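/- Let $k$ be a field. Algebras are of the form $R=k\langle X\rangle/I$ with $X$ a finite set of generators of degree $1$ and $I$ a homogeneous two-sided ideal. Let $E(R)=\bigoplus_{i,j}E^{i,j}(R)$, $E^{i,j}(R)=\operatorname{Ext}_R^{i,j}(k,k)$, be the bigraded Yoneda algebra ($i$ the cohomological, $j$ the internal degree), and $E^i(R)=\bigoplus_j E^{i,j}(R)$. The algebra $R$ is called Koszul if $E(R)$ is generated as a $k$-algebra by $E^1(R)$, and $\mathcal K_2$ if $E(R)$ is generated as a $k$-algebra by $E^1(R)$ and $E^2(R)$. For an integer $d>2$, $R$ is called $2$-$d$-determined if $I$ can be generated by elements of degrees $2$ and $d$ and $E^{i,j}(R)=0$ unless $j\le\delta(i)$, where $\delta(2m)=dm$ and $\delta(2m+1)=dm+1$. **Theorem.** Let $k$ be any field and let $$A=\frac{k\langle a,b,n,p,q,r,s,t,u,v,w,x,y\rangle}{\left\langle\begin{matrix}np-nq,\ np-nr,\ ps-pt,\ qt-qu,\ rs-ru,\ sv-sw,\ tw-tx,\\ uv-ux,\ sv-sy,\ tw-ty,\ ux-uy,\ va-vb,\ wa-wb,\ xa-xb\end{matrix}\right\rangle},\qquad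 B=\frac{k\langle z\rangle}{\langle z^4\rangle},\qquad C=A\sqcup B,$$ where $\sqcup$ denotes the free product (coproduct) of $k$-algebras. Then $A$ is a quadratic algebra of finite global dimension which is not Koszul, and $C$ is a $2$-$4$-determined algebra of infinite global dimension whose Yoneda algebra $E(C)$ is finitely generated as a $k$-algebra but which is not $\mathcal K_2$. In particular, there is a $2$-$d$-determined algebra of infinite global dimension whose Yoneda algebra is finitely generated but which is not $\mathcal K_2$. -/

import Mathlib

universe u v

set_option linter.unusedSectionVars false

/-! ### Cochains of the reduced bar construction -/

/-- A cochain on `M` with values in `k`: a function on finite sequences `[m₁, …, mₙ]` of elements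
of `M`.  The functions that matter are the multilinear ones, see `BarCochain.homogeneous`. -/
def BarCochain (k : Type u) (M : Type v) : Type (max u v) := List M → k

namespace BarCochain

section Ring

variable {k : Type u} {M : Type v} [Field k]

instance : AddCommGroup (BarCochain k M) := inferInstanceAs (AddCommGroup (List M → k))

instance : Module k (BarCochain k M) := inferInstanceAs (Module k (List M → k))

@[ext]
theorem ext {f g : BarCochain k M} (h : ∀ l, f l = g l) : f = g := funext h

@[simp] theorem add_apply (f g : BarCochain k M) (l : List M) : (f + g) l = f l + g l := rfl

@[simp] theorem sub_apply (f g : BarCochain k M) (l : List M) : (f - g) l = f l - g l := rfl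

@[simp] theorem neg_apply (f : BarCochain k M) (l : List M) : (-f) l = -f l := rfl

@[simp] theorem zero_apply (l : List M) : (0 : BarCochain k M) l = 0 := rfl

@[simp] theorem smul_apply (c : k) (f : BarCochain k M) (l : List M) : (c • f) l = c * f l := rfl

/-- The concatenation (cup) product:
`(f * g) [m₁, …, mₙ] = ∑ i, f [m₁, …, mᵢ] * g [mᵢ₊₁, …, mₙ]`. -/
instance : Mul (BarCochain k M) :=
  ⟨fun f g l => ∑ i ∈ Finset.range (l.length + 1), f (l.take i) * g (l.drop i)⟩

/-- The unit: the cochain that is `1` on the empty sequence and `0` elsewhere. -/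
instance : One (BarCochain k M) := ⟨fun l => if l.length = 0 then 1 else 0⟩

theorem mul_apply (f g : BarCochain k M) (l : List M) :
    (f * g) l = ∑ i ∈ Finset.range (l.length + 1), f (l.take i) * g (l.drop i) := rfl

theorem one_apply (l : List M) : (1 : BarCochain k M) l = if l.length = 0 then 1 else 0 := rfl

/-- The cochain `l ↦ f (x :: l)`. -/
def tail (x : M) (f : BarCochain k M) : BarCochain k M := fun l => f (x :: l)

@[simp] theorem tail_apply (x : M) (f : BarCochain k M) (l : List M) : tail x f l = f (x :: l) :=
  rfl

theorem mul_nil (f g : BarCochain k M) : (f * g) [] = f [] * g [] := by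
  simp [mul_apply]

theorem mul_cons (f g : BarCochain k M) (x : M) (l : List M) :
    (f * g) (x :: l) = (tail x f * g) l + f [] * g (x :: l) := by
  simp [mul_apply, Finset.sum_range_succ' _ (l.length + 1)]

theorem add_mul' (f g h : BarCochain k M) : (f + g) * h = f * h + g * h := by
  ext l; simp [mul_apply, add_mul, Finset.sum_add_distrib]

theorem mul_add' (f g h : BarCochain k M) : f * (g + h) = f * g + f * h := by
  ext l; simp [mul_apply, mul_add, Finset.sum_add_distrib]

theorem smul_mul' (c : k) (f g : BarCochain k M) : (c • f) * g = c • (f * g) := by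
  ext l; simp [mul_apply, mul_assoc, Finset.mul_sum]

theorem mul_smul' (c : k) (f g : BarCochain k M) : f * (c • g) = c • (f * g) := by
  ext l; simp [mul_apply, mul_left_comm, Finset.mul_sum]

theorem tail_mul (x : M) (f g : BarCochain k M) :
    tail x (f * g) = tail x f * g + f [] • tail x g := by
  ext l; simp [mul_cons]

theorem mul_assoc_apply (l : List M) : ∀ f g h : BarCochain k M,
    (f * g * h) l = (f * (g * h)) l := by
  induction l with
  | nil => intro f g h; simp [mul_nil, mul_assoc]
  | cons x l ih =>
    intro f g h
    rw [mul_cons, mul_cons f, mul_cons g, tail_mul, add_mul', add_apply, ih, smul_mul', smul_apply,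
      mul_nil]
    ring

theorem tail_one (x : M) : tail x (1 : BarCochain k M) = 0 := by
  ext l; simp [one_apply]

theorem one_mul_apply (f : BarCochain k M) (l : List M) : (1 * f) l = f l := by
  cases l with
  | nil => simp [mul_nil, one_apply]
  | cons x l =>
    rw [mul_cons, tail_one]
    simp [mul_apply, one_apply]

theorem mul_one_apply (l : List M) : ∀ f : BarCochain k M, (f * 1) l = f l := by
  induction l with
  | nil => intro f; simp [mul_nil, one_apply]
  | cons x l ih => intro f; rw [mul_cons, ih]; simp [one_apply]

instance : Ring (BarCochain k M) :=
  { (inferInstance : AddCommGroup (BarCochain k M)),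
    (inferInstance : Mul (BarCochain k M)),
    (inferInstance : One (BarCochain k M)) with
    left_distrib := mul_add'
    right_distrib := add_mul'
    zero_mul := fun f => by ext l; simp [mul_apply]
    mul_zero := fun f => by ext l; simp [mul_apply]
    mul_assoc := fun f g h => ext fun l => mul_assoc_apply l f g h
    one_mul := fun f => ext (one_mul_apply f)
    mul_one := fun f => ext fun l => mul_one_apply l f }

instance : Algebra k (BarCochain k M) := Algebra.ofModule smul_mul' mul_smul'

end Ring

section Differential

variable {k : Type u} {M : Type v} [Field k] [NonUnitalRing M]

/-- Replaces the entries in positions `i` and `i + 1` (counted from `0`) by their product. -/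
def contract : ℕ → List M → List M
  | 0, x :: y :: l => (x * y) :: l
  | i + 1, x :: l => x :: contract i l
  | _, _ => []

/-- The differential of the dual of the reduced bar construction:
`(d f) [m₀, …, mₙ] = ∑_{i < n} (-1)ⁱ f [m₀, …, mᵢ mᵢ₊₁, …, mₙ]`. -/
def d : BarCochain k M →ₗ[k] BarCochain k M where
  toFun f := fun l => ∑ i ∈ Finset.range (l.length - 1), (-1) ^ i * f (contract i l)
  map_add' f g := funext fun l => by
    change _ = (∑ i ∈ Finset.range (l.length - 1), (-1 : k) ^ i * f (contract i l)) +
      ∑ i ∈ Finset.range (l.length - 1), (-1 : k) ^ i * g (contract i l)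
    simp [mul_add, Finset.sum_add_distrib]
  map_smul' c f := funext fun l => by
    change _ = c * (∑ i ∈ Finset.range (l.length - 1), (-1 : k) ^ i * f (contract i l))
    simp [Finset.mul_sum, mul_left_comm]

theorem d_apply (f : BarCochain k M) (l : List M) :
    d f l = ∑ i ∈ Finset.range (l.length - 1), (-1) ^ i * f (contract i l) := rfl

@[simp] theorem d_nil (f : BarCochain k M) : d f [] = 0 := by simp [d_apply]

@[simp] theorem d_singleton (f : BarCochain k M) (x : M) : d f [x] = 0 := by simp [d_apply]

theorem d_cons (f : BarCochain k M) (x y : M) (l : List M) :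
    d f (x :: y :: l) = f ((x * y) :: l) - d (tail x f) (y :: l) := by
  simp [d_apply, Finset.sum_range_succ', contract, pow_succ, sub_eq_add_neg, add_comm]

/-- The sign twist `f ↦ (-1)ⁿ f` on cochains of cohomological degree `n`. -/
def sign (f : BarCochain k M) : BarCochain k M := fun l => (-1) ^ l.length * f l

theorem tail_sign (x : M) (f : BarCochain k M) : tail x (sign f) = -sign (tail x f) := by
  ext l; simp [sign, pow_succ]

theorem d_mul_apply (l : List M) : ∀ f g : BarCochain k M,
    d (f * g) l = (d f * g) l + (sign f * d g) l := by
  induction l with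
  | nil => intro f g; simp [mul_nil]
  | cons x l ih =>
    intro f g
    cases l with
    | nil => simp [mul_cons, mul_nil]
    | cons y l =>
      have e : tail y (tail x (d f)) = tail (x * y) f - tail y (d (tail x f)) := by
        ext m; simp [d_cons]
      have h1 : (d f * g) (x :: y :: l) = (tail (x * y) f * g) l - (d (tail x f) * g) (y :: l) := by
        rw [mul_cons, mul_cons, mul_cons, e, sub_mul]
        simp
      have h2 : (sign f * d g) (x :: y :: l) =
          -(sign (tail x f) * d g) (y :: l) + f [] * d g (x :: y :: l) := by
        rw [mul_cons, tail_sign, neg_mul]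
        simp [sign]
      rw [h1, h2, d_cons, tail_mul, map_add, add_apply, ih, map_smul, smul_apply, mul_cons,
        d_cons g]
      ring

theorem d_mul (f g : BarCochain k M) : d (f * g) = d f * g + sign f * d g :=
  ext fun l => d_mul_apply l f g

theorem d_one : d (1 : BarCochain k M) = 0 := by
  ext l
  match l with
  | [] => simp
  | [x] => simp
  | x :: y :: l => rw [d_cons, tail_one]; simp [one_apply]

end Differential

section Homogeneous

variable {k : Type u} {M : Type v} [Field k] [AddCommGroup M] [Module k M]

/-- Cochains of bidegree `(n, j)` on a graded vector space `M = ⨁ ℳ e`: `k`-multilinear functions of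
`n` variables (extended by `0` to sequences of other lengths) that vanish on all sequences of
homogeneous elements whose degrees do not sum up to `j`; that is, the dual of the degree `j` part of
the `n`-fold tensor power of `M`. -/
def homogeneous (ℳ : ℕ → Submodule k M) (n j : ℕ) : Submodule k (BarCochain k M) where
  carrier := {f |
    (∀ (a b : List M) (x y : M), f (a ++ (x + y) :: b) = f (a ++ x :: b) + f (a ++ y :: b)) ∧
    (∀ (a b : List M) (c : k) (x : M), f (a ++ (c • x) :: b) = c * f (a ++ x :: b)) ∧
    (∀ l : List M, l.length ≠ n → f l = 0) ∧
    (∀ (l : List M) (e : List ℕ), List.Forall₂ (fun x i => x ∈ ℳ i) l e → e.sum ≠ j → f l = 0)}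
  add_mem' := by
    rintro f g ⟨f1, f2, f3, f4⟩ ⟨g1, g2, g3, g4⟩
    refine ⟨fun a b x y => ?_, fun a b c x => ?_, fun l hl => ?_, fun l e h he => ?_⟩
    · simp only [add_apply, f1, g1]; ring
    · simp only [add_apply, f2, g2]; ring
    · simp [f3 l hl, g3 l hl]
    · simp [f4 l e h he, g4 l e h he]
  zero_mem' := by simp
  smul_mem' := by
    rintro c f ⟨f1, f2, f3, f4⟩
    refine ⟨fun a b x y => ?_, fun a b c x => ?_, fun l hl => ?_, fun l e h he => ?_⟩
    · simp only [smul_apply, f1]; ring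
    · simp only [smul_apply, f2]; ring
    · simp [f3 l hl]
    · simp [f4 l e h he]

variable {ℳ : ℕ → Submodule k M}

theorem one_mem_homogeneous : (1 : BarCochain k M) ∈ homogeneous ℳ 0 0 := by
  refine ⟨fun a b x y => ?_, fun a b c x => ?_, fun l hl => ?_, fun l e h he => ?_⟩
  · simp [one_apply]
  · simp [one_apply]
  · simp [one_apply]; simpa using hl
  · cases h with
    | nil => simp at he
    | cons _ _ => simp [one_apply]

theorem mul_eq_of_mem {n j : ℕ} {f : BarCochain k M} (hf : f ∈ homogeneous ℳ n j)
    (g : BarCochain k M) (l : List M) : (f * g) l = f (l.take n) * g (l.drop n) := by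
  rw [mul_apply]
  by_cases hn : n ≤ l.length
  · refine Finset.sum_eq_single n (fun i hi hin => ?_) (fun h => ?_)
    · rw [hf.2.2.1, zero_mul]
      rw [Finset.mem_range] at hi
      rw [List.length_take]; omega
    · exact absurd (Finset.mem_range.2 (by omega)) h
  · rw [hf.2.2.1 (l.take n) (by rw [List.length_take]; omega), zero_mul]
    refine Finset.sum_eq_zero fun i hi => ?_
    rw [hf.2.2.1, zero_mul]
    rw [Finset.mem_range] at hi
    rw [List.length_take]; omega

theorem mul_mem_homogeneous {n j n' j' : ℕ} {f g : BarCochain k M}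
    (hf : f ∈ homogeneous ℳ n j) (hg : g ∈ homogeneous ℳ n' j') :
    f * g ∈ homogeneous ℳ (n + n') (j + j') := by
  have key : ∀ (a b : List M), (∃ b' b'' : List M, ∀ x : M,
        (f * g) (a ++ x :: b) = f (a ++ x :: b') * g b'') ∨
      (∃ a' a'' : List M, ∀ x : M, (f * g) (a ++ x :: b) = f a' * g (a'' ++ x :: b)) := by
    intro a b
    by_cases h : a.length < n
    · left
      obtain ⟨m, hm⟩ : ∃ m, n = a.length + (m + 1) := ⟨n - a.length - 1, by omega⟩
      refine ⟨b.take m, b.drop m, fun x => ?_⟩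
      rw [mul_eq_of_mem hf, hm, List.take_length_add_append, List.drop_length_add_append]
      simp
    · right
      refine ⟨a.take n, a.drop n, fun x => ?_⟩
      rw [mul_eq_of_mem hf, List.take_append_of_le_length (by omega),
        List.drop_append_of_le_length (by omega)]
  refine ⟨fun a b x y => ?_, fun a b c x => ?_, fun l hl => ?_, fun l e h he => ?_⟩
  · rcases key a b with ⟨b', b'', h⟩ | ⟨a', a'', h⟩
    · rw [h, h, h, hf.1]; ring
    · rw [h, h, h, hg.1]; ring
  · rcases key a b with ⟨b', b'', h⟩ | ⟨a', a'', h⟩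
    · rw [h, h, hf.2.1]; ring
    · rw [h, h, hg.2.1]; ring
  · rw [mul_eq_of_mem hf]
    by_cases h : (l.take n).length = n
    · rw [hg.2.2.1, mul_zero]
      rw [List.length_take] at h
      rw [List.length_drop]; omega
    · rw [hf.2.2.1 _ h, zero_mul]
  · rw [mul_eq_of_mem hf]
    by_cases h1 : (e.take n).sum = j
    · rw [hg.2.2.2 _ (e.drop n) (List.forall₂_drop n h), mul_zero]
      intro h2
      exact he (by rw [← h1, ← h2, ← List.sum_append, List.take_append_drop])
    · rw [hf.2.2.2 _ (e.take n) (List.forall₂_take n h) h1, zero_mul]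

end Homogeneous

section Cohomology

variable {k : Type u} {M : Type v} [Field k] [NonUnitalRing M] [Module k M]

theorem sign_eq_of_mem {ℳ : ℕ → Submodule k M} {n j : ℕ} {f : BarCochain k M}
    (hf : f ∈ homogeneous ℳ n j) : sign f = (-1 : k) ^ n • f := by
  ext l
  by_cases h : l.length = n
  · simp [sign, h]
  · simp [sign, hf.2.2.1 l h]

/-- Cocycles of bidegree `(n, j)`. -/
def cocycles (ℳ : ℕ → Submodule k M) (n j : ℕ) : Submodule k (BarCochain k M) :=
  homogeneous ℳ n j ⊓ LinearMap.ker d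

/-- Coboundaries of bidegree `(n, j)`: the image of the cochains of bidegree `(n - 1, j)` under `d`.
(Coboundaries are cocycles, as `d ∘ d = 0`; the intersection records this.) -/
def coboundaries (ℳ : ℕ → Submodule k M) : ℕ → ℕ → Submodule k (BarCochain k M)
  | 0, _ => ⊥
  | n + 1, j => cocycles ℳ (n + 1) j ⊓ (homogeneous ℳ n j).map d

variable {ℳ : ℕ → Submodule k M}

theorem coboundaries_le (n j : ℕ) : coboundaries ℳ n j ≤ cocycles ℳ n j := by
  cases n with
  | zero => exact bot_le
  | succ n => exact inf_le_left

theorem one_mem_cocycles : (1 : BarCochain k M) ∈ cocycles ℳ 0 0 :=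
  ⟨one_mem_homogeneous, d_one⟩

theorem mul_mem_cocycles {n j n' j' : ℕ} {f g : BarCochain k M}
    (hf : f ∈ cocycles ℳ n j) (hg : g ∈ cocycles ℳ n' j') :
    f * g ∈ cocycles ℳ (n + n') (j + j') := by
  refine ⟨mul_mem_homogeneous hf.1 hg.1, ?_⟩
  have h1 : d f = 0 := hf.2
  have h2 : d g = 0 := hg.2
  change d (f * g) = 0
  rw [d_mul, h1, h2, zero_mul, mul_zero, add_zero]

theorem mul_mem_coboundaries_right {n j n' j' : ℕ} {f g : BarCochain k M}
    (hf : f ∈ cocycles ℳ n j) (hg : g ∈ coboundaries ℳ n' j') :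
    f * g ∈ coboundaries ℳ (n + n') (j + j') := by
  cases n' with
  | zero =>
    have : g = 0 := hg
    rw [this, mul_zero]; exact zero_mem _
  | succ n' =>
    have h0 : f * g ∈ cocycles ℳ (n + (n' + 1)) (j + j') := mul_mem_cocycles hf hg.1
    refine ⟨h0, ?_⟩
    obtain ⟨h, hh, rfl⟩ := hg.2
    refine ⟨(-1 : k) ^ n • (f * h), Submodule.smul_mem _ _ (mul_mem_homogeneous hf.1 hh), ?_⟩
    have h1 : d f = 0 := hf.2
    rw [map_smul, d_mul, h1, zero_mul, zero_add, sign_eq_of_mem hf.1, smul_mul', smul_smul,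
      ← mul_pow]
    simp

theorem mul_mem_coboundaries_left {n j n' j' : ℕ} {f g : BarCochain k M}
    (hf : f ∈ coboundaries ℳ n j) (hg : g ∈ cocycles ℳ n' j') :
    f * g ∈ coboundaries ℳ (n + n') (j + j') := by
  cases n with
  | zero =>
    have : f = 0 := hf
    rw [this, zero_mul]; exact zero_mem _
  | succ n =>
    have h0 := mul_mem_cocycles hf.1 hg
    rw [Nat.add_right_comm n 1 n'] at h0 ⊢
    refine ⟨h0, ?_⟩
    obtain ⟨h, hh, rfl⟩ := hf.2
    refine ⟨h * g, mul_mem_homogeneous hh hg.1, ?_⟩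
    have h1 : d g = 0 := hg.2
    rw [d_mul, h1, mul_zero, add_zero]

variable (ℳ)

/-- The algebra of all cocycles, `⨁ₙⱼ cocycles ℳ n j`. -/
def cocycleAlgebra : Subalgebra k (BarCochain k M) :=
  (⨆ (n : ℕ) (j : ℕ), cocycles ℳ n j).toSubalgebra
    (Submodule.mem_iSup_of_mem 0 (Submodule.mem_iSup_of_mem 0 one_mem_cocycles))
    (by
      intro f g hf hg
      refine (?_ : (⨆ (n : ℕ) (j : ℕ), cocycles ℳ n j) * (⨆ (n : ℕ) (j : ℕ), cocycles ℳ n j) ≤ _)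
        (Submodule.mul_mem_mul hf hg)
      simp only [Submodule.iSup_mul, Submodule.mul_iSup, iSup_le_iff]
      intro n j n' j'
      refine Submodule.mul_le.2 fun a ha b hb => ?_
      exact Submodule.mem_iSup_of_mem _ (Submodule.mem_iSup_of_mem _ (mul_mem_cocycles ‹_› ‹_›)))

/-- The ideal of coboundaries, `⨁ₙⱼ coboundaries ℳ n j`, of the algebra of cocycles. -/
def coboundaryIdeal : Ideal (cocycleAlgebra ℳ) where
  carrier := {f | (f : BarCochain k M) ∈ ⨆ (n : ℕ) (j : ℕ), coboundaries ℳ n j}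
  add_mem' hf hg := Submodule.add_mem (⨆ (n : ℕ) (j : ℕ), coboundaries ℳ n j) hf hg
  zero_mem' := Submodule.zero_mem (⨆ (n : ℕ) (j : ℕ), coboundaries ℳ n j)
  smul_mem' := by
    intro f g hg
    refine (?_ : (⨆ (n : ℕ) (j : ℕ), cocycles ℳ n j) * (⨆ (n : ℕ) (j : ℕ), coboundaries ℳ n j) ≤
      ⨆ (n : ℕ) (j : ℕ), coboundaries ℳ n j) (Submodule.mul_mem_mul f.2 hg)
    simp only [Submodule.iSup_mul, Submodule.mul_iSup, iSup_le_iff]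
    intro n j n' j'
    refine Submodule.mul_le.2 fun a ha b hb => ?_
    exact Submodule.mem_iSup_of_mem _
      (Submodule.mem_iSup_of_mem _ (mul_mem_coboundaries_right ‹_› ‹_›))

instance : (coboundaryIdeal ℳ).IsTwoSided where
  mul_mem_of_left := by
    intro f g hf
    have hf' : (f : BarCochain k M) ∈ ⨆ (n : ℕ) (j : ℕ), coboundaries ℳ n j := hf
    refine (?_ : (⨆ (n : ℕ) (j : ℕ), coboundaries ℳ n j) * (⨆ (n : ℕ) (j : ℕ), cocycles ℳ n j) ≤
      ⨆ (n : ℕ) (j : ℕ), coboundaries ℳ n j) (Submodule.mul_mem_mul hf' g.2)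
    simp only [Submodule.iSup_mul, Submodule.mul_iSup, iSup_le_iff]
    intro n j n' j'
    refine Submodule.mul_le.2 fun a ha b hb => ?_
    exact Submodule.mem_iSup_of_mem _
      (Submodule.mem_iSup_of_mem _ (mul_mem_coboundaries_left ‹_› ‹_›))

end Cohomology

end BarCochain

/-! ### The Yoneda algebra of a connected graded algebra -/

section Yoneda

variable {k : Type u} {A : Type v} [Field k] [Ring A] [Algebra k A]

/-- The augmentation ideal `A₊ = ⨁_{j ≥ 1} A_j` of a graded algebra. -/
def augmentationIdeal (𝒜 : ℕ → Submodule k A) [SetLike.GradedMonoid 𝒜] :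
    NonUnitalSubalgebra k A where
  __ := ⨆ j : ℕ, 𝒜 (j + 1)
  mul_mem' := by
    intro f g hf hg
    refine (?_ : (⨆ j : ℕ, 𝒜 (j + 1)) * (⨆ j : ℕ, 𝒜 (j + 1)) ≤ _) (Submodule.mul_mem_mul hf hg)
    simp only [Submodule.iSup_mul, Submodule.mul_iSup, iSup_le_iff]
    intro i j
    refine Submodule.mul_le.2 fun a ha b hb => ?_
    refine Submodule.mem_iSup_of_mem (j + 1 + i) ?_
    exact SetLike.GradedMul.mul_mem (i := j + 1) (j := i + 1) ha hb

/-- The graded components of `A₊`. -/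
def augmentationGrading (𝒜 : ℕ → Submodule k A) [SetLike.GradedMonoid 𝒜] (j : ℕ) :
    Submodule k (augmentationIdeal 𝒜) :=
  (𝒜 j).comap (augmentationIdeal 𝒜).toSubmodule.subtype

variable (𝒜 : ℕ → Submodule k A) [SetLike.GradedMonoid 𝒜]

/-- The Yoneda algebra `E(A) = ⨁ Ext_A^{i,j}(k, k)` of a connected graded `k`-algebra
`A = ⨁ 𝒜 j`: the cohomology algebra of the complex `⨁ Hom_k((A₊^{⊗ i})_j, k)` obtained by applying
the graded `Hom_A(-, k)` to the bar resolution `A ⊗ A₊^{⊗ •}` of `k`. -/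
abbrev YonedaAlgebra : Type (max u v) :=
  BarCochain.cocycleAlgebra (augmentationGrading 𝒜) ⧸
    BarCochain.coboundaryIdeal (augmentationGrading 𝒜)

/-- The component `E^{i,j}(A) = Ext_A^{i,j}(k, k)`, with `i` the cohomological and `j` the internal
degree. -/
def YonedaAlgebra.bigraded (i j : ℕ) : Submodule k (YonedaAlgebra 𝒜) :=
  ((BarCochain.cocycles (augmentationGrading 𝒜) i j).comap
    (BarCochain.cocycleAlgebra (augmentationGrading 𝒜)).val.toLinearMap).map
      (Ideal.Quotient.mkₐ k (BarCochain.coboundaryIdeal (augmentationGrading 𝒜))).toLinearMap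

/-- The component `E^i(A) = ⨁ⱼ E^{i,j}(A)`. -/
def YonedaAlgebra.component (i : ℕ) : Submodule k (YonedaAlgebra 𝒜) :=
  ⨆ j : ℕ, YonedaAlgebra.bigraded 𝒜 i j

/-- `A` is Koszul: `E(A)` is generated as a `k`-algebra by `E¹(A)`. -/
def IsKoszul : Prop :=
  Algebra.adjoin k (YonedaAlgebra.component 𝒜 1 : Set (YonedaAlgebra 𝒜)) = ⊤

/-- `A` is `𝒦₂`: `E(A)` is generated as a `k`-algebra by `E¹(A)` and `E²(A)`. -/
def IsK2 : Prop :=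
  Algebra.adjoin k ((YonedaAlgebra.component 𝒜 1 : Set (YonedaAlgebra 𝒜)) ∪
    (YonedaAlgebra.component 𝒜 2 : Set (YonedaAlgebra 𝒜))) = ⊤

end Yoneda

/-! ### Quotients of free algebras -/

section Presented

variable {k : Type u} [Field k] {X Y : Type}

/-- The degree `j` component of the free algebra on `X`, where every generator has degree `1`. -/
def freeComponent (k : Type u) [Field k] (X : Type) (j : ℕ) : Submodule k (FreeAlgebra k X) :=
  Submodule.span k (Set.range (FreeAlgebra.ι k : X → FreeAlgebra k X)) ^ j

/-- The algebra `k⟨X⟩ / I`. -/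
abbrev QuotAlgebra (I : TwoSidedIdeal (FreeAlgebra k X)) : Type u := I.ringCon.Quotient

/-- The class of the generator `x` in `k⟨X⟩ / I`. -/
def QuotAlgebra.gen (I : TwoSidedIdeal (FreeAlgebra k X)) (x : X) : QuotAlgebra I :=
  I.ringCon.mk' (FreeAlgebra.ι k x)

/-- The grading of `k⟨X⟩ / I`, for a homogeneous ideal `I`, in which the generators have degree `1`:
the component of degree `j` is spanned by the products of `j` generators. -/
abbrev QuotAlgebra.grading (I : TwoSidedIdeal (FreeAlgebra k X)) :
    ℕ → Submodule k (QuotAlgebra I) :=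
  fun j => Submodule.span k (Set.range (QuotAlgebra.gen I)) ^ j

/-- `k⟨X⟩ / I` is a quadratic algebra: `X` is finite and `I` can be generated by elements of
degree `2`. -/
def IsQuadratic (I : TwoSidedIdeal (FreeAlgebra k X)) : Prop :=
  Finite X ∧ ∃ S : Set (FreeAlgebra k X),
    S ⊆ freeComponent k X 2 ∧ I = TwoSidedIdeal.span S

/-- `δ(2m) = dm` and `δ(2m + 1) = dm + 1`. -/
def koszulDegree (d i : ℕ) : ℕ := d * (i / 2) + i % 2

/-- `R = k⟨X⟩ / I` is 2-`d`-determined, for `d > 2`: `X` is finite, `I` can be generated by elements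
of degrees `2` and `d`, and `E^{i,j}(R) = 0` unless `j ≤ δ(i)`. -/
def IsTwoDetermined (d : ℕ) (I : TwoSidedIdeal (FreeAlgebra k X)) : Prop :=
  2 < d ∧ Finite X ∧
  (∃ S : Set (FreeAlgebra k X),
    S ⊆ (freeComponent k X 2 : Set (FreeAlgebra k X)) ∪ freeComponent k X d ∧
    I = TwoSidedIdeal.span S) ∧
  ∀ i j : ℕ, koszulDegree d i < j → YonedaAlgebra.bigraded (QuotAlgebra.grading I) i j = ⊥

/-- The ideal of relations of the free product `k⟨X⟩ / I ⊔ k⟨Y⟩ / J = k⟨X ⊔ Y⟩ / ⟨I, J⟩`. -/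
def freeProductIdeal (I : TwoSidedIdeal (FreeAlgebra k X)) (J : TwoSidedIdeal (FreeAlgebra k Y)) :
    TwoSidedIdeal (FreeAlgebra k (X ⊕ Y)) :=
  TwoSidedIdeal.span
    (FreeAlgebra.lift k (fun x => FreeAlgebra.ι k (Sum.inl x : X ⊕ Y)) '' (I : Set (FreeAlgebra k X)) ∪
      FreeAlgebra.lift k (fun y => FreeAlgebra.ι k (Sum.inr y : X ⊕ Y)) '' (J : Set (FreeAlgebra k Y)))

/-- `C`, with the maps `iA` and `iB`, is the free product (the coproduct of `k`-algebras) of `A`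
and `B`. -/
def IsFreeProduct {A B C : Type u} [Ring A] [Ring B] [Ring C] [Algebra k A] [Algebra k B]
    [Algebra k C] (iA : A →ₐ[k] C) (iB : B →ₐ[k] C) : Prop :=
  ∀ (D : Type u) [Ring D] [Algebra k D] (f : A →ₐ[k] D) (g : B →ₐ[k] D),
    ∃! h : C →ₐ[k] D, h.comp iA = f ∧ h.comp iB = g

end Presented

/-- The (left) global dimension of a ring: the supremum of the projective dimensions of its left
modules. -/
noncomputable def leftGlobalDimension (R : Type u) [Ring R] : WithBot ℕ∞ :=
  ⨆ M : ModuleCat.{u} R, CategoryTheory.projectiveDimension M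

/-! ### The example -/

/-- The thirteen generators of the algebra `A`. -/
inductive GenA : Type
  | a | b | n | p | q | r | s | t | u | v | w | x | y

/-- The generator `z` of the algebra `B`. -/
inductive GenB : Type
  | z

/-- The product `gh` of two generators, as an element of the free algebra. -/
def word2 (k : Type u) [Field k] (g h : GenA) : FreeAlgebra k GenA :=
  FreeAlgebra.ι k g * FreeAlgebra.ι k h

open GenA in
/-- The ideal of relations of `A`. -/
def idealA (k : Type u) [Field k] : TwoSidedIdeal (FreeAlgebra k GenA) :=
  TwoSidedIdeal.span
    {word2 k n p - word2 k n q, word2 k n p - word2 k n r, word2 k p s - word2 k p t,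
      word2 k q t - word2 k q u, word2 k r s - word2 k r u, word2 k s v - word2 k s w,
      word2 k t w - word2 k t x, word2 k u v - word2 k u x, word2 k s v - word2 k s y,
      word2 k t w - word2 k t y, word2 k u x - word2 k u y, word2 k v a - word2 k v b,
      word2 k w a - word2 k w b, word2 k x a - word2 k x b}

/-- The ideal of relations of `B = k⟨z⟩ / ⟨z⁴⟩`. -/
def idealB (k : Type u) [Field k] : TwoSidedIdeal (FreeAlgebra k GenB) :=
  TwoSidedIdeal.span {FreeAlgebra.ι k GenB.z ^ 4}

/-- The ideal of relations of `C = A ⊔ B`. -/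
def idealC (k : Type u) [Field k] : TwoSidedIdeal (FreeAlgebra k (GenA ⊕ GenB)) :=
  freeProductIdeal (idealA k) (idealB k)

/-! Every relation of `C` either equates two words or kills one, so `C` has a basis of normal words
in which the product of two basis words is a basis word or zero. Which letters are identified
depends only on the two preceding letters. Instead of a rewriting argument, `C` acts from the right
on the space of all lists of letters; the relations hold there by a finite check (`canon_relation`),
and acting on the empty word separates normal words.

The relations of `A` follow paths through five layers, n, then p q r, then s t u, then v w x y, then
a b. Adjacent letters interact only if their layers are consecutive or if both are z. Any other
adjacency is a break, and normal words can be cut and glued at breaks (`isNormalWord_append_iff`).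
Both the homological and the cohomological arguments exploit this.

Global dimension of `A`: consider generators of a module on which letters of certain layers are
absorbed, that is, map generators to combinations of generators absorbing the layer below, while all
other words act freely. The first syzygy has generators of the same type, indexed by connected
words, and absorbs strictly lower layers (`LayeredFamily.syzygy`). Any module is of this type with
all layers absorbed, so after five steps the syzygy is free.

Global dimension of `C`: the kernels of right multiplication by z and by z³ are the left ideals Cz³
and Cz. These ideals are therefore syzygies of each other, and neither is projective.

Cohomology of `C`: cutting lists of words at their first break gives a contracting homotopy that
removes from a cocycle all lists with a break. An unbroken list outside z runs through the five
layers and has degree at most 5, so in internal degree at least 6 only lists of powers of z remain.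
Normalising these as for the truncated polynomial algebra k[z]/(z⁴) shows that every such class in
cohomological degree at least 2 is a multiple of the class of z⁴ in bidegree (2,4)
(`IsWordBasis.exists_quart_mul`). This gives finite generation, and, with the vanishing of E^{1,j}
for j ≠ 1 and of E^{2,j} for j ≠ 2, 4, it gives the bound j ≤ δ(i).

Failure of generation: E¹ and E² live in bidegrees (1,1), (2,2) and (2,4), all of even total degree,
whereas E^{4,5} ≠ 0. The reason is that ya ≠ yb although sya = syb, tya = tyb and uya = uyb. Hence
n|(p−r)|(s−t)|y(a−b) + n|(q−r)|(t−u)|y(a−b) is a bar cycle, and an explicit integral cocycle takes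
the value 1 on it. Restricting that cocycle to `A` shows that `A` is not Koszul. -/

set_option linter.constructorNameAsVariable false

/-! ### Homomorphisms out of presented algebras -/

section Presentation

variable {k : Type u} [Field k] {X Y : Type}

namespace QuotAlgebra

/-- The quotient map `k⟨X⟩ → k⟨X⟩ / I`. -/
def mkHom (I : TwoSidedIdeal (FreeAlgebra k X)) : FreeAlgebra k X →ₐ[k] QuotAlgebra I :=
  I.ringCon.mkₐ k

theorem mkHom_surjective (I : TwoSidedIdeal (FreeAlgebra k X)) :
    Function.Surjective (mkHom I) :=
  RingCon.mkₐ_surjective (α := k) I.ringCon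

@[simp] theorem mkHom_ι (I : TwoSidedIdeal (FreeAlgebra k X)) (x : X) :
    mkHom I (FreeAlgebra.ι k x) = gen I x := rfl

theorem mkHom_eq_zero_iff {I : TwoSidedIdeal (FreeAlgebra k X)} {a : FreeAlgebra k X} :
    mkHom I a = 0 ↔ a ∈ I := by
  have h := TwoSidedIdeal.ker_ringCon_mk' I
  have h2 : a ∈ TwoSidedIdeal.ker I.ringCon.mk' ↔ I.ringCon.mk' a = 0 := TwoSidedIdeal.mem_ker _
  rw [h] at h2
  exact h2.symm

theorem hom_ext {I : TwoSidedIdeal (FreeAlgebra k X)} {R : Type*} [Ring R] [Algebra k R]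
    {f g : QuotAlgebra I →ₐ[k] R} (h : ∀ x, f (gen I x) = g (gen I x)) : f = g := by
  have h2 : f.comp (mkHom I) = g.comp (mkHom I) := by
    ext x; exact h x
  refine AlgHom.ext fun a => ?_
  obtain ⟨a, rfl⟩ := mkHom_surjective I a
  exact DFunLike.congr_fun h2 a

/-- The homomorphism from `k⟨X⟩ / ⟨S⟩` given by images of the generators that satisfy the
relations. -/
def liftHom {I : TwoSidedIdeal (FreeAlgebra k X)} {S : Set (FreeAlgebra k X)}
    (hI : I = TwoSidedIdeal.span S) {R : Type*} [Ring R] [Algebra k R] (g : X → R)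
    (hS : ∀ a ∈ S, FreeAlgebra.lift k g a = 0) : QuotAlgebra I →ₐ[k] R :=
  RingCon.liftₐ I.ringCon (FreeAlgebra.lift k g) (by
    have h1 : I ≤ TwoSidedIdeal.ker (FreeAlgebra.lift k g : FreeAlgebra k X →+* R) := by
      rw [hI, TwoSidedIdeal.span_le]
      intro a ha
      exact (TwoSidedIdeal.mem_ker _).2 (hS a ha)
    intro a b hab
    have h2 : a - b ∈ I := (TwoSidedIdeal.rel_iff I a b).1 hab
    have h3 := (TwoSidedIdeal.mem_ker _).1 (h1 h2)
    have h4 : FreeAlgebra.lift k g a - FreeAlgebra.lift k g b = 0 := by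
      rw [← map_sub]; exact h3
    exact sub_eq_zero.1 h4)

@[simp] theorem liftHom_gen {I : TwoSidedIdeal (FreeAlgebra k X)} {S : Set (FreeAlgebra k X)}
    (hI : I = TwoSidedIdeal.span S) {R : Type*} [Ring R] [Algebra k R] (g : X → R)
    (hS : ∀ a ∈ S, FreeAlgebra.lift k g a = 0) (x : X) :
    liftHom hI g hS (gen I x) = g x := by
  have : liftHom hI g hS (gen I x) = FreeAlgebra.lift k g (FreeAlgebra.ι k x) := rfl
  rw [this, FreeAlgebra.lift_ι_apply]

end QuotAlgebra

theorem image_span_subset {R S : Type*} [Ring R] [Ring S] (f : R →+* S) (U : Set R)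
    (K : TwoSidedIdeal S) (hU : f '' U ⊆ K) : f '' (TwoSidedIdeal.span U : Set R) ⊆ K := by
  have h1 : TwoSidedIdeal.span U ≤ TwoSidedIdeal.comap f K := by
    rw [TwoSidedIdeal.span_le]
    intro a ha
    exact (TwoSidedIdeal.mem_comap f).2 (hU (Set.mem_image_of_mem f ha))
  rintro _ ⟨a, ha, rfl⟩
  exact (TwoSidedIdeal.mem_comap f).1 (h1 ha)

theorem span_image_span_union {R S T : Type*} [Ring R] [Ring S] [Ring T] (f : R →+* T)
    (g : S →+* T) (U : Set R) (V : Set S) :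
    TwoSidedIdeal.span (f '' (TwoSidedIdeal.span U : Set R) ∪
      g '' (TwoSidedIdeal.span V : Set S)) = TwoSidedIdeal.span (f '' U ∪ g '' V) := by
  apply le_antisymm
  · rw [TwoSidedIdeal.span_le]
    exact Set.union_subset
      (image_span_subset f U _ (Set.subset_union_left.trans TwoSidedIdeal.subset_span))
      (image_span_subset g V _ (Set.subset_union_right.trans TwoSidedIdeal.subset_span))
  · exact TwoSidedIdeal.span_mono (Set.union_subset_union
      (Set.image_mono TwoSidedIdeal.subset_span) (Set.image_mono TwoSidedIdeal.subset_span))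

/-- Allows the free product to be presented by the listed relations alone, rather than by the images
of whole ideals. -/
theorem freeProductIdeal_span (S : Set (FreeAlgebra k X)) (T : Set (FreeAlgebra k Y)) :
    freeProductIdeal (TwoSidedIdeal.span S) (TwoSidedIdeal.span T) =
      TwoSidedIdeal.span
        (FreeAlgebra.lift k (fun x => FreeAlgebra.ι k (Sum.inl x : X ⊕ Y)) '' S ∪
          FreeAlgebra.lift k (fun y => FreeAlgebra.ι k (Sum.inr y : X ⊕ Y)) '' T) := by
  rw [freeProductIdeal]
  exact span_image_span_union
    (FreeAlgebra.lift k (fun x => FreeAlgebra.ι k (Sum.inl x : X ⊕ Y))).toRingHom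
    (FreeAlgebra.lift k (fun y => FreeAlgebra.ι k (Sum.inr y : X ⊕ Y))).toRingHom S T

/-- The free product of presented algebras has the universal property of the coproduct. -/
theorem exists_isFreeProduct (I : TwoSidedIdeal (FreeAlgebra k X))
    (J : TwoSidedIdeal (FreeAlgebra k Y)) :
    ∃ (iA : QuotAlgebra I →ₐ[k] QuotAlgebra (freeProductIdeal I J))
      (iB : QuotAlgebra J →ₐ[k] QuotAlgebra (freeProductIdeal I J)),
      (∀ g, iA (QuotAlgebra.gen I g) = QuotAlgebra.gen (freeProductIdeal I J) (Sum.inl g)) ∧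
      (∀ g, iB (QuotAlgebra.gen J g) = QuotAlgebra.gen (freeProductIdeal I J) (Sum.inr g)) ∧
      IsFreeProduct iA iB := by
  -- An ideal is generated by its own elements, so `liftHom` applies to arbitrary `I` and `J`.
  have spanI : ∀ {Z : Type} (K : TwoSidedIdeal (FreeAlgebra k Z)),
      K = TwoSidedIdeal.span (K : Set (FreeAlgebra k Z)) := fun K =>
    le_antisymm (fun a ha => TwoSidedIdeal.subset_span ha) (TwoSidedIdeal.span_le.2 subset_rfl)
  have hsub := TwoSidedIdeal.subset_span (s :=
    (FreeAlgebra.lift k (fun x => FreeAlgebra.ι k (Sum.inl x : X ⊕ Y)) '' (I : Set (FreeAlgebra k X)) ∪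
      FreeAlgebra.lift k (fun y => FreeAlgebra.ι k (Sum.inr y : X ⊕ Y)) '' (J : Set (FreeAlgebra k Y))))
  have hC : freeProductIdeal I J = TwoSidedIdeal.span
      (FreeAlgebra.lift k (fun x => FreeAlgebra.ι k (Sum.inl x : X ⊕ Y)) '' (I : Set (FreeAlgebra k X)) ∪
        FreeAlgebra.lift k (fun y => FreeAlgebra.ι k (Sum.inr y : X ⊕ Y)) ''
          (J : Set (FreeAlgebra k Y))) := by rw [freeProductIdeal]
  have lift_comp : ∀ {Z : Type} (e : Z → X ⊕ Y) {R : Type u} [Ring R] [Algebra k R]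
      (g : X ⊕ Y → R) (a : FreeAlgebra k Z), FreeAlgebra.lift k g
        (FreeAlgebra.lift k (fun x => FreeAlgebra.ι k (e x)) a) =
        FreeAlgebra.lift k (fun x => g (e x)) a := by
    intro Z e R _ _ g a
    have : (FreeAlgebra.lift k g).comp (FreeAlgebra.lift k (fun x => FreeAlgebra.ι k (e x))) =
        FreeAlgebra.lift k (fun x => g (e x)) := by ext x; simp
    exact DFunLike.congr_fun this a
  have lift_mk : ∀ {Z W : Type} (K : TwoSidedIdeal (FreeAlgebra k Z)) {R : Type u} [Ring R]
      [Algebra k R] (f : QuotAlgebra K →ₐ[k] R) (a : FreeAlgebra k Z),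
      FreeAlgebra.lift k (fun x => f (QuotAlgebra.gen K x)) a = f (QuotAlgebra.mkHom K a) := by
    intro Z W K R _ _ f a
    have : FreeAlgebra.lift k (fun x => f (QuotAlgebra.gen K x)) = f.comp (QuotAlgebra.mkHom K) := by
      ext x; simp
    exact DFunLike.congr_fun this a
  refine ⟨QuotAlgebra.liftHom (spanI I) (fun x => QuotAlgebra.gen _ (Sum.inl x)) ?_,
    QuotAlgebra.liftHom (spanI J) (fun x => QuotAlgebra.gen _ (Sum.inr x)) ?_, ?_, ?_, ?_⟩
  · intro a ha
    rw [← lift_comp Sum.inl (QuotAlgebra.gen (freeProductIdeal I J)) a]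
    have h := lift_mk (W := X) (freeProductIdeal I J) (AlgHom.id k _)
    simp only [AlgHom.id_apply] at h
    rw [h]
    exact QuotAlgebra.mkHom_eq_zero_iff.2 (hsub (Or.inl ⟨a, ha, rfl⟩))
  · intro a ha
    rw [← lift_comp Sum.inr (QuotAlgebra.gen (freeProductIdeal I J)) a]
    have h := lift_mk (W := X) (freeProductIdeal I J) (AlgHom.id k _)
    simp only [AlgHom.id_apply] at h
    rw [h]
    exact QuotAlgebra.mkHom_eq_zero_iff.2 (hsub (Or.inr ⟨a, ha, rfl⟩))
  · intro g; simp
  · intro g; simp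
  · intro D _ _ f g
    refine ⟨QuotAlgebra.liftHom hC
      (Sum.elim (fun x => f (QuotAlgebra.gen I x)) (fun y => g (QuotAlgebra.gen J y))) ?_,
      ⟨?_, ?_⟩, ?_⟩
    · rintro _ (⟨a, ha, rfl⟩ | ⟨a, ha, rfl⟩)
      · rw [lift_comp Sum.inl]
        simp only [Sum.elim_inl]
        rw [lift_mk (W := X), QuotAlgebra.mkHom_eq_zero_iff.2 ha, map_zero]
      · rw [lift_comp Sum.inr]
        simp only [Sum.elim_inr]
        rw [lift_mk (W := X), QuotAlgebra.mkHom_eq_zero_iff.2 ha, map_zero]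
    · apply QuotAlgebra.hom_ext; intro x; simp
    · apply QuotAlgebra.hom_ext; intro x; simp
    · rintro h ⟨h1, h2⟩
      apply QuotAlgebra.hom_ext
      rintro (x | y)
      · rw [QuotAlgebra.liftHom_gen, Sum.elim_inl, ← h1]; simp
      · rw [QuotAlgebra.liftHom_gen, Sum.elim_inr, ← h2]; simp

end Presentation

/-! ### The letters and the relations of the example -/

/-- A numbering of the generators of `A`. -/
def GenA.index : GenA → ℕ
  | .a => 0 | .b => 1 | .n => 2 | .p => 3 | .q => 4 | .r => 5 | .s => 6 | .t => 7 | .u => 8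
  | .v => 9 | .w => 10 | .x => 11 | .y => 12

instance : DecidableEq GenA := fun g h =>
  decidable_of_iff (g.index = h.index) ⟨by cases g <;> cases h <;> simp [GenA.index], by
    rintro rfl; rfl⟩

instance : Fintype GenA where
  elems := {.a, .b, .n, .p, .q, .r, .s, .t, .u, .v, .w, .x, .y}
  complete := by intro g; cases g <;> decide

instance : DecidableEq GenB := fun .z .z => isTrue rfl

instance : Fintype GenB where
  elems := {.z}
  complete := by intro g; cases g; decide

/-- The letters of `C`. -/
abbrev Letter : Type := GenA ⊕ GenB

/-- The triples `(g, h, h')` such that `gh - gh'` is one of the relations of `A`. -/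
def relationTriples : List (GenA × GenA × GenA) :=
  [(.n, .p, .q), (.n, .p, .r), (.p, .s, .t), (.q, .t, .u), (.r, .s, .u), (.s, .v, .w),
    (.t, .w, .x), (.u, .v, .x), (.s, .v, .y), (.t, .w, .y), (.u, .x, .y), (.v, .a, .b),
    (.w, .a, .b), (.x, .a, .b)]

/-- The relations of `A`. -/
def relationsA (k : Type u) [Field k] : Set (FreeAlgebra k GenA) :=
  {f | ∃ c ∈ relationTriples, f = word2 k c.1 c.2.1 - word2 k c.1 c.2.2}

theorem idealA_eq_span (k : Type u) [Field k] :
    idealA k = TwoSidedIdeal.span (relationsA k) := by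
  rw [idealA]
  congr 1
  ext f
  simp [relationsA, relationTriples]

/-- A family of elements of a ring satisfies the relations of `C`. -/
structure SatisfiesRelations {R : Type*} [Ring R] (g : Letter → R) : Prop where
  quad : ∀ c ∈ relationTriples,
    g (.inl c.1) * g (.inl c.2.1) = g (.inl c.1) * g (.inl c.2.2)
  quart : g (.inr .z) * g (.inr .z) * g (.inr .z) * g (.inr .z) = 0

/-- The relations of `C`. -/
def relationsC (k : Type u) [Field k] : Set (FreeAlgebra k Letter) :=
  FreeAlgebra.lift k (fun x => FreeAlgebra.ι k (Sum.inl x : Letter)) '' relationsA k ∪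
    FreeAlgebra.lift k (fun y => FreeAlgebra.ι k (Sum.inr y : Letter)) ''
      {FreeAlgebra.ι k GenB.z ^ 4}

theorem idealC_eq_span (k : Type u) [Field k] :
    idealC k = TwoSidedIdeal.span (relationsC k) := by
  rw [idealC, idealA_eq_span, idealB, freeProductIdeal_span, relationsC]

theorem pow_four_eq {R : Type*} [Monoid R] (a : R) : a ^ 4 = a * a * a * a := by
  simp [pow_succ]

/-- The homomorphism from `A` given by elements that satisfy the relations. -/
def liftA {k : Type u} [Field k] {R : Type*} [Ring R] [Algebra k R] (g : Letter → R)
    (hg : SatisfiesRelations g) : QuotAlgebra (idealA k) →ₐ[k] R :=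
  QuotAlgebra.liftHom (idealA_eq_span k) (fun x => g (.inl x)) (by
    rintro _ ⟨c, hc, rfl⟩
    simp [word2, hg.quad c hc])

@[simp] theorem liftA_gen {k : Type u} [Field k] {R : Type*} [Ring R] [Algebra k R]
    (g : Letter → R) (hg : SatisfiesRelations g) (x : GenA) :
    liftA (k := k) g hg (QuotAlgebra.gen _ x) = g (.inl x) := by simp [liftA]

/-- The homomorphism from `C` given by elements that satisfy the relations. -/
def liftC {k : Type u} [Field k] {R : Type*} [Ring R] [Algebra k R] (g : Letter → R)
    (hg : SatisfiesRelations g) : QuotAlgebra (idealC k) →ₐ[k] R :=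
  QuotAlgebra.liftHom (idealC_eq_span k) g (by
    rintro _ (⟨_, ⟨c, hc, rfl⟩, rfl⟩ | ⟨_, rfl, rfl⟩)
    · simp [word2, hg.quad c hc]
    · simp [pow_four_eq, hg.quart])

@[simp] theorem liftC_gen {k : Type u} [Field k] {R : Type*} [Ring R] [Algebra k R]
    (g : Letter → R) (hg : SatisfiesRelations g) (x : Letter) :
    liftC (k := k) g hg (QuotAlgebra.gen _ x) = g x := by simp [liftC]

theorem mkHom_eq_zero_of_mem {k : Type u} [Field k] {X : Type} {I : TwoSidedIdeal (FreeAlgebra k X)}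
    {S : Set (FreeAlgebra k X)} (hI : I = TwoSidedIdeal.span S) {f : FreeAlgebra k X} (hf : f ∈ S) :
    QuotAlgebra.mkHom I f = 0 :=
  QuotAlgebra.mkHom_eq_zero_iff.2 (hI ▸ TwoSidedIdeal.subset_span hf)

theorem satisfiesRelations_genC (k : Type u) [Field k] :
    SatisfiesRelations (QuotAlgebra.gen (idealC k)) := by
  constructor
  · intro c hc
    have h := mkHom_eq_zero_of_mem (idealC_eq_span k) (Or.inl ⟨_, ⟨c, hc, rfl⟩, rfl⟩)
    simpa [word2, sub_eq_zero] using h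
  · have h := mkHom_eq_zero_of_mem (idealC_eq_span k) (Or.inr ⟨_, rfl, rfl⟩)
    simpa [pow_four_eq] using h

/-- The generators of `A`, together with `z ↦ 0`. -/
def genA (k : Type u) [Field k] : Letter → QuotAlgebra (idealA k) :=
  Sum.elim (QuotAlgebra.gen (idealA k)) 0

theorem satisfiesRelations_genA (k : Type u) [Field k] :
    SatisfiesRelations (genA k) := by
  constructor
  · intro c hc
    have h := mkHom_eq_zero_of_mem (idealA_eq_span k) ⟨c, hc, rfl⟩
    simpa [genA, word2, sub_eq_zero] using h
  · simp [genA]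

theorem word2_mem_freeComponent (k : Type u) [Field k] (g h : GenA) :
    word2 k g h ∈ freeComponent k GenA 2 := by
  rw [freeComponent, pow_two]
  exact Submodule.mul_mem_mul (Submodule.subset_span ⟨g, rfl⟩) (Submodule.subset_span ⟨h, rfl⟩)

theorem isQuadratic_idealA (k : Type u) [Field k] : IsQuadratic (idealA k) := by
  refine ⟨inferInstance, relationsA k, ?_, idealA_eq_span k⟩
  rintro _ ⟨c, -, rfl⟩
  exact Submodule.sub_mem _ (word2_mem_freeComponent k _ _) (word2_mem_freeComponent k _ _)

theorem relationsC_subset (k : Type u) [Field k] : relationsC k ⊆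
    (freeComponent k Letter 2 : Set (FreeAlgebra k Letter)) ∪ freeComponent k Letter 4 := by
  have hm : ∀ x : Letter, FreeAlgebra.ι k x ∈
      Submodule.span k (Set.range (FreeAlgebra.ι k : Letter → FreeAlgebra k Letter)) :=
    fun x => Submodule.subset_span ⟨x, rfl⟩
  rintro _ (⟨_, ⟨c, hc, rfl⟩, rfl⟩ | ⟨_, rfl, rfl⟩)
  · left
    simp only [word2, map_sub, map_mul, FreeAlgebra.lift_ι_apply, SetLike.mem_coe, freeComponent,
      pow_two]
    exact Submodule.sub_mem _ (Submodule.mul_mem_mul (hm _) (hm _))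
      (Submodule.mul_mem_mul (hm _) (hm _))
  · right
    simp only [map_pow, FreeAlgebra.lift_ι_apply, SetLike.mem_coe, freeComponent]
    exact Submodule.pow_mem_pow _ (hm _) 4

/-! ### Normal words -/

/-- The letters that are identified after a word whose last two letters are `p₂` and `p₁`.  The
first member of the list is the canonical representative. -/
def mergeClass (p₂ : Option Letter) : Option Letter → List GenA
  | some (.inl .n) => [.p, .q, .r]
  | some (.inl .p) => if p₂ = some (.inl .n) then [.s, .t, .u] else [.s, .t]
  | some (.inl .q) => if p₂ = some (.inl .n) then [.t, .s, .u] else [.t, .u]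
  | some (.inl .r) => if p₂ = some (.inl .n) then [.s, .t, .u] else [.s, .u]
  | some (.inl .s) =>
    if p₂ = some (.inl .p) ∨ p₂ = some (.inl .r) then [.y, .v, .w, .x] else [.y, .v, .w]
  | some (.inl .t) => if p₂ = some (.inl .q) then [.y, .v, .w, .x] else [.y, .w, .x]
  | some (.inl .u) => [.y, .v, .x]
  | some (.inl .v) => [.a, .b]
  | some (.inl .w) => [.a, .b]
  | some (.inl .x) => [.a, .b]
  | some (.inl .y) =>
    if p₂ = some (.inl .s) ∨ p₂ = some (.inl .t) ∨ p₂ = some (.inl .u) then [.a, .b] else []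
  | _ => []

/-- The canonical representative of a letter after a word whose last two letters are `p₂`, `p₁`. -/
def canon (p₂ p₁ : Option Letter) : Letter → Letter
  | .inl g => if g ∈ mergeClass p₂ p₁ then .inl ((mergeClass p₂ p₁).headD g) else .inl g
  | .inr c => .inr c

@[simp] theorem canon_inr (p₂ p₁ : Option Letter) (c : GenB) : canon p₂ p₁ (.inr c) = .inr c := rfl

/-- Multiplication of a word by a letter.  Words are stored in reverse order: the head of the list
is the last letter. -/
def push (l : List Letter) (x : Letter) : Option (List Letter) :=
  if x = .inr .z ∧ l.take 3 = [.inr .z, .inr .z, .inr .z] then none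
  else some (canon l.tail.head? l.head? x :: l)

/-- Words in normal form. -/
def IsNormalWord : List Letter → Prop
  | [] => True
  | x :: l => push l x = some (x :: l) ∧ IsNormalWord l

instance decidableIsNormalWord : ∀ l, Decidable (IsNormalWord l)
  | [] => isTrue trivial
  | _ :: l => @instDecidableAnd _ _ inferInstance (decidableIsNormalWord l)

-- A finite check over all two-letter contexts. It makes a letter stable once pushed, so that
-- pushing preserves normality.
set_option maxRecDepth 100000 in
theorem canon_canon : ∀ (p₂ p₁ : Option Letter) (x : Letter),
    canon p₂ p₁ (canon p₂ p₁ x) = canon p₂ p₁ x := by decide +kernel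

theorem push_inl (l : List Letter) (g : GenA) :
    push l (.inl g) = some (canon l.tail.head? l.head? (.inl g) :: l) := by simp [push]

theorem canon_inl (p₂ p₁ : Option Letter) (g : GenA) : ∃ g', canon p₂ p₁ (.inl g) = .inl g' := by
  simp only [canon]; split_ifs <;> exact ⟨_, rfl⟩

theorem normal_of_push {l l' : List Letter} {x : Letter} (hl : IsNormalWord l)
    (h : push l x = some l') : IsNormalWord l' := by
  rcases x with g | ⟨⟩
  · rw [push_inl] at h
    cases h
    refine ⟨?_, hl⟩
    obtain ⟨g', hg'⟩ := canon_inl l.tail.head? l.head? g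
    rw [hg', push_inl, ← hg', canon_canon]
  · have h' := h
    unfold push at h
    split at h
    · cases h
    · cases h
      exact ⟨h', hl⟩

/-- The confluence check: after any context, the two sides of a quadratic relation reach the same
letter. It is finite because only two preceding letters matter. -/
theorem canon_relation : ∀ c ∈ relationTriples, ∀ (p₂ p₁ : Option Letter),
    canon p₁ (some (canon p₂ p₁ (.inl c.1))) (.inl c.2.1) =
      canon p₁ (some (canon p₂ p₁ (.inl c.1))) (.inl c.2.2) := by decide +kernel

/-- The product of the letters of a word. -/
def word {R : Type*} [Ring R] (g : Letter → R) : List Letter → R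
  | [] => 1
  | x :: l => word g l * g x

/-! ### Evaluating words in a ring that satisfies the relations -/

section Word

variable {R : Type*} [Ring R] {g : Letter → R}

@[simp] theorem word_nil : word g [] = 1 := rfl

@[simp] theorem word_cons (x : Letter) (l : List Letter) : word g (x :: l) = word g l * g x := rfl

theorem word_append (l l' : List Letter) : word g (l ++ l') = word g l' * word g l := by
  induction l with
  | nil => simp
  | cons x l ih => simp [ih, mul_assoc]

/-- Multiplication in a ring by the letter that precedes a pair of letters, if there is one. -/
def optMul (g : Letter → R) : Option Letter → R → R
  | none, r => r
  | some x, r => g x * r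

/-- Soundness of `mergeClass`: letters merged in a given context really are equal there, in every
ring with the relations. -/
theorem mul_eq_of_mem_mergeClass (hg : SatisfiesRelations g) (p₂ : Option Letter) (p₁ : Letter) :
    ∀ h ∈ mergeClass p₂ (some p₁), optMul g p₂ (g p₁ * g (.inl h)) =
      optMul g p₂ (g p₁ * g (.inl ((mergeClass p₂ (some p₁)).headD h))) := by
  have hq := hg.quad
  simp only [relationTriples, List.forall_mem_cons, List.not_mem_nil, false_implies,
    implies_true, and_true] at hq
  obtain ⟨h1, h2, h3, h4, h5, h6, h7, h8, h9, h10, h11, h12, h13, h14⟩ := hq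
  -- Consequences in three letters: the middle letter is traded for another one by means of a
  -- relation with a neighbour, which makes a further relation applicable.
  have e1 : g (.inl .n) * (g (.inl .p) * g (.inl .u)) = g (.inl .n) * (g (.inl .p) * g (.inl .s)) := by
    simp only [← mul_assoc]; rw [h2]; simp only [mul_assoc]; rw [h5]
  have e2 : g (.inl .n) * (g (.inl .q) * g (.inl .s)) = g (.inl .n) * (g (.inl .q) * g (.inl .t)) := by
    simp only [← mul_assoc]; rw [← h1]; simp only [mul_assoc]; rw [h3]
  have e3 : g (.inl .n) * (g (.inl .r) * g (.inl .t)) = g (.inl .n) * (g (.inl .r) * g (.inl .s)) := by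
    simp only [← mul_assoc]; rw [← h2]; simp only [mul_assoc]; rw [h3]
  have e4 : g (.inl .p) * (g (.inl .s) * g (.inl .x)) = g (.inl .p) * (g (.inl .s) * g (.inl .y)) := by
    rw [← h9, h6]; simp only [← mul_assoc]; rw [h3]; simp only [mul_assoc]; rw [h7]
  have e5 : g (.inl .r) * (g (.inl .s) * g (.inl .x)) = g (.inl .r) * (g (.inl .s) * g (.inl .y)) := by
    rw [← h9]; simp only [← mul_assoc]; rw [h5]; simp only [mul_assoc]; rw [h8]
  have e6 : g (.inl .q) * (g (.inl .t) * g (.inl .v)) = g (.inl .q) * (g (.inl .t) * g (.inl .y)) := by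
    rw [← h10, h7]; simp only [← mul_assoc]; rw [h4]; simp only [mul_assoc]; rw [h8]
  -- No relation identifies ya with yb directly. They agree only after s, t or u, where y may be
  -- replaced by v, w or x.
  have e7 : g (.inl .s) * (g (.inl .y) * g (.inl .b)) = g (.inl .s) * (g (.inl .y) * g (.inl .a)) := by
    simp only [← mul_assoc]; rw [← h9]; simp only [mul_assoc]; rw [h12]
  have e8 : g (.inl .t) * (g (.inl .y) * g (.inl .b)) = g (.inl .t) * (g (.inl .y) * g (.inl .a)) := by
    simp only [← mul_assoc]; rw [← h10]; simp only [mul_assoc]; rw [h13]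
  have e9 : g (.inl .u) * (g (.inl .y) * g (.inl .b)) = g (.inl .u) * (g (.inl .y) * g (.inl .a)) := by
    simp only [← mul_assoc]; rw [← h11]; simp only [mul_assoc]; rw [h14]
  have f1 : g (.inl .s) * g (.inl .w) = g (.inl .s) * g (.inl .y) := by rw [← h6, h9]
  have f2 : g (.inl .t) * g (.inl .x) = g (.inl .t) * g (.inl .y) := by rw [← h7, h10]
  have f4 : g (.inl .n) * g (.inl .r) = g (.inl .n) * g (.inl .q) := by rw [← h2, h1]
  have f3 : g (.inl .u) * g (.inl .v) = g (.inl .u) * g (.inl .y) := by rw [h8, h11]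
  rcases p₁ with p₁ | ⟨⟩
  · cases p₁ <;> simp only [mergeClass] <;> (try split_ifs with hp) <;>
      (try subst hp) <;> (try rcases hp with rfl | rfl | rfl) <;>
      simp [optMul, *]
  · simp [mergeClass]

theorem word_mul_canon (hg : SatisfiesRelations g) (l : List Letter) (x : Letter) :
    word g l * g (canon l.tail.head? l.head? x) = word g l * g x := by
  rcases x with h | c
  · simp only [canon]
    split_ifs with hm
    · match l, hm with
      | [], hm => simp [mergeClass] at hm
      | [p₁], hm =>
        have := mul_eq_of_mem_mergeClass hg none p₁ h hm
        simpa [optMul] using this.symm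
      | p₁ :: p₂ :: l, hm =>
        have := mul_eq_of_mem_mergeClass hg (some p₂) p₁ h hm
        simp only [optMul] at this
        simp only [word_cons, mul_assoc]
        exact congrArg _ this.symm
    · rfl
  · rfl

/-- The product of the letters of a word, where `none` is the zero word. -/
def owordOf (g : Letter → R) (o : Option (List Letter)) : R := o.elim 0 (word g)

@[simp] theorem owordOf_none : owordOf g none = 0 := rfl
@[simp] theorem owordOf_some (l : List Letter) : owordOf g (some l) = word g l := rfl

theorem word_mul_letter (hg : SatisfiesRelations g) (l : List Letter) (x : Letter) :
    word g l * g x = owordOf g (push l x) := by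
  unfold push
  split_ifs with h
  · obtain ⟨rfl, h2⟩ := h
    obtain ⟨l', rfl⟩ : ∃ l', l = [.inr .z, .inr .z, .inr .z] ++ l' :=
      ⟨l.drop 3, by rw [← h2, List.take_append_drop]⟩
    simp only [word_append, word_cons, word_nil, one_mul, owordOf_none]
    rw [mul_assoc, hg.quart, mul_zero]
  · rw [owordOf_some, word_cons, word_mul_canon hg]

end Word

/-! ### The action on words and the basis -/

section Action

variable (k : Type u) [Field k]

open MulOpposite in
/-- Right multiplication by a letter on the vector space of words. -/
noncomputable def pushMap (x : Letter) : Module.End k (List Letter →₀ k) :=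
  Finsupp.lift (List Letter →₀ k) k (List Letter) fun l =>
    (push l x).elim 0 fun l' => Finsupp.single l' 1

theorem pushMap_single (x : Letter) (l : List Letter) : pushMap k x (Finsupp.single l 1) =
    (push l x).elim 0 fun l' => Finsupp.single l' 1 := by
  simp [pushMap]

/-- The operators act on all lists, normal or not, so no invariant subspace has to be checked. The
opposite ring appears because letters multiply on the right. -/
theorem satisfiesRelations_pushMap :
    SatisfiesRelations (R := (Module.End k (List Letter →₀ k))ᵐᵒᵖ)
      (fun x => MulOpposite.op (pushMap k x)) := by
  constructor
  · intro c hc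
    rw [← MulOpposite.op_mul, ← MulOpposite.op_mul]
    congr 1
    ext l : 2
    simp only [LinearMap.coe_comp, Function.comp_apply, Finsupp.lsingle_apply, Module.End.mul_apply,
      pushMap_single, push_inl, Option.elim_some, List.tail_cons, List.head?_cons]
    rw [canon_relation c hc]
  · rw [← MulOpposite.op_mul, ← MulOpposite.op_mul, ← MulOpposite.op_mul, ← MulOpposite.op_zero]
    congr 1
    ext l : 2
    simp only [LinearMap.coe_comp, Function.comp_apply, Finsupp.lsingle_apply, Module.End.mul_apply,
      pushMap_single]
    have step : ∀ l, push l (.inr .z) = none ∨ push l (.inr .z) = some (.inr .z :: l) := by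
      intro l; unfold push; split_ifs <;> simp
    have hz : push (.inr .z :: .inr .z :: .inr .z :: l) (.inr .z) = none := by simp [push]
    rcases step l with h | h
    · simp [h]
    rcases step (.inr .z :: l) with h2 | h2
    · simp [h, h2, pushMap_single]
    rcases step (.inr .z :: .inr .z :: l) with h3 | h3
    · simp [h, h2, h3, pushMap_single]
    simp [h, h2, h3, hz, pushMap_single]

/-- The right action of `C` on the vector space of words. -/
noncomputable def actC : QuotAlgebra (idealC k) →ₐ[k] (Module.End k (List Letter →₀ k))ᵐᵒᵖ :=
  liftC _ (satisfiesRelations_pushMap k)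

/-- The action of `C` on the empty word. -/
noncomputable def coordC : QuotAlgebra (idealC k) →ₗ[k] (List Letter →₀ k) :=
  (LinearMap.applyₗ (Finsupp.single [] 1)).comp
    ((MulOpposite.opLinearEquiv k).symm.toLinearMap.comp (actC k).toLinearMap)

theorem coordC_apply (c : QuotAlgebra (idealC k)) :
    coordC k c = (actC k c).unop (Finsupp.single [] 1) := rfl

/-- Each letter of a normal word is left unchanged by `push`, so acting on the empty word rebuilds
the word itself. -/
theorem coordC_word : ∀ l : List Letter, IsNormalWord l →
    coordC k (word (QuotAlgebra.gen (idealC k)) l) = Finsupp.single l 1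
  | [], _ => by simp [coordC_apply]
  | x :: l, h => by
    have ih := coordC_word l h.2
    rw [coordC_apply] at ih ⊢
    rw [word_cons, map_mul, MulOpposite.unop_mul, Module.End.mul_apply, ih]
    simp [actC, pushMap_single, h.1]

/-- The type of normal words. -/
abbrev NWord : Type := {l : List Letter // IsNormalWord l}

theorem linearIndependent_wordC :
    LinearIndependent k fun w : NWord => word (QuotAlgebra.gen (idealC k)) w.1 := by
  apply LinearIndependent.of_comp (coordC k)
  have : (coordC k ∘ fun w : NWord => word (QuotAlgebra.gen (idealC k)) w.1) =
      (fun l : List Letter => (Finsupp.single l 1 : List Letter →₀ k)) ∘ Subtype.val := by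
    ext1 w; exact coordC_word k w.1 w.2
  rw [this]
  exact (Finsupp.linearIndependent_single_one k (List Letter)).comp _ Subtype.val_injective

theorem span_word_eq_top {R : Type*} [Ring R] [Algebra k R] {g : Letter → R}
    (hg : SatisfiesRelations g) (hgen : Algebra.adjoin k (Set.range g) = ⊤) :
    Submodule.span k (Set.range fun w : NWord => word g w.1) = ⊤ := by
  set S := Submodule.span k (Set.range fun w : NWord => word g w.1) with hS
  have h1 : (1 : R) ∈ S := Submodule.subset_span ⟨⟨[], trivial⟩, rfl⟩
  have hstep : ∀ m ∈ S, ∀ x, m * g x ∈ S := by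
    intro m hm x
    induction hm using Submodule.span_induction with
    | mem m hm =>
      obtain ⟨w, rfl⟩ := hm
      rw [word_mul_letter hg]
      cases h : push w.1 x with
      | none => simp
      | some l' => exact Submodule.subset_span ⟨⟨l', normal_of_push w.2 h⟩, rfl⟩
    | zero => simp
    | add a b _ _ ha hb => rw [add_mul]; exact S.add_mem ha hb
    | smul c a _ ha => rw [smul_mul_assoc]; exact S.smul_mem c ha
  refine eq_top_iff.2 fun r hr0 => ?_
  clear hr0
  have hr : r ∈ Algebra.adjoin k (Set.range g) := hgen ▸ trivial
  -- Quantifying over all `m` in the span lets the induction pass through products.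
  suffices h : ∀ m ∈ S, m * r ∈ S by simpa using h 1 h1
  induction hr using Algebra.adjoin_induction with
  | mem a ha => obtain ⟨x, rfl⟩ := ha; exact fun m hm => hstep m hm x
  | algebraMap c =>
    intro m hm
    rw [← Algebra.commutes, ← Algebra.smul_def]; exact S.smul_mem c hm
  | add a b _ _ ha hb => intro m hm; rw [mul_add]; exact S.add_mem (ha m hm) (hb m hm)
  | mul a b _ _ ha hb => intro m hm; rw [← mul_assoc]; exact hb _ (ha m hm)

theorem adjoin_gen_eq_top {X : Type} (I : TwoSidedIdeal (FreeAlgebra k X)) :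
    Algebra.adjoin k (Set.range (QuotAlgebra.gen I)) = ⊤ := by
  have h := FreeAlgebra.adjoin_range_ι k X
  have h2 := congrArg (Subalgebra.map (QuotAlgebra.mkHom I)) h
  rw [AlgHom.map_adjoin, ← Set.range_comp, Algebra.map_top,
    (AlgHom.range_eq_top _).2 (QuotAlgebra.mkHom_surjective I)] at h2
  exact h2

/-- The basis of `C` that consists of the normal words. -/
noncomputable def basisC : Module.Basis NWord k (QuotAlgebra (idealC k)) :=
  Module.Basis.mk (linearIndependent_wordC k)
    (span_word_eq_top k (satisfiesRelations_genC k) (adjoin_gen_eq_top k _)).ge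

theorem basisC_apply (w : NWord) : basisC k w = word (QuotAlgebra.gen (idealC k)) w.1 := by
  simp [basisC]

end Action

/-! ### Layers and breaks -/

/-- The layer of a letter: the relations of `A` are paths through consecutive layers. -/
def layer : Letter → ℕ
  | .inl .n => 1
  | .inl .p => 2 | .inl .q => 2 | .inl .r => 2
  | .inl .s => 3 | .inl .t => 3 | .inl .u => 3
  | .inl .v => 4 | .inl .w => 4 | .inl .x => 4 | .inl .y => 4
  | .inl .a => 5 | .inl .b => 5
  | .inr .z => 7

/-- Two layers are linked if a letter of the second may interact with a preceding letter of the
first. -/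
def Linked (i j : ℕ) : Prop := j = i + 1 ∨ (i = 7 ∧ j = 7)

instance (i j : ℕ) : Decidable (Linked i j) := inferInstanceAs (Decidable (_ ∨ _))

theorem layer_canon : ∀ (p₂ p₁ : Option Letter) (x : Letter), layer (canon p₂ p₁ x) = layer x := by
  decide +kernel

theorem canon_of_not_linked : ∀ (p₂ : Option Letter) (p₁ x : Letter),
    ¬ Linked (layer p₁) (layer x) → canon p₂ (some p₁) x = x := by
  decide +kernel

theorem canon_some_of_not_linked : ∀ (p₂ p₁ x : Letter),
    ¬ Linked (layer p₂) (layer p₁) → canon (some p₂) (some p₁) x = canon none (some p₁) x := by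
  decide +kernel

theorem canon_none : ∀ (p₂ : Option Letter) (x : Letter), canon p₂ none x = x := by
  decide +kernel

theorem isNormalWord_singleton (x : Letter) : IsNormalWord [x] := by
  simp [IsNormalWord, push, canon_none]

/-- Words may be concatenated and cut at breaks. -/
theorem isNormalWord_append_iff {a b : Letter} (h : ¬ Linked (layer a) (layer b))
    (u : List Letter) : ∀ v : List Letter,
    IsNormalWord (v ++ b :: a :: u) ↔ IsNormalWord (v ++ [b]) ∧ IsNormalWord (a :: u)
  | [] => by
    have h1 : push (a :: u) b = some (b :: a :: u) := by
      unfold push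
      rw [if_neg]
      · simp [canon_of_not_linked _ _ _ h]
      · rintro ⟨rfl, h2⟩
        have : a = .inr .z := by simp at h2; exact h2.1
        subst this
        exact h (Or.inr ⟨rfl, rfl⟩)
    have h2 := isNormalWord_singleton b
    simp [IsNormalWord, h1] at h2 ⊢
    intro _ _; exact h2
  | x :: v => by
    have ih := isNormalWord_append_iff h u v
    -- Pushing x inspects two letters for `canon` and three for z⁴. It sees past the break only when
    -- `v` is short, and there the break makes the further letters irrelevant.
    have hp : push (v ++ b :: a :: u) x = some (x :: (v ++ b :: a :: u)) ↔
        push (v ++ [b]) x = some (x :: (v ++ [b])) := by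
      have hab : ¬ (b = .inr .z ∧ a = .inr .z) := by
        rintro ⟨rfl, rfl⟩; exact h (Or.inr ⟨rfl, rfl⟩)
      unfold push
      match v with
      | [] =>
        simp only [List.nil_append, List.tail_cons, List.head?_cons, List.head?_nil,
          canon_some_of_not_linked _ _ _ h]
        rw [if_neg (by simp; intro _ hb ha; exact absurd ⟨hb, ha⟩ hab), if_neg (by simp)]
        simp
      | [y] =>
        simp only [List.cons_append, List.nil_append, List.tail_cons, List.head?_cons]
        rw [if_neg (by simp; intro _ _ hb ha; exact absurd ⟨hb, ha⟩ hab), if_neg (by simp)]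
        simp
      | y :: y' :: [] =>
        simp
      | y :: y' :: y'' :: v =>
        simp
    simp only [List.cons_append, IsNormalWord, hp, ih, and_assoc]

theorem isNormalWord_of_append {v u : List Letter} (h : IsNormalWord (v ++ u)) :
    IsNormalWord u := by
  induction v with
  | nil => exact h
  | cons x v ih => exact ih h.2

/-- Connected words: consecutive letters lie in linked layers. -/
def Connected (l : List Letter) : Prop :=
  l.IsChain fun x y => Linked (layer y) (layer x)

/-- The decomposition of a word at its first break. -/
def splitFirst : List Letter → Option (List Letter × List Letter)
  | [] => none
  | [_] => none
  | x :: y :: l =>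
    match splitFirst (y :: l) with
    | some (u, v) => some (u, x :: v)
    | none => if Linked (layer y) (layer x) then none else some (y :: l, [x])

theorem splitFirst_eq_none_iff : ∀ l : List Letter, splitFirst l = none ↔ Connected l
  | [] => by simp [splitFirst, Connected]
  | [_] => by simp [splitFirst, Connected]
  | x :: y :: l => by
    have ih := splitFirst_eq_none_iff (y :: l)
    unfold Connected at ih ⊢
    rw [List.isChain_cons_cons, ← ih, splitFirst]
    cases h : splitFirst (y :: l) with
    | none => simp
    | some c => simp

theorem splitFirst_eq_some : ∀ {l u v : List Letter}, splitFirst l = some (u, v) →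
    ∃ a u' b v', u = a :: u' ∧ v = v' ++ [b] ∧ ¬ Linked (layer a) (layer b) ∧ Connected u ∧
      l = v ++ u
  | [], _, _, h => by simp [splitFirst] at h
  | [_], _, _, h => by simp [splitFirst] at h
  | x :: y :: l, u, v, h => by
    rw [splitFirst] at h
    cases h2 : splitFirst (y :: l) with
    | none =>
      rw [h2] at h
      simp only at h
      split_ifs at h with h3
      cases h
      exact ⟨y, l, x, [], rfl, rfl, h3, (splitFirst_eq_none_iff _).1 h2, rfl⟩
    | some c =>
      obtain ⟨u₀, v₀⟩ := c
      rw [h2] at h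
      cases h
      obtain ⟨a, u', b, v', rfl, rfl, h3, h4, h5⟩ := splitFirst_eq_some h2
      exact ⟨a, u', b, x :: v', rfl, rfl, h3, h4, by simp [h5]⟩

theorem splitFirst_append {a b : Letter} {u : List Letter} (h : ¬ Linked (layer a) (layer b))
    (hu : Connected (a :: u)) : ∀ v : List Letter,
    splitFirst (v ++ b :: a :: u) = some (a :: u, v ++ [b])
  | [] => by
    have := (splitFirst_eq_none_iff _).2 hu
    simp [splitFirst, this, h]
  | [x] => by
    have := splitFirst_append h hu []
    simp only [List.nil_append, List.cons_append] at this ⊢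
    rw [splitFirst, this]
  | x :: y :: v => by
    have := splitFirst_append h hu (y :: v)
    simp only [List.cons_append] at this ⊢
    rw [splitFirst, this]

/-! ### Products of words -/

/-- The product of two words. -/
def mulList (u : List Letter) : List Letter → Option (List Letter)
  | [] => some u
  | x :: v => (mulList u v).bind fun w => push w x

theorem word_mul_word {R : Type*} [Ring R] {g : Letter → R} (hg : SatisfiesRelations g)
    (u : List Letter) : ∀ v : List Letter, word g u * word g v = owordOf g (mulList u v)
  | [] => by simp [mulList]
  | x :: v => by
    rw [word_cons, ← mul_assoc, word_mul_word hg u v, mulList]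
    cases h : mulList u v with
    | none => simp
    | some w => simp [word_mul_letter hg]

theorem isNormalWord_mulList {u : List Letter} (hu : IsNormalWord u) :
    ∀ {v w : List Letter}, mulList u v = some w → IsNormalWord w
  | [], w, h => by cases h; exact hu
  | x :: v, w, h => by
    obtain ⟨w', h1, h2⟩ := Option.bind_eq_some_iff.1 h
    exact normal_of_push (isNormalWord_mulList hu h1) h2

theorem mulList_of_isNormalWord (u : List Letter) : ∀ {v : List Letter}, IsNormalWord (v ++ u) →
    mulList u v = some (v ++ u)
  | [], _ => rfl
  | x :: v, h => by rw [mulList, mulList_of_isNormalWord u h.2]; exact h.1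

theorem push_eq_some {l l' : List Letter} {x : Letter} (h : push l x = some l') :
    ∃ x', l' = x' :: l ∧ layer x' = layer x := by
  unfold push at h
  split_ifs at h
  cases h
  exact ⟨_, rfl, layer_canon _ _ _⟩

/-- The left factor is never rewritten, and the letters of the right factor change only within their
layers. Hence breaks can be located in a product from the layers of its factors. -/
theorem mulList_eq_some (u : List Letter) : ∀ {v w : List Letter}, mulList u v = some w →
    ∃ v', w = v' ++ u ∧ v'.map layer = v.map layer
  | [], w, h => ⟨[], by cases h; rfl, rfl⟩
  | x :: v, w, h => by
    obtain ⟨w', h1, h2⟩ := Option.bind_eq_some_iff.1 h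
    obtain ⟨v', rfl, h3⟩ := mulList_eq_some u h1
    obtain ⟨x', rfl, h4⟩ := push_eq_some h2
    exact ⟨x' :: v', rfl, by simp [h3, h4]⟩

theorem connected_iff_map (l : List Letter) :
    Connected l ↔ (l.map layer).IsChain fun i j => Linked j i := by
  rw [List.isChain_map]; rfl

/-! ### The basis of `A` -/

/-- The type of normal words without the letter `z`. -/
abbrev AWord : Type := {l : List Letter // IsNormalWord l ∧ ∀ x ∈ l, x ≠ .inr .z}

section BasisA

variable (k : Type u) [Field k]

/-- The inclusion of `A` in `C`. -/
noncomputable def inclA : QuotAlgebra (idealA k) →ₐ[k] QuotAlgebra (idealC k) :=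
  liftA _ (satisfiesRelations_genC k)

theorem inclA_word : ∀ l : List Letter, (∀ x ∈ l, x ≠ .inr .z) →
    inclA k (word (genA k) l) = word (QuotAlgebra.gen (idealC k)) l
  | [], _ => by simp
  | .inl x :: l, h => by
    rw [word_cons, map_mul, inclA_word l fun y hy => h y (by simp [hy])]
    simp [genA, inclA]
  | .inr .z :: l, h => absurd rfl (h (.inr .z) (by simp))

theorem word_genA_eq_zero {l : List Letter} (h : .inr .z ∈ l) : word (genA k) l = 0 := by
  induction l with
  | nil => simp at h
  | cons x l ih =>
    rcases List.mem_cons.1 h with rfl | h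
    · simp [genA]
    · rw [word_cons, ih h, zero_mul]

theorem adjoin_genA_eq_top : Algebra.adjoin k (Set.range (genA k)) = ⊤ := by
  rw [eq_top_iff, ← adjoin_gen_eq_top k (idealA k)]
  apply Algebra.adjoin_mono
  rintro _ ⟨x, rfl⟩
  exact ⟨.inl x, rfl⟩

/-- The basis of `A` that consists of the normal words. -/
noncomputable def basisA : Module.Basis AWord k (QuotAlgebra (idealA k)) :=
  Module.Basis.mk (v := fun w : AWord => word (genA k) w.1)
    (by
      -- Independence is inherited from `C`, where the words without z are part of the basis.
      apply LinearIndependent.of_comp (inclA k).toLinearMap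
      have : ((inclA k).toLinearMap ∘ fun w : AWord => word (genA k) w.1) =
          (fun w : NWord => word (QuotAlgebra.gen (idealC k)) w.1) ∘
            (fun w : AWord => (⟨w.1, w.2.1⟩ : NWord)) := by
        ext1 w; exact inclA_word k w.1 w.2.2
      rw [this]
      exact (linearIndependent_wordC k).comp _ fun v w h => Subtype.ext (congrArg (·.1) h))
    (by
      rw [← span_word_eq_top k (satisfiesRelations_genA k) (adjoin_genA_eq_top k),
        Submodule.span_le]
      rintro _ ⟨w, rfl⟩
      by_cases h : ∀ x ∈ w.1, x ≠ .inr .z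
      · exact Submodule.subset_span ⟨⟨w.1, w.2, h⟩, rfl⟩
      · push Not at h
        obtain ⟨x, hx, rfl⟩ := h
        simp only [word_genA_eq_zero k hx]
        exact zero_mem _)

theorem basisA_apply (w : AWord) : basisA k w = word (genA k) w.1 := by
  simp [basisA]

end BasisA

/-! ### Unitriangular families -/

section Unitriangular

variable {k : Type*} [Field k] {V K J : Type*} [AddCommGroup V] [Module k V] [AddCommGroup K]
  [Module k K]

/-- The endomorphism `Θ` taking `B` to `r` differs from the identity by a map that lowers the
filtration `F`. An element killed by `Θ` therefore sinks step by step to `F 0`, which is zero. -/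
theorem unitriangular_linearIndependent (B : Module.Basis J k V) (ℓ : J → ℕ) (r : J → V)
    (hr : ∀ j, r j - B j ∈ Submodule.span k (B '' {i | ℓ i < ℓ j})) : LinearIndependent k r := by
  set F : ℕ → Submodule k V := fun m => Submodule.span k (B '' {i | ℓ i < m}) with hF
  set Θ : V →ₗ[k] V := B.constr k r with hΘ
  have hΘB : ∀ j, Θ (B j) = r j := fun j => by simp [hΘ]
  have hmono : Monotone F := fun m m' h =>
    Submodule.span_mono (Set.image_mono fun i (hi : ℓ i < m) => hi.trans_le h)
  have hN : ∀ m, ∀ y ∈ F (m + 1), Θ y - y ∈ F m := by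
    intro m y hy
    induction hy using Submodule.span_induction with
    | mem y hy =>
      obtain ⟨j, hj, rfl⟩ := hy
      rw [hΘB]
      exact hmono (Nat.lt_succ_iff.1 hj) (hr j)
    | zero => simp
    | add a b _ _ ha hb =>
      rw [map_add, add_sub_add_comm]; exact Submodule.add_mem _ ha hb
    | smul c a _ ha =>
      rw [map_smul, ← smul_sub]; exact Submodule.smul_mem _ c ha
  have hinj : ∀ m, ∀ y ∈ F m, Θ y = 0 → y = 0 := by
    intro m
    induction m with
    | zero => intro y hy _; simpa [hF] using hy
    | succ m ih =>
      intro y hy h0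
      have := hN m y hy
      rw [h0, zero_sub] at this
      exact ih y ((Submodule.neg_mem_iff _).1 this) h0
  have hall : ∀ y, ∃ m, y ∈ F m := by
    intro y
    have hy : y ∈ Submodule.span k (Set.range B) := by rw [B.span_eq]; trivial
    induction hy using Submodule.span_induction with
    | mem y hy =>
      obtain ⟨j, rfl⟩ := hy
      exact ⟨ℓ j + 1, Submodule.subset_span ⟨j, Nat.lt_succ_self _, rfl⟩⟩
    | zero => exact ⟨0, zero_mem _⟩
    | add a b _ _ ha hb =>
      obtain ⟨m, hm⟩ := ha
      obtain ⟨m', hm'⟩ := hb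
      exact ⟨max m m', Submodule.add_mem _ (hmono (le_max_left _ _) hm)
        (hmono (le_max_right _ _) hm')⟩
    | smul c a _ ha =>
      obtain ⟨m, hm⟩ := ha
      exact ⟨m, Submodule.smul_mem _ c hm⟩
  have hker : LinearMap.ker Θ = ⊥ := by
    rw [LinearMap.ker_eq_bot']
    intro y hy
    obtain ⟨m, hm⟩ := hall y
    exact hinj m y hm hy
  have := B.linearIndependent.map' Θ hker
  have h2 : Θ ∘ B = r := funext hΘB
  rwa [h2] at this

theorem unitriangular_span (B : Module.Basis J k V) (ℓ : J → ℕ) (r : J → V)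
    (hr : ∀ j, r j - B j ∈ Submodule.span k (B '' {i | ℓ i < ℓ j})) :
    Submodule.span k (Set.range r) = ⊤ := by
  have key : ∀ m j, ℓ j < m → B j ∈ Submodule.span k (Set.range r) := by
    intro m
    induction m with
    | zero => intro j hj; simp at hj
    | succ m ih =>
      intro j hj
      have h1 : Submodule.span k (B '' {i | ℓ i < ℓ j}) ≤ Submodule.span k (Set.range r) := by
        rw [Submodule.span_le]
        rintro _ ⟨i, hi, rfl⟩
        exact ih i (lt_of_lt_of_le hi (Nat.lt_succ_iff.1 hj))
      have h2 := Submodule.sub_mem _ (Submodule.subset_span (Set.mem_range_self j)) (h1 (hr j))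
      simpa using h2
  rw [eq_top_iff, ← B.span_eq, Submodule.span_le]
  rintro _ ⟨j, rfl⟩
  exact key _ j (Nat.lt_succ_self _)

/-- A unitriangular change of basis that moves part of the basis into the kernel of a linear map,
which is injective on the span of the rest, yields a basis of the kernel. -/
theorem ker_le_span_of_unitriangular (B : Module.Basis J k V) (ℓ : J → ℕ) (r : J → V)
    (hr : ∀ j, r j - B j ∈ Submodule.span k (B '' {i | ℓ i < ℓ j})) (φ : V →ₗ[k] K)
    (good : Set J) (hgood : ∀ j ∈ good, r j = B j) (hbad : ∀ j ∉ good, φ (r j) = 0)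
    (hφ : LinearIndependent k fun j : good => φ (B j)) :
    LinearMap.ker φ ≤ Submodule.span k (r '' goodᶜ) := by
  intro y hy
  have h1 : y ∈ Submodule.span k (r '' goodᶜ) ⊔ Submodule.span k (B '' good) := by
    rw [← Submodule.span_union]
    have : y ∈ Submodule.span k (Set.range r) := by
      rw [unitriangular_span B ℓ r hr]; trivial
    refine Submodule.span_mono ?_ this
    rintro _ ⟨j, rfl⟩
    by_cases hj : j ∈ good
    · exact Or.inr ⟨j, hj, (hgood j hj).symm⟩
    · exact Or.inl ⟨j, hj, rfl⟩
  obtain ⟨s, hs, t, ht, rfl⟩ := Submodule.mem_sup.1 h1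
  have hs0 : φ s = 0 := by
    have : Submodule.span k (r '' goodᶜ) ≤ LinearMap.ker φ := by
      rw [Submodule.span_le]
      rintro _ ⟨j, hj, rfl⟩
      exact hbad j hj
    exact this hs
  have ht0 : φ t = 0 := by
    have : φ (s + t) = 0 := hy
    rwa [map_add, hs0, zero_add] at this
  have : t = 0 := by
    have hli : LinearIndependent k (fun j : good => B j) :=
      B.linearIndependent.comp _ Subtype.val_injective
    rw [Set.image_eq_range] at ht
    obtain ⟨c, rfl⟩ := (Finsupp.mem_span_range_iff_exists_finsupp).1 ht
    have hc : c = 0 := by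
      apply linearIndependent_iff.1 hφ
      rw [Finsupp.linearCombination_apply]
      rw [map_finsuppSum] at ht0
      simpa using ht0
    simp [hc]
  rw [this, add_zero]
  exact hs

end Unitriangular

/-! ### The last block of a word -/

/-- The last block of a word, and the rest. -/
def lastBlock : List Letter → List Letter × List Letter
  | [] => ([], [])
  | [x] => ([x], [])
  | x :: y :: l =>
    if Linked (layer y) (layer x) then (x :: (lastBlock (y :: l)).1, (lastBlock (y :: l)).2)
    else ([x], y :: l)

/-- The layer of the first letter of a word. -/
def startLayer (l : List Letter) : ℕ := (l.getLast?.map layer).getD 0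

theorem lastBlock_append : ∀ l, (lastBlock l).1 ++ (lastBlock l).2 = l
  | [] => rfl
  | [x] => rfl
  | x :: y :: l => by
    rw [lastBlock]
    split_ifs
    · simpa using lastBlock_append (y :: l)
    · rfl

theorem lastBlock_cons (x : Letter) (l : List Letter) : ∃ l', (lastBlock (x :: l)).1 = x :: l' := by
  cases l with
  | nil => exact ⟨[], rfl⟩
  | cons y l =>
    rw [lastBlock]
    split_ifs
    · exact ⟨_, rfl⟩
    · exact ⟨_, rfl⟩

theorem connected_lastBlock : ∀ l, Connected (lastBlock l).1
  | [] => by simp [Connected, lastBlock]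
  | [x] => by simp [Connected, lastBlock]
  | x :: y :: l => by
    have ih := connected_lastBlock (y :: l)
    rw [lastBlock]
    split_ifs with h
    · obtain ⟨l', hl'⟩ := lastBlock_cons y l
      unfold Connected at ih ⊢
      simp only
      rw [hl'] at ih ⊢
      exact List.isChain_cons_cons.2 ⟨h, ih⟩
    · simp [Connected]

theorem startLayer_cons_cons (x y : Letter) (l : List Letter) :
    startLayer (x :: y :: l) = startLayer (y :: l) := by simp [startLayer]

theorem not_linked_lastBlock : ∀ l, ∀ a ∈ (lastBlock l).2.head?,
    ¬ Linked (layer a) (startLayer (lastBlock l).1)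
  | [] => by simp [lastBlock]
  | [x] => by simp [lastBlock]
  | x :: y :: l => by
    have ih := not_linked_lastBlock (y :: l)
    rw [lastBlock]
    split_ifs with h
    · obtain ⟨l', hl'⟩ := lastBlock_cons y l
      simp only
      rw [hl'] at ih ⊢
      rw [startLayer_cons_cons]
      exact ih
    · intro a ha
      simp at ha
      subst ha
      simpa [startLayer] using h

/-- Uniqueness of the last block; it makes concatenation with a block invertible. -/
theorem lastBlock_of_append : ∀ {g r : List Letter}, g ≠ [] → Connected g →
    (∀ a ∈ r.head?, ¬ Linked (layer a) (startLayer g)) → lastBlock (g ++ r) = (g, r)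
  | [], _, h, _, _ => absurd rfl h
  | [x], [], _, _, _ => rfl
  | [x], a :: r, _, _, h => by
    have := h a (by simp)
    simp only [startLayer] at this
    simp only [List.cons_append, List.nil_append, lastBlock]
    rw [if_neg (by simpa using this)]
  | x :: y :: g, r, _, hc, h => by
    have hc' := List.isChain_cons_cons.1 hc
    have ih := lastBlock_of_append (g := y :: g) (r := r) (by simp) hc'.2
      (by simpa [startLayer_cons_cons] using h)
    simp only [List.cons_append] at ih ⊢
    rw [lastBlock, if_pos hc'.1, ih]

theorem layer_ne_seven {x : Letter} (h : x ≠ .inr .z) : layer x ≠ 7 := by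
  rcases x with x | ⟨⟩
  · cases x <;> decide
  · exact absurd rfl h

theorem linked_iff_of_ne_z {x : Letter} (h : x ≠ .inr .z) (j : ℕ) :
    Linked (layer x) j ↔ layer x + 1 = j := by
  unfold Linked
  have := layer_ne_seven h
  omega

theorem startLayer_le_of_connected : ∀ {x : Letter} {l : List Letter}, Connected (x :: l) →
    (∀ y ∈ x :: l, y ≠ .inr .z) → startLayer (x :: l) ≤ layer x
  | x, [], _, _ => by simp [startLayer]
  | x, y :: l, h, hz => by
    have h' := List.isChain_cons_cons.1 h
    rw [startLayer_cons_cons]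
    have := startLayer_le_of_connected h'.2 (fun w hw => hz w (by simp [hw]))
    have h2 := (linked_iff_of_ne_z (hz y (by simp)) _).1 h'.1
    omega

theorem mulList_ne_none (u : List Letter) : ∀ {v : List Letter}, (∀ y ∈ v, y ≠ .inr .z) →
    ∃ w, mulList u v = some w
  | [], _ => ⟨u, rfl⟩
  | x :: v, h => by
    obtain ⟨w, hw⟩ := mulList_ne_none u (fun y hy => h y (List.mem_cons_of_mem _ hy))
    rcases x with x | ⟨⟩
    · exact ⟨_, by rw [mulList, hw]; exact push_inl w x⟩
    · exact absurd rfl (h (.inr .z) (by simp))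

theorem forall_ne_z_of_map_layer {v v' : List Letter} (h : v'.map layer = v.map layer)
    (hv : ∀ y ∈ v, y ≠ .inr .z) : ∀ y ∈ v', y ≠ .inr .z := by
  rintro y hy rfl
  have : (7 : ℕ) ∈ v.map layer := by rw [← h]; exact List.mem_map.2 ⟨_, hy, rfl⟩
  obtain ⟨x, hx, hx7⟩ := List.mem_map.1 this
  exact layer_ne_seven (hv x hx) hx7

theorem startLayer_eq_map (l : List Letter) : startLayer l = ((l.map layer).getLast?).getD 0 := by
  simp [startLayer]

theorem one_le_layer (x : Letter) : 1 ≤ layer x := by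
  rcases x with x | x <;> cases x <;> decide

theorem layer_le_five {x : Letter} (h : x ≠ .inr .z) : layer x ≤ 5 := by
  rcases x with x | ⟨⟩
  · cases x <;> decide
  · exact absurd rfl h

/-- Words without `z` may be cut at the start of their last block. -/
theorem isNormalWord_block_append {g r : List Letter} (hg : IsNormalWord g) (hr : IsNormalWord r)
    (hne : g ≠ []) (h : ∀ a ∈ r.head?, ¬ Linked (layer a) (startLayer g)) :
    IsNormalWord (g ++ r) := by
  match r, h with
  | [], _ => simpa using hg
  | a :: r, h =>
    obtain ⟨g', b, rfl⟩ : ∃ g' b, g = g' ++ [b] :=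
      ⟨g.dropLast, g.getLast hne, (List.dropLast_append_getLast hne).symm⟩
    have hb : ¬ Linked (layer a) (layer b) := by simpa [startLayer] using h a (by simp)
    simpa using (isNormalWord_append_iff hb r g').2 ⟨hg, hr⟩

theorem isNormalWord_lastBlock {l : List Letter} (h : IsNormalWord l) :
    IsNormalWord (lastBlock l).1 ∧ IsNormalWord (lastBlock l).2 := by
  have h1 := lastBlock_append l
  have h2 := not_linked_lastBlock l
  generalize hg : (lastBlock l).1 = g at *
  generalize hr : (lastBlock l).2 = r at *
  rw [← h1] at h
  refine ⟨?_, isNormalWord_of_append h⟩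
  match r, h2 with
  | [], _ => simpa using h
  | a :: r, h2 =>
    rcases List.eq_nil_or_concat g with rfl | ⟨g', b, rfl⟩
    · trivial
    · have hb : ¬ Linked (layer a) (layer b) := by simpa [startLayer] using h2 a (by simp)
      simp only [List.concat_eq_append, List.append_assoc, List.cons_append,
        List.nil_append] at h ⊢
      exact ((isNormalWord_append_iff hb r g').1 h).1

/-! ### The global dimension of `A` -/

-- Dimension shift. The indices begin at `n + 2` because one step lower the equivalence would say
-- that a projective `K` has zero kernel.
open CategoryTheory in
theorem hasProjectiveDimensionLT_of_ker {R : Type u} [Ring R] {P K : Type u} [AddCommGroup P]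
    [Module R P] [AddCommGroup K] [Module R K] [Module.Projective R P] (φ : P →ₗ[R] K)
    (hφ : Function.Surjective φ) (n : ℕ) :
    HasProjectiveDimensionLT (ModuleCat.of R K) (n + 2) ↔
      HasProjectiveDimensionLT (ModuleCat.of R (LinearMap.ker φ)) (n + 1) :=
  (LinearMap.shortExact_shortComplexKer hφ).hasProjectiveDimensionLT_X₃_iff n
    ((IsProjective.iff_projective P).1 inferInstance)

section GlobalDimensionA

variable (k : Type u) [Field k]

/-- A generating family `e` of a left `A`-module such that the elements `w • e i`, where `w` is a
normal word that does not end in a layer absorbed by `e i`, form a basis, and such that the absorbed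
letters map the family to itself, shifting the absorbed layers down. -/
structure LayeredFamily {K I : Type u} [AddCommGroup K] [Module (QuotAlgebra (idealA k)) K]
    [Module k K] (e : I → K) (ok : I → ℕ → Prop) : Prop where
  linearIndependent : LinearIndependent k
    fun j : {j : AWord × I | ∀ x ∈ j.1.1.head?, ¬ ok j.2 (layer x)} => basisA k j.1.1 • e j.1.2
  span : ⊤ ≤ Submodule.span k (Set.range
    fun j : {j : AWord × I | ∀ x ∈ j.1.1.head?, ¬ ok j.2 (layer x)} => basisA k j.1.1 • e j.1.2)
  absorb : ∀ i x, x ≠ .inr .z → ok i (layer x) →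
    genA k x • e i ∈ Submodule.span k (e '' {i' | ∀ m, m + 1 = layer x → ok i' m})

variable {k} {K I : Type u} [AddCommGroup K] [Module (QuotAlgebra (idealA k)) K]
    [Module k K] [IsScalarTower k (QuotAlgebra (idealA k)) K] {e : I → K} {ok : I → ℕ → Prop}

local notation "𝐀" => QuotAlgebra (idealA k)

/-- An absorbed letter produces generators that absorb the layer below, which is the layer of the
preceding letter in a connected word. So the whole word is swallowed, letter by letter from its end.
-/
theorem LayeredFamily.word_smul_mem (h : LayeredFamily k e ok) :
    ∀ (l : List Letter) (x : Letter), Connected (x :: l) → (∀ y ∈ x :: l, y ≠ .inr .z) →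
      ∀ i, ok i (layer x) → word (genA k) (x :: l) • e i ∈
        Submodule.span k (e '' {i' | ∀ m, m + 1 = startLayer (x :: l) → ok i' m})
  | [], x, _, hz, i, hi => by
    simpa [startLayer] using h.absorb i x (hz x (by simp)) hi
  | y :: l, x, hc, hz, i, hi => by
    have hc' := List.isChain_cons_cons.1 hc
    have hy := (linked_iff_of_ne_z (hz y (by simp)) _).1 hc'.1
    rw [startLayer_cons_cons, word_cons, mul_smul]
    have h1 := h.absorb i x (hz x (by simp)) hi
    refine Submodule.span_induction (p := fun v _ => word (genA k) (y :: l) • v ∈ _)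
      ?_ ?_ ?_ ?_ h1
    · rintro _ ⟨i', hi', rfl⟩
      exact LayeredFamily.word_smul_mem h l y hc'.2 (fun w hw => hz w (by simp [hw])) i'
        (hi' _ hy)
    · simp
    · intro a b _ _ ha hb
      rw [smul_add]; exact Submodule.add_mem _ ha hb
    · intro c a _ ha
      rw [smul_algebra_smul_comm]; exact Submodule.smul_mem _ c ha

/-- The index set of the family that generates the first syzygy. -/
abbrev BlockIndex (ok : I → ℕ → Prop) : Type u :=
  {j : AWord × I // j.1.1 ≠ [] ∧ Connected j.1.1 ∧ ∀ x ∈ j.1.1.head?, ok j.2 (layer x)}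

variable (k e) in
/-- The free cover given by a family. -/
noncomputable def cover : (I →₀ 𝐀) →ₗ[𝐀] K := Finsupp.linearCombination 𝐀 e

@[simp] theorem cover_single (i : I) (a : 𝐀) : cover k e (Finsupp.single i a) = a • e i := by
  simp [cover]

variable (k I) in
/-- The basis of a free `A`-module as a vector space. -/
noncomputable def freeBasis : Module.Basis (AWord × I) k (I →₀ 𝐀) :=
  (basisA k).smulTower Finsupp.basisSingleOne

theorem freeBasis_apply (j : AWord × I) :
    freeBasis k I j = Finsupp.single j.2 (basisA k j.1) := by
  simp [freeBasis, Module.Basis.smulTower_apply]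

/-- A swallowed word acts on a generator as a combination of generators with scalar coefficients, so
the result lifts to a scalar combination of the free generators. The difference of the two lifts is
a syzygy. -/
theorem LayeredFamily.exists_lift (h : LayeredFamily k e ok) (j : BlockIndex ok) :
    ∃ q ∈ Submodule.span k ((fun i => (Finsupp.single i 1 : I →₀ 𝐀)) ''
      {i' | ∀ m, m + 1 = startLayer j.1.1.1 → ok i' m}),
      cover k e q = basisA k j.1.1 • e j.1.2 := by
  obtain ⟨⟨⟨l, hn, hz⟩, i⟩, hne, hc, hok⟩ := j
  cases l with
  | nil => exact absurd rfl hne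
  | cons x l =>
    have h1 := h.word_smul_mem l x hc hz i (hok x (by simp))
    rw [basisA_apply]
    have h2 : (fun i => e i) '' {i' | ∀ m, m + 1 = startLayer (x :: l) → ok i' m} =
        (cover k e).restrictScalars k '' ((fun i => (Finsupp.single i 1 : I →₀ 𝐀)) ''
          {i' | ∀ m, m + 1 = startLayer (x :: l) → ok i' m}) := by
      rw [Set.image_image]; simp
    change _ ∈ Submodule.span k ((fun i => e i) '' _) at h1
    rw [h2, ← Submodule.map_span] at h1
    exact h1

/-- The correction term of a generator of the syzygy. -/
noncomputable def LayeredFamily.corr (h : LayeredFamily k e ok) (j : BlockIndex ok) : I →₀ 𝐀 :=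
  (h.exists_lift j).choose

theorem LayeredFamily.corr_mem (h : LayeredFamily k e ok) (j : BlockIndex ok) :
    h.corr j ∈ Submodule.span k ((fun i => (Finsupp.single i 1 : I →₀ 𝐀)) ''
      {i' | ∀ m, m + 1 = startLayer j.1.1.1 → ok i' m}) := (h.exists_lift j).choose_spec.1

theorem LayeredFamily.cover_corr (h : LayeredFamily k e ok) (j : BlockIndex ok) :
    cover k e (h.corr j) = basisA k j.1.1 • e j.1.2 := (h.exists_lift j).choose_spec.2

/-- The family that generates the first syzygy. -/
noncomputable def LayeredFamily.syz (h : LayeredFamily k e ok) (j : BlockIndex ok) :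
    LinearMap.ker (cover k e) :=
  ⟨Finsupp.single j.1.2 (basisA k j.1.1) - h.corr j, by
    rw [LinearMap.mem_ker, map_sub, cover_single, h.cover_corr, sub_self]⟩

theorem LayeredFamily.surjective_cover (h : LayeredFamily k e ok) :
    Function.Surjective (cover k e) := by
  have h1 : Submodule.span k (Set.range fun j : {j : AWord × I | ∀ x ∈ j.1.1.head?,
      ¬ ok j.2 (layer x)} => basisA k j.1.1 • e j.1.2) ≤
      LinearMap.range ((cover k e).restrictScalars k) := by
    rw [Submodule.span_le]
    rintro _ ⟨j, rfl⟩
    exact ⟨Finsupp.single j.1.2 (basisA k j.1.1), by simp⟩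
  intro y
  obtain ⟨z, hz⟩ := h1 (h.span (Submodule.mem_top (x := y)))
  exact ⟨z, hz⟩

theorem LayeredFamily.linearIndependent_cover (h : LayeredFamily k e ok) : LinearIndependent k
    fun j : {j : AWord × I | ∀ x ∈ j.1.1.head?, ¬ ok j.2 (layer x)} =>
      (cover k e).restrictScalars k (freeBasis k I j) := by
  have : (fun j : {j : AWord × I | ∀ x ∈ j.1.1.head?, ¬ ok j.2 (layer x)} =>
      (cover k e).restrictScalars k (freeBasis k I j)) = fun j => basisA k j.1.1 • e j.1.2 := by
    funext j
    simp [freeBasis_apply]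
  rw [this]
  exact h.linearIndependent

/-- The last block of a normal word, as a normal word. -/
def AWord.block (w : AWord) : AWord :=
  ⟨(lastBlock w.1).1, (isNormalWord_lastBlock w.2.1).1, fun x hx => w.2.2 x (by
    rw [← lastBlock_append w.1]; exact List.mem_append_left _ hx)⟩

/-- What precedes the last block of a normal word, as a normal word. -/
def AWord.rest (w : AWord) : AWord :=
  ⟨(lastBlock w.1).2, (isNormalWord_lastBlock w.2.1).2, fun x hx => w.2.2 x (by
    rw [← lastBlock_append w.1]; exact List.mem_append_right _ hx)⟩

theorem basisA_rest_mul_block (w : AWord) :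
    basisA k w.rest * basisA k w.block = basisA k w := by
  simp only [basisA_apply, ← word_append, AWord.rest, AWord.block, lastBlock_append]

/-- The block index of a pair of a word and a generator that absorbs its last letter. -/
def blockIndexOf {j : AWord × I} (hj : ¬ ∀ x ∈ j.1.1.head?, ¬ ok j.2 (layer x)) :
    BlockIndex ok :=
  ⟨(j.1.block, j.2), by
    push Not at hj
    obtain ⟨x, hx, hok⟩ := hj
    obtain ⟨⟨l, hl⟩, i⟩ := j
    cases l with
    | nil => simp at hx
    | cons y l =>
      obtain rfl : y = x := by simpa using hx
      obtain ⟨l', hl'⟩ := lastBlock_cons y l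
      refine ⟨by simp [AWord.block, hl'], connected_lastBlock _, ?_⟩
      simpa [AWord.block, hl'] using hok⟩

open Classical in
/-- The unitriangular change of basis of the free cover. -/
noncomputable def LayeredFamily.newBasis (h : LayeredFamily k e ok) (j : AWord × I) : I →₀ 𝐀 :=
  if hj : ∀ x ∈ j.1.1.head?, ¬ ok j.2 (layer x) then freeBasis k I j
  else basisA k j.1.rest • (h.syz (blockIndexOf hj)).1

/-- The difference is `rest • corr`. Since `corr` has scalar coefficients, only the word `rest`
occurs in it, and this word is shorter because the last block is nonempty. -/
theorem LayeredFamily.newBasis_sub_mem (h : LayeredFamily k e ok) (j : AWord × I) :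
    h.newBasis j - freeBasis k I j ∈ Submodule.span k
      (freeBasis k I '' {i | i.1.1.length < j.1.1.length}) := by
  unfold LayeredFamily.newBasis
  split_ifs with hj
  · simp
  · have hlen : j.1.rest.1.length < j.1.1.length := by
      push Not at hj
      obtain ⟨x, hx, -⟩ := hj
      obtain ⟨⟨l, hl⟩, i⟩ := j
      cases l with
      | nil => simp at hx
      | cons y l =>
        obtain ⟨l', hl'⟩ := lastBlock_cons y l
        have := congrArg List.length (lastBlock_append (y :: l))
        rw [hl'] at this
        simp [AWord.rest] at this ⊢
        omega
    have h1 : basisA k j.1.rest • (h.syz (blockIndexOf hj)).1 - freeBasis k I j =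
        -(basisA k j.1.rest • h.corr (blockIndexOf hj)) := by
      rw [freeBasis_apply, LayeredFamily.syz, smul_sub, Finsupp.smul_single, smul_eq_mul]
      simp only [blockIndexOf, basisA_rest_mul_block]
      abel
    rw [h1, Submodule.neg_mem_iff]
    refine Submodule.span_induction (p := fun v _ => basisA k j.1.rest • v ∈ _)
      ?_ ?_ ?_ ?_ (h.corr_mem (blockIndexOf hj))
    · rintro _ ⟨i', hi', rfl⟩
      apply Submodule.subset_span
      refine ⟨(j.1.rest, i'), hlen, ?_⟩
      simp [freeBasis_apply]
    · simp
    · intro a b _ _ ha hb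
      rw [smul_add]; exact Submodule.add_mem _ ha hb
    · intro c a _ ha
      rw [smul_algebra_smul_comm]; exact Submodule.smul_mem _ c ha

/-- A block and a normal word that does not end in a layer absorbed by it. -/
abbrev SyzIndex (ok : I → ℕ → Prop) : Type u :=
  {j : AWord × BlockIndex ok | ∀ x ∈ j.1.1.head?, ¬ layer x + 1 = startLayer j.2.1.1.1}

/-- The concatenation of a normal word and a block. -/
def SyzIndex.concat (j : SyzIndex ok) : AWord × I :=
  (⟨j.1.2.1.1.1 ++ j.1.1.1, isNormalWord_block_append j.1.2.1.1.2.1 j.1.1.2.1 j.1.2.2.1 (by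
      intro a ha
      rw [linked_iff_of_ne_z (j.1.1.2.2 a (List.mem_of_mem_head? ha))]
      exact j.2 a ha), fun x hx => by
      rcases List.mem_append.1 hx with hx | hx
      · exact j.1.2.1.1.2.2 x hx
      · exact j.1.1.2.2 x hx⟩, j.1.2.1.2)

theorem SyzIndex.lastBlock_concat (j : SyzIndex ok) :
    lastBlock j.concat.1.1 = (j.1.2.1.1.1, j.1.1.1) :=
  lastBlock_of_append j.1.2.2.1 j.1.2.2.2.1 (by
      intro a ha
      rw [linked_iff_of_ne_z (j.1.1.2.2 a (List.mem_of_mem_head? ha))]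
      exact j.2 a ha)

theorem SyzIndex.concat_bad (j : SyzIndex ok) :
    ¬ ∀ x ∈ j.concat.1.1.head?, ¬ ok j.concat.2 (layer x) := by
  obtain ⟨⟨w, ⟨⟨⟨l, hl⟩, i⟩, hne, hc, hok⟩⟩, hj⟩ := j
  cases l with
  | nil => exact absurd rfl hne
  | cons x l =>
    intro h
    exact h x (by simp [SyzIndex.concat]) (hok x (by simp))

theorem LayeredFamily.newBasis_concat (h : LayeredFamily k e ok) (j : SyzIndex ok) :
    h.newBasis j.concat = basisA k j.1.1 • (h.syz j.1.2).1 := by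
  have hb := j.concat_bad
  have hl := j.lastBlock_concat
  rw [LayeredFamily.newBasis, dif_neg hb]
  have h1 : j.concat.1.rest = j.1.1 := Subtype.ext (congrArg Prod.snd hl)
  have h2 : blockIndexOf hb = j.1.2 :=
    Subtype.ext (Prod.ext (Subtype.ext (congrArg Prod.fst hl)) rfl)
  rw [h1, h2]

theorem SyzIndex.concat_injective : Function.Injective (SyzIndex.concat (ok := ok)) := by
  intro j j' h
  have h1 := j.lastBlock_concat
  rw [h, j'.lastBlock_concat] at h1
  have hw : j.1.1 = j'.1.1 := Subtype.ext (congrArg Prod.snd h1).symm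
  have hb : j.1.2 = j'.1.2 := Subtype.ext (Prod.ext
    (Subtype.ext (congrArg Prod.fst h1).symm)
    (show j.concat.2 = j'.concat.2 from congrArg Prod.snd h))
  exact Subtype.ext (Prod.ext hw hb)

theorem SyzIndex.exists_concat {j : AWord × I}
    (hj : ¬ ∀ x ∈ j.1.1.head?, ¬ ok j.2 (layer x)) : ∃ j' : SyzIndex ok, j'.concat = j := by
  refine ⟨⟨(j.1.rest, blockIndexOf hj), ?_⟩, ?_⟩
  · intro x hx
    have hx' : x ∈ (lastBlock j.1.1).2.head? := hx
    have := not_linked_lastBlock j.1.1 x hx'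
    rwa [linked_iff_of_ne_z (j.1.rest.2.2 x (List.mem_of_mem_head? hx))] at this
  · exact Prod.ext (Subtype.ext (lastBlock_append j.1.1)) rfl

/-- The generators are independent over `k`, since the empty word has no last letter and is never
excluded. This lets scalar correction terms be discarded inside the kernel. -/
theorem LayeredFamily.cover_injOn (h : LayeredFamily k e ok) {q : I →₀ 𝐀}
    (hq : q ∈ Submodule.span k (Set.range fun i => (Finsupp.single i 1 : I →₀ 𝐀)))
    (h0 : cover k e q = 0) : q = 0 := by
  have hli : LinearIndependent k e := by
    have := h.linearIndependent.comp
      (fun i : I => (⟨(⟨[], trivial, by simp⟩, i), by simp⟩ :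
        {j : AWord × I | ∀ x ∈ j.1.1.head?, ¬ ok j.2 (layer x)}))
      (fun i i' hi => congrArg (·.1.2) hi)
    simpa [Function.comp_def, basisA_apply] using this
  obtain ⟨c, rfl⟩ := (Finsupp.mem_span_range_iff_exists_finsupp).1 hq
  have hc : c = 0 := by
    apply linearIndependent_iff.1 hli
    rw [Finsupp.linearCombination_apply]
    rw [map_finsuppSum] at h0
    simp only [LinearMap.map_smul_of_tower] at h0
    simpa using h0
  simp [hc]

/-- The pairs of a word and a generator that absorbs its last letter split uniquely as a rest times
a block, which makes the syzygies of blocks act freely up to absorption. The syzygy of a block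
absorbs the layer just before the start of the block, because a letter of that layer prolongs the
block to the left. -/
theorem LayeredFamily.syzygy (h : LayeredFamily k e ok) :
    LayeredFamily k h.syz (fun j m => m + 1 = startLayer j.1.1.1) where
  linearIndependent := by
    apply LinearIndependent.of_comp ((LinearMap.ker (cover k e)).subtype.restrictScalars k)
    have := (unitriangular_linearIndependent (freeBasis k I) (fun j => j.1.1.length) h.newBasis
      h.newBasis_sub_mem).comp _ (SyzIndex.concat_injective (ok := ok))
    have heq : (((LinearMap.ker (cover k e)).subtype.restrictScalars k) ∘
        fun j : SyzIndex ok => basisA k j.1.1 • h.syz j.1.2) = h.newBasis ∘ SyzIndex.concat :=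
      funext fun j => (h.newBasis_concat j).symm
    exact heq ▸ this
  span := by
    have h1 := ker_le_span_of_unitriangular (freeBasis k I) (fun j => j.1.1.length) h.newBasis
      h.newBasis_sub_mem ((cover k e).restrictScalars k)
      {j | ∀ x ∈ j.1.1.head?, ¬ ok j.2 (layer x)} ?_ ?_ h.linearIndependent_cover
    · intro y _
      have hy := h1 (show y.1 ∈ _ from y.2)
      have h2 : h.newBasis '' {j | ∀ x ∈ j.1.1.head?, ¬ ok j.2 (layer x)}ᶜ =
          (LinearMap.ker (cover k e)).subtype.restrictScalars k '' Set.range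
            (fun j : SyzIndex ok => basisA k j.1.1 • h.syz j.1.2) := by
        ext v
        constructor
        · rintro ⟨j, hj, rfl⟩
          obtain ⟨j', rfl⟩ := SyzIndex.exists_concat hj
          exact ⟨_, ⟨j', rfl⟩, (h.newBasis_concat j').symm⟩
        · rintro ⟨_, ⟨j, rfl⟩, rfl⟩
          exact ⟨j.concat, j.concat_bad, h.newBasis_concat j⟩
      rw [h2, ← Submodule.map_span] at hy
      obtain ⟨y', hy', hyy⟩ := hy
      rwa [← Subtype.ext (show y'.1 = y.1 from hyy)]
    · intro j hj
      rw [LayeredFamily.newBasis, dif_pos (by exact hj)]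
    · intro j hj
      obtain ⟨j', rfl⟩ := SyzIndex.exists_concat hj
      rw [h.newBasis_concat, LinearMap.restrictScalars_apply, map_smul,
        LinearMap.mem_ker.1 (h.syz j'.1.2).2, smul_zero]
  absorb := by
    intro j x hx hj
    obtain ⟨⟨γ, i⟩, hne, hc, hok⟩ := j
    simp only at hj hne hc hok
    set T : Set (BlockIndex ok) := {i' | ∀ m, m + 1 = layer x → m + 1 = startLayer i'.1.1.1} with hT
    set U := Submodule.span k ((fun j => (h.syz j).1) '' T) with hU
    set Q := Submodule.span k (Set.range fun i => (Finsupp.single i 1 : I →₀ 𝐀)) with hQ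
    have corr_Q : ∀ j, h.corr j ∈ Q := fun j =>
      Submodule.span_mono (Set.image_subset_range _ _) (h.corr_mem j)
    have single_mem : ∀ j ∈ T, Finsupp.single j.1.2 (basisA k j.1.1) ∈ U ⊔ Q := by
      intro j hjT
      have : Finsupp.single j.1.2 (basisA k j.1.1) = (h.syz j).1 + h.corr j := by
        simp [LayeredFamily.syz]
      rw [this]
      exact Submodule.add_mem_sup (Submodule.subset_span ⟨j, hjT, rfl⟩) (corr_Q j)
    -- The product is first computed modulo `Q`, the scalar combinations of free generators, where
    -- the syzygy of a block may be replaced by its leading term.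
    have hmain : genA k x • (h.syz ⟨(γ, i), hne, hc, hok⟩).1 ∈ U ⊔ Q := by
      rw [LayeredFamily.syz, smul_sub]
      apply Submodule.sub_mem
      -- The product of x and the block is a word whose layers are those of the block preceded by
      -- that of x, hence again a block, starting in the layer of x.
      · obtain ⟨w, hw⟩ := mulList_ne_none [x] γ.2.2
        obtain ⟨v', hv', hlay⟩ := mulList_eq_some [x] hw
        have hwn := isNormalWord_mulList (isNormalWord_singleton x) hw
        have hv'z := forall_ne_z_of_map_layer hlay γ.2.2
        have hwz : ∀ y ∈ w, y ≠ .inr .z := by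
          intro y hy
          rw [hv'] at hy
          rcases List.mem_append.1 hy with hy | hy
          · exact hv'z y hy
          · obtain rfl : y = x := by simpa using hy
            exact hx
        have hmul : genA k x * basisA k γ = basisA k ⟨w, hwn, hwz⟩ := by
          have := word_mul_word (satisfiesRelations_genA k) [x] γ.1
          rw [hw] at this
          simpa [basisA_apply] using this
        obtain ⟨y, l, hγ⟩ : ∃ y l, γ.1 = y :: l := List.exists_cons_of_ne_nil hne
        obtain ⟨y', l', hv⟩ : ∃ y' l', v' = y' :: l' := by
          cases v' with
          | nil => rw [hγ] at hlay; simp at hlay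
          | cons y' l' => exact ⟨y', l', rfl⟩
        have hyy : layer y' = layer y := by
          rw [hγ, hv] at hlay; simp at hlay; exact hlay.1
        have hconn : Connected w := by
          rw [connected_iff_map] at hc ⊢
          rw [hv', List.map_append, hlay, List.isChain_append]
          refine ⟨hc, by simp, ?_⟩
          intro a ha b hb
          have hb' : b = layer x := by simpa using hb.symm
          subst hb'
          rw [linked_iff_of_ne_z hx, hj, startLayer_eq_map]
          rw [Option.mem_def.1 ha]; rfl
        have hwne : w ≠ [] := by rw [hv']; simp
        have hwok : ∀ x ∈ w.head?, ok i (layer x) := by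
          rw [hv', hv]
          intro y₁ hy₁
          obtain rfl : y' = y₁ := by simpa using hy₁
          rw [hyy]; exact hok y (by rw [hγ]; rfl)
        have hjT : (⟨(⟨w, hwn, hwz⟩, i), hwne, hconn, hwok⟩ : BlockIndex ok) ∈ T := by
          intro m hm
          rw [hm]
          simp only [hv']
          simp [startLayer]
        have := single_mem _ hjT
        simpa [hmul] using this
      · refine Submodule.span_induction (p := fun v _ => genA k x • v ∈ U ⊔ Q)
          ?_ ?_ ?_ ?_ (h.corr_mem ⟨(γ, i), hne, hc, hok⟩)
        · rintro _ ⟨i', hi', rfl⟩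
          -- The generators in the correction term absorb the layer of x, so the single letter x is
          -- a block for them.
          have hjT : (⟨(⟨[x], isNormalWord_singleton x, by simpa using hx⟩, i'), by simp,
              by simp [Connected], by
                intro y hy
                obtain rfl : x = y := by simpa using hy
                exact hi' _ hj⟩ : BlockIndex ok) ∈ T := by
            intro m hm
            rw [hm]; simp [startLayer]
          have := single_mem _ hjT
          simpa [basisA_apply] using this
        · simp
        · intro a b _ _ ha hb
          rw [smul_add]; exact Submodule.add_mem _ ha hb
        · intro c a _ ha
          rw [smul_algebra_smul_comm]; exact Submodule.smul_mem _ c ha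
    -- The component in `Q` lies in the kernel of the cover, which is injective on `Q`; so it
    -- vanishes.
    obtain ⟨y₁, hy₁, y₂, hy₂, hy⟩ := Submodule.mem_sup.1 hmain
    have hUker : U ≤ (LinearMap.ker (cover k e)).restrictScalars k := by
      rw [hU, Submodule.span_le]
      rintro _ ⟨j, -, rfl⟩
      exact (h.syz j).2
    have hy2 : y₂ = 0 := by
      apply h.cover_injOn hy₂
      have e1 : cover k e (y₁ + y₂) = 0 := by
        rw [hy, map_smul, LinearMap.mem_ker.1 (h.syz _).2, smul_zero]
      rw [map_add, LinearMap.mem_ker.1 (hUker hy₁), zero_add] at e1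
      exact e1
    rw [hy2, add_zero] at hy
    rw [hy] at hy₁
    have h2 : (fun j => (h.syz j).1) '' T =
        (LinearMap.ker (cover k e)).subtype.restrictScalars k '' (h.syz '' T) := by
      rw [Set.image_image]; rfl
    rw [hU, h2, ← Submodule.map_span] at hy₁
    obtain ⟨y', hy', hyy⟩ := hy₁
    have e2 : y' = genA k x • h.syz ⟨(γ, i), hne, hc, hok⟩ := Subtype.ext hyy
    rw [← e2]
    exact hy'

end GlobalDimensionA

-- Induction on a bound `T` for the absorbed layers. A block ends in a layer at most `T` and starts
-- no higher, and its syzygy absorbs only the layer below the start. Layers begin at 1, so for `T =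
-- 0` nothing is absorbed and the cover is an isomorphism.
open CategoryTheory in
theorem LayeredFamily.hasProjectiveDimensionLT {k : Type u} [Field k] (T : ℕ) :
    ∀ {K I : Type u} [AddCommGroup K] [Module (QuotAlgebra (idealA k)) K] [Module k K]
      [IsScalarTower k (QuotAlgebra (idealA k)) K] {e : I → K} {ok : I → ℕ → Prop},
      LayeredFamily k e ok → (∀ i x, x ≠ .inr .z → ok i (layer x) → layer x ≤ T) →
      HasProjectiveDimensionLT (ModuleCat.of (QuotAlgebra (idealA k)) K) (T + 1) := by
  induction T with
  | zero =>
    intro K I _ _ _ _ e ok h hT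
    have hinj : Function.Injective (cover k e) := by
      have h1 := h.linearIndependent_cover
      have h2 : LinearIndependent k (((cover k e).restrictScalars k) ∘ freeBasis k I) := by
        refine h1.comp (fun j => ⟨j, ?_⟩) (fun j j' hj => congrArg Subtype.val hj)
        intro x hx hok
        have := hT _ x (j.1.2.2 x (List.mem_of_mem_head? hx)) hok
        have := one_le_layer x
        omega
      rw [injective_iff_map_eq_zero]
      intro y hy
      have h3 := (freeBasis k I).linearCombination_repr y
      rw [← h3] at hy ⊢
      have h4 := linearIndependent_iff.1 h2 ((freeBasis k I).repr y) (by
        rw [← Finsupp.apply_linearCombination]; exact hy)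
      rw [h4, map_zero]
    have : Module.Projective (QuotAlgebra (idealA k)) K :=
      Module.Projective.of_equiv (LinearEquiv.ofBijective (cover k e) ⟨hinj, h.surjective_cover⟩)
    have : Projective (ModuleCat.of (QuotAlgebra (idealA k)) K) :=
      (IsProjective.iff_projective K).1 inferInstance
    infer_instance
  | succ T ih =>
    intro K I _ _ _ _ e ok h hT
    rw [hasProjectiveDimensionLT_of_ker (cover k e) h.surjective_cover]
    refine ih h.syzygy ?_
    rintro ⟨⟨⟨l, hl⟩, i⟩, hne, hc, hok⟩ x hx hj
    cases l with
    | nil => exact absurd rfl hne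
    | cons y l =>
      have h1 := startLayer_le_of_connected hc hl.2
      have h2 := hT i y (hl.2 y (by simp)) (hok y (by simp))
      simp only at hj
      omega

-- A basis over `k` of an arbitrary module is a layered family in which everything is absorbed: only
-- the empty word survives as a coefficient. The number 5 is the highest layer of `A`.
open CategoryTheory in
theorem leftGlobalDimension_A_lt_top (k : Type u) [Field k] :
    leftGlobalDimension (QuotAlgebra (idealA k)) < ⊤ := by
  have key : ∀ M : ModuleCat.{u} (QuotAlgebra (idealA k)), projectiveDimension M ≤ (5 : ℕ) := by
    intro M
    rw [projectiveDimension_le_iff]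
    let _ : Module k M := Module.compHom M (algebraMap k (QuotAlgebra (idealA k)))
    have : IsScalarTower k (QuotAlgebra (idealA k)) M := ⟨fun c a m => by
      change (c • a) • m = algebraMap k (QuotAlgebra (idealA k)) c • a • m
      rw [Algebra.smul_def, mul_smul]⟩
    let B := Module.Basis.ofVectorSpace k M
    have hfam : LayeredFamily k (K := M) B (fun _ _ => True) := by
      have hnil : ∀ w : AWord, (∀ x ∈ w.1.head?, ¬ True) → w = ⟨[], trivial, by simp⟩ := by
        rintro ⟨l, hl⟩ h
        cases l with
        | nil => rfl
        | cons x l => exact absurd trivial (h x (by simp))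
      refine ⟨?_, ?_, ?_⟩
      · have := B.linearIndependent.comp
          (fun j : {j : AWord × _ | ∀ x ∈ j.1.1.head?, ¬ True} => j.1.2) (by
            rintro ⟨⟨w, i⟩, h⟩ ⟨⟨w', i'⟩, h'⟩ hi
            obtain rfl : i = i' := hi
            rw [Subtype.mk.injEq, hnil w h, hnil w' h'])
        convert this using 1
        funext j
        simp [hnil j.1.1 j.2, basisA_apply]
      · rw [← B.span_eq, Submodule.span_le]
        rintro _ ⟨i, rfl⟩
        exact Submodule.subset_span ⟨⟨(⟨[], trivial, by simp⟩, i), by simp⟩, by simp [basisA_apply]⟩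
      · intro i x _ _
        simp [B.span_eq]
    exact hfam.hasProjectiveDimensionLT 5 (fun i x hx _ => layer_le_five hx)
  have h5 : leftGlobalDimension (QuotAlgebra (idealA k)) ≤ (5 : ℕ) := iSup_le key
  exact lt_of_le_of_lt h5 (by
    rw [lt_top_iff_ne_top]; intro h
    exact ENat.natCast_ne_top 5 (WithBot.coe_injective h))

/-! ### The global dimension of `C` -/

section GlobalDimensionC

variable (k : Type u) [Field k]

local notation "𝐂" => QuotAlgebra (idealC k)

/-- The generator `z` of `C`. -/
def genZ : QuotAlgebra (idealC k) := QuotAlgebra.gen (idealC k) (.inr .z)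

theorem genZ_quart : genZ k * genZ k * genZ k * genZ k = 0 := (satisfiesRelations_genC k).quart

theorem satisfiesRelations_truncated : SatisfiesRelations
    (Sum.elim 0 (fun _ => Ideal.Quotient.mk (Ideal.span {(Polynomial.X : Polynomial k) ^ 4})
      Polynomial.X)) := by
  constructor
  · intro c _; simp
  · simp only [Sum.elim_inr]
    rw [← map_mul, ← map_mul, ← map_mul, Ideal.Quotient.eq_zero_iff_mem,
      Ideal.mem_span_singleton]
    exact ⟨1, by ring⟩

/-- A commutative quotient of `C` in which `z ^ 3` does not vanish. -/
theorem exists_commutative_quotient : ∃ (B : Type u) (_ : CommRing B) (f : 𝐂 →+* B),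
    f (genZ k) * f (genZ k) * f (genZ k) ≠ 0 := by
  let _ : Algebra k (Polynomial k ⧸ Ideal.span {(Polynomial.X : Polynomial k) ^ 4}) := inferInstance
  refine ⟨Polynomial k ⧸ Ideal.span {(Polynomial.X : Polynomial k) ^ 4}, inferInstance,
    (liftC (k := k) _ (satisfiesRelations_truncated k)).toRingHom, ?_⟩
  have : (liftC (k := k) _ (satisfiesRelations_truncated k)).toRingHom (genZ k) =
      Ideal.Quotient.mk _ Polynomial.X :=
    liftC_gen _ (satisfiesRelations_truncated k) (.inr .z)
  rw [this, ← map_mul, ← map_mul, ne_eq, Ideal.Quotient.eq_zero_iff_mem,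
      Ideal.mem_span_singleton]
  intro h
  have h2 : (Polynomial.X : Polynomial k) ^ 4 ∣ Polynomial.X ^ 3 := by
    convert h using 1; ring
  have := (pow_dvd_pow_iff (Polynomial.X_ne_zero (R := k)) Polynomial.not_isUnit_X).1 h2
  omega

/-- The left ideal generated by `c`, as the image of right multiplication by `c`. -/
noncomputable def mulRightMap (c : 𝐂) : 𝐂 →ₗ[𝐂] 𝐂 := LinearMap.toSpanSingleton 𝐂 𝐂 c

@[simp] theorem mulRightMap_apply (c x : 𝐂) : mulRightMap k c x = x * c := by
  simp [mulRightMap]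

theorem isNormalWord_z_cons {l : List Letter} (h : IsNormalWord l)
    (h3 : l.take 3 ≠ [.inr .z, .inr .z, .inr .z]) : IsNormalWord (.inr .z :: l) := by
  refine ⟨?_, h⟩
  simp [push, h3]

/-- When right multiplication by `c₀` takes `w` to `w'` and no other basis word contributes to `w'`,
the coefficient of `w` can be read off the product. Thus `w` cannot occur in an element annihilated
by `c₀`. -/
theorem coeff_mul_eq (c₀ : 𝐂) (w w' : NWord) (f : NWord → 𝐂)
    (hf : ∀ v, basisC k v * c₀ = f v)
    (h1 : f w = basisC k w') (h2 : ∀ v, v ≠ w → (basisC k).repr (f v) w' = 0) (c : 𝐂) :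
    (basisC k).repr (c * c₀) w' = (basisC k).repr c w := by
  have : (Finsupp.lapply w').comp ((basisC k).repr.toLinearMap.comp (LinearMap.mulRight k c₀)) =
      (Finsupp.lapply w).comp (basisC k).repr.toLinearMap := by
    apply (basisC k).ext
    intro v
    by_cases hv : v = w
    · subst hv
      simp [hf, h1]
    · simp [hf, h2 v hv, hv]
  exact DFunLike.congr_fun this c

theorem mem_of_repr {N : Submodule 𝐂 𝐂} {c : 𝐂}
    (h : ∀ w, (basisC k).repr c w ≠ 0 → basisC k w ∈ N) : c ∈ N := by
  rw [← (basisC k).linearCombination_repr c, Finsupp.linearCombination_apply]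
  refine Submodule.sum_mem _ fun w hw => ?_
  exact Submodule.smul_of_tower_mem _ _ (h w (Finsupp.mem_support_iff.1 hw))

theorem exists_of_take_three {l : List Letter}
    (h : l.take 3 = [.inr .z, .inr .z, .inr .z]) :
    ∃ l', l = .inr .z :: .inr .z :: .inr .z :: l' :=
  ⟨l.drop 3, by
    conv_lhs => rw [← List.take_append_drop 3 l, h]
    rfl⟩

/-- Words ending in z³ are killed by z; every other normal word stays normal when z is appended, and
distinct words stay distinct. -/
theorem ker_mul_z : LinearMap.ker (mulRightMap k (genZ k)) =
    LinearMap.range (mulRightMap k (genZ k * genZ k * genZ k)) := by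
  apply le_antisymm
  · intro c hc
    have hc : c * genZ k = 0 := by simpa using hc
    apply mem_of_repr
    intro w hw
    by_cases h3 : w.1.take 3 = [.inr .z, .inr .z, .inr .z]
    · obtain ⟨l', hl'⟩ := exists_of_take_three h3
      refine ⟨word (QuotAlgebra.gen (idealC k)) l', ?_⟩
      rw [mulRightMap_apply, basisC_apply, hl']
      simp [genZ, mul_assoc]
    · exfalso
      apply hw
      have key := coeff_mul_eq k (genZ k) w ⟨.inr .z :: w.1, isNormalWord_z_cons w.2 h3⟩
        (fun v => owordOf (QuotAlgebra.gen (idealC k)) (push v.1 (.inr .z)))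
        (fun v => by
          rw [basisC_apply]; exact word_mul_letter (satisfiesRelations_genC k) v.1 _)
        (by simp [push, h3, basisC_apply])
        (fun v hv => by
          cases hp : push v.1 (.inr .z) with
          | none => simp
          | some l =>
            have hn : IsNormalWord l := normal_of_push v.2 hp
            rw [owordOf_some, ← basisC_apply k ⟨l, hn⟩, Module.Basis.repr_self,
              Finsupp.single_apply, if_neg]
            intro he
            apply hv
            unfold push at hp
            split_ifs at hp
            cases hp
            simpa [Subtype.ext_iff] using he) c
      rw [← key, hc]; simp
  · rintro _ ⟨c, rfl⟩
    rw [LinearMap.mem_ker, mulRightMap_apply, mulRightMap_apply, mul_assoc, genZ_quart, mul_zero]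

/-- Words ending in z are killed by z³; the remaining normal words stay normal and distinct when z³
is appended. -/
theorem ker_mul_z_cube : LinearMap.ker (mulRightMap k (genZ k * genZ k * genZ k)) =
    LinearMap.range (mulRightMap k (genZ k)) := by
  apply le_antisymm
  · intro c hc
    have hc : c * (genZ k * genZ k * genZ k) = 0 := by simpa using hc
    apply mem_of_repr
    intro w hw
    by_cases h1 : w.1.head? = some (.inr .z)
    · obtain ⟨l', hl'⟩ : ∃ l', w.1 = .inr .z :: l' := by
        obtain ⟨l, hl⟩ := w
        cases l with
        | nil => simp at h1
        | cons x l => exact ⟨l, by simp at h1; simp [h1]⟩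
      refine ⟨word (QuotAlgebra.gen (idealC k)) l', ?_⟩
      rw [mulRightMap_apply, basisC_apply, hl']
      simp [genZ]
    · exfalso
      apply hw
      have hn : ∀ w : NWord, w.1.head? ≠ some (.inr .z) →
          IsNormalWord (.inr .z :: .inr .z :: .inr .z :: w.1) := by
        rintro ⟨l, hl⟩ h
        refine isNormalWord_z_cons (isNormalWord_z_cons (isNormalWord_z_cons hl ?_) ?_) ?_
        all_goals
          cases l with
          | nil => simp
          | cons x l => simp at h; simp [h]
      have key := coeff_mul_eq k (genZ k * genZ k * genZ k) w
        ⟨.inr .z :: .inr .z :: .inr .z :: w.1, hn w h1⟩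
        (fun v => if v.1.head? = some (.inr .z) then 0 else
          word (QuotAlgebra.gen (idealC k)) (.inr .z :: .inr .z :: .inr .z :: v.1))
        (fun v => by
          split_ifs with hv
          · obtain ⟨l, hl⟩ := v
            cases l with
            | nil => simp at hv
            | cons x l =>
              obtain rfl : x = .inr .z := by simpa using hv
              have : word (QuotAlgebra.gen (idealC k)) l * (genZ k * genZ k * genZ k * genZ k) = 0 := by
                rw [genZ_quart, mul_zero]
              rw [basisC_apply]
              simpa [genZ, mul_assoc] using this
          · rw [basisC_apply]
            simp [genZ, mul_assoc])
        (by simp [h1, basisC_apply])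
        (fun v hv => by
          split_ifs with hv1
          · simp
          · rw [← basisC_apply k ⟨_, hn v hv1⟩, Module.Basis.repr_self,
              Finsupp.single_apply, if_neg]
            intro he
            apply hv
            simpa [Subtype.ext_iff] using he) c
      rw [← key, hc]; simp
  · rintro _ ⟨c, rfl⟩
    have h := genZ_quart k
    rw [LinearMap.mem_ker, mulRightMap_apply, mulRightMap_apply, mul_assoc]
    simp only [mul_assoc] at h ⊢
    rw [h, mul_zero]

/-- The element `e` is the image of `c` under a section of the surjection from `C` to the left ideal
of `c`; linearity carries `d * c = 0` to `d * e = 0`. -/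
theorem exists_section_of_projective {c d : 𝐂} (hdc : d * c = 0)
    (hP : Module.Projective 𝐂 (LinearMap.range (mulRightMap k c))) :
    ∃ e : 𝐂, e * c = c ∧ d * e = 0 := by
  obtain ⟨s, hs⟩ := Module.projective_lifting_property (mulRightMap k c).rangeRestrict
    LinearMap.id (LinearMap.surjective_rangeRestrict _)
  let c' : LinearMap.range (mulRightMap k c) := ⟨c, 1, by simp⟩
  refine ⟨s c', ?_, ?_⟩
  · have := congrArg Subtype.val (LinearMap.congr_fun hs c')
    simpa [c'] using this
  · have : d • c' = 0 := Subtype.ext (by simpa [c'] using hdc)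
    rw [← smul_eq_mul, ← map_smul, this, map_zero]

-- Both ideals are treated at once because each is the first syzygy of the other. If one of them
-- were projective, the resulting section would force z³ = 0 in the commutative quotient k[X]/(X⁴).
open CategoryTheory in
theorem not_hasProjectiveDimensionLT (n : ℕ) :
    ¬ HasProjectiveDimensionLT (ModuleCat.of 𝐂 (LinearMap.range (mulRightMap k (genZ k)))) (n + 1) ∧
    ¬ HasProjectiveDimensionLT (ModuleCat.of 𝐂
      (LinearMap.range (mulRightMap k (genZ k * genZ k * genZ k)))) (n + 1) := by
  induction n with
  | zero =>
    obtain ⟨B, _, f, hf⟩ := exists_commutative_quotient k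
    have hq := genZ_quart k
    constructor
    · intro h
      have hP : Projective (ModuleCat.of 𝐂 (LinearMap.range (mulRightMap k (genZ k)))) :=
        projective_iff_hasProjectiveDimensionLT_one.2 h
      obtain ⟨e, h1, h2⟩ := exists_section_of_projective k hq
        ((IsProjective.iff_projective _).2 hP)
      have h1' := congrArg f h1
      have h2' := congrArg f h2
      simp only [map_mul, map_zero] at h1' h2'
      apply hf
      calc f (genZ k) * f (genZ k) * f (genZ k)
          = f (genZ k) * f (genZ k) * (f e * f (genZ k)) := by rw [h1']
        _ = f (genZ k) * f (genZ k) * f (genZ k) * f e := by ring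
        _ = 0 := h2'
    · intro h
      have hP : Projective (ModuleCat.of 𝐂
          (LinearMap.range (mulRightMap k (genZ k * genZ k * genZ k)))) :=
        projective_iff_hasProjectiveDimensionLT_one.2 h
      obtain ⟨e, h1, h2⟩ := exists_section_of_projective k
        (show genZ k * (genZ k * genZ k * genZ k) = 0 by rw [← hq]; simp only [mul_assoc])
        ((IsProjective.iff_projective _).2 hP)
      have h1' := congrArg f h1
      have h2' := congrArg f h2
      simp only [map_mul, map_zero] at h1' h2'
      apply hf
      calc f (genZ k) * f (genZ k) * f (genZ k)
          = f e * (f (genZ k) * f (genZ k) * f (genZ k)) := by rw [h1']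
        _ = f (genZ k) * f e * (f (genZ k) * f (genZ k)) := by ring
        _ = 0 := by rw [h2', zero_mul]
  | succ n ih =>
    constructor
    · rw [hasProjectiveDimensionLT_of_ker (mulRightMap k (genZ k)).rangeRestrict
        (LinearMap.surjective_rangeRestrict _), LinearMap.ker_rangeRestrict, ker_mul_z]
      exact ih.2
    · rw [hasProjectiveDimensionLT_of_ker
        (mulRightMap k (genZ k * genZ k * genZ k)).rangeRestrict
        (LinearMap.surjective_rangeRestrict _), LinearMap.ker_rangeRestrict, ker_mul_z_cube]
      exact ih.1

open CategoryTheory in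
theorem leftGlobalDimension_C_eq_top : leftGlobalDimension (QuotAlgebra (idealC k)) = ⊤ := by
  rw [← top_le_iff]
  have h : projectiveDimension
      (ModuleCat.of 𝐂 (LinearMap.range (mulRightMap k (genZ k)))) = ⊤ := by
    by_contra hne
    obtain ⟨n, hn⟩ := (projectiveDimension_ne_top_iff _).1 hne
    exact (not_hasProjectiveDimensionLT k n).1 hn
  rw [← h]
  exact le_iSup (fun M : ModuleCat.{u} (QuotAlgebra (idealC k)) => projectiveDimension M) _

end GlobalDimensionC

/-! ### Multilinear bar cochains -/

namespace BarCochain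

section Multilinear

variable {k : Type u} {M : Type v} [Field k] [AddCommGroup M] [Module k M]

/-- Cochains that are linear in every variable. -/
structure IsMultilinear (f : BarCochain k M) : Prop where
  add : ∀ (a b : List M) (x y : M), f (a ++ (x + y) :: b) = f (a ++ x :: b) + f (a ++ y :: b)
  smul : ∀ (a b : List M) (c : k) (x : M), f (a ++ (c • x) :: b) = c * f (a ++ x :: b)

theorem isMultilinear_of_mem {ℳ : ℕ → Submodule k M} {n j : ℕ} {f : BarCochain k M}
    (hf : f ∈ homogeneous ℳ n j) : IsMultilinear f := ⟨hf.1, hf.2.1⟩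

theorem IsMultilinear.tail {f : BarCochain k M} (hf : IsMultilinear f) (x : M) :
    IsMultilinear (tail x f) :=
  ⟨fun a b => hf.add (x :: a) b, fun a b => hf.smul (x :: a) b⟩

/-- A multilinear cochain as a function of its first variable. -/
def IsMultilinear.headMap {f : BarCochain k M} (hf : IsMultilinear f) (l : List M) : M →ₗ[k] k where
  toFun x := f (x :: l)
  map_add' x y := hf.add [] l x y
  map_smul' c x := hf.smul [] l c x

theorem IsMultilinear.zero_cons {f : BarCochain k M} (hf : IsMultilinear f) (l : List M) :
    f (0 :: l) = 0 := (hf.headMap l).map_zero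

variable {W : Type*} (b : Module.Basis W k M)

/-- The multilinear extension of a function on lists of basis elements. -/
noncomputable def extendAux : List M → (List W → k) → k
  | [], φ => φ []
  | c :: l, φ => (b.repr c).sum fun w a => a * extendAux l fun l' => φ (w :: l')

/-- The multilinear extension of a function on lists of basis elements, as a cochain. -/
noncomputable def extend (φ : List W → k) : BarCochain k M := fun l => extendAux b l φ

theorem extend_cons (φ : List W → k) (c : M) (l : List M) : extend b φ (c :: l) =
    (b.repr c).sum fun w a => a * extend b (fun l' => φ (w :: l')) l := rfl

theorem extend_map (l : List W) : ∀ φ : List W → k, extend b φ (l.map b) = φ l := by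
  induction l with
  | nil => intro φ; rfl
  | cons w l ih =>
    intro φ
    rw [List.map_cons, extend_cons, Module.Basis.repr_self, Finsupp.sum_single_index (by simp), ih,
      one_mul]

theorem isMultilinear_extend (φ : List W → k) : IsMultilinear (extend b φ) := by
  constructor
  · intro a b' x y
    induction a generalizing φ with
    | nil =>
      simp only [List.nil_append, extend_cons, map_add]
      rw [Finsupp.sum_add_index' (by simp) (by intros; ring)]
    | cons c a ih =>
      simp only [List.cons_append, extend_cons, ih, mul_add, Finsupp.sum_add]
  · intro a b' r x
    induction a generalizing φ with
    | nil =>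
      simp only [List.nil_append, extend_cons, map_smul]
      rw [Finsupp.sum_smul_index (by simp), Finsupp.mul_sum]
      simp only [mul_assoc]
    | cons c a ih =>
      simp only [List.cons_append, extend_cons, ih, Finsupp.mul_sum]
      simp only [mul_left_comm]

theorem IsMultilinear.eq_extend {f : BarCochain k M} (hf : IsMultilinear f) :
    f = extend b fun l => f (l.map b) := by
  ext l
  induction l generalizing f with
  | nil => rfl
  | cons c l ih =>
    have h1 : f (c :: l) = hf.headMap l c := rfl
    rw [h1, extend_cons]
    conv_lhs => rw [← b.linearCombination_repr c, Finsupp.linearCombination_apply, map_finsuppSum]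
    apply Finsupp.sum_congr
    intro w _
    rw [map_smul, smul_eq_mul]
    congr 1
    exact ih (hf.tail (b w))

/-- Multilinear cochains are determined by their values on a basis. -/
theorem IsMultilinear.ext_basis {f g : BarCochain k M} (hf : IsMultilinear f)
    (hg : IsMultilinear g) (h : ∀ l : List W, f (l.map b) = g (l.map b)) : f = g := by
  rw [hf.eq_extend b, hg.eq_extend b]
  congr 1
  exact funext h

theorem extend_eq_zero (l : List M) : ∀ (φ : List W → k),
    (∀ l' : List W, List.Forall₂ (fun c w => b.repr c w ≠ 0) l l' → φ l' = 0) →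
    extend b φ l = 0 := by
  induction l with
  | nil => intro φ h; exact h [] .nil
  | cons c l ih =>
    intro φ h
    rw [extend_cons]
    refine Finset.sum_eq_zero fun w hw => ?_
    exact mul_eq_zero_of_right _
      (ih _ fun l' hl' => h _ (.cons (Finsupp.mem_support_iff.1 hw) hl'))

/-- The total degree of a list of basis elements. -/
def totalDegree (deg : W → ℕ) (l : List W) : ℕ := (l.map deg).sum

/-- Bihomogeneity of a cochain given on a basis is read off the support of its values. -/
theorem extend_mem_homogeneous {ℳ : ℕ → Submodule k M} (deg : W → ℕ)
    (hdeg : ∀ c i w, c ∈ ℳ i → b.repr c w ≠ 0 → deg w = i) {n j : ℕ} {φ : List W → k}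
    (hφ : ∀ l, φ l ≠ 0 → l.length = n ∧ totalDegree deg l = j) :
    extend b φ ∈ homogeneous ℳ n j := by
  have hml := isMultilinear_extend b φ
  refine ⟨hml.add, hml.smul, fun l hl => ?_, fun l e he hj => ?_⟩
  · apply extend_eq_zero
    intro l' hl'
    by_contra h
    exact hl (hl'.length_eq.trans (hφ l' h).1)
  · apply extend_eq_zero
    intro l' hl'
    by_contra h
    apply hj
    rw [← (hφ l' h).2]
    have key : ∀ {l : List M} {l' : List W} {e : List ℕ},
        List.Forall₂ (fun c w => b.repr c w ≠ 0) l l' → List.Forall₂ (fun x i => x ∈ ℳ i) l e →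
        l'.map deg = e := by
      intro l l' e h1 h2
      induction h1 generalizing e with
      | nil => cases h2; rfl
      | cons h _ ih =>
        cases h2 with
        | cons h3 h4 => rw [List.map_cons, ih h4, hdeg _ _ _ h3 h]
    rw [totalDegree, key hl' he]

end Multilinear

section Differential

variable {k : Type u} {M : Type v} [Field k] [NonUnitalRing M] [Module k M]

theorem d_d_apply (l : List M) : ∀ f : BarCochain k M, d (d f) l = 0 := by
  induction l with
  | nil => intro f; simp
  | cons x l ih =>
    intro f
    match l, ih with
    | [], _ => simp
    | [y], _ => simp [d_cons]
    | y :: z :: l, ih =>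
      have e1 : tail y (tail x (d f)) = tail (x * y) f - tail y (d (tail x f)) := by
        ext m; simp [d_cons]
      have e2 := ih (tail x f)
      rw [d_cons] at e2
      rw [d_cons, d_cons, d_cons (tail x (d f)), e1, map_sub, sub_apply, tail_apply, d_cons f,
        mul_assoc]
      linear_combination e2

theorem d_d (f : BarCochain k M) : d (d f) = 0 := ext fun l => d_d_apply l f

theorem length_contract : ∀ (i : ℕ) (l : List M), i + 1 < l.length →
    (contract i l).length + 1 = l.length
  | 0, [], h => by simp at h
  | 0, [_], h => by simp at h
  | 0, x :: y :: l, _ => by simp [contract]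
  | i + 1, [], h => by simp at h
  | i + 1, x :: l, h => by
    have := length_contract i l (by simpa using h)
    simp [contract, this]

variable [IsScalarTower k M M] [SMulCommClass k M M]

theorem IsMultilinear.d {f : BarCochain k M} (hf : IsMultilinear f) : IsMultilinear (d f) := by
  constructor
  · intro a b x y
    induction a generalizing f with
    | nil =>
      cases b with
      | nil => simp
      | cons c b =>
        have h1 : BarCochain.tail (x + y) f = BarCochain.tail x f + BarCochain.tail y f :=
          BarCochain.ext fun l => hf.add [] l x y
        have h2 := hf.add [] b (x * c) (y * c)
        simp only [List.nil_append] at h2 ⊢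
        rw [d_cons, d_cons, d_cons, h1, add_mul, h2, map_add, add_apply]
        ring
    | cons c a ih =>
      have h1 := ih (hf.tail c)
      cases a with
      | nil =>
        have h2 := hf.add [] b (c * x) (c * y)
        simp only [List.nil_append, List.cons_append] at h1 h2 ⊢
        rw [d_cons, d_cons, d_cons, h1, mul_add, h2]
        ring
      | cons c' a =>
        have h2 := hf.add (c * c' :: a) b x y
        simp only [List.cons_append] at h1 h2 ⊢
        rw [d_cons, d_cons, d_cons, h1, h2]
        ring
  · intro a b r x
    induction a generalizing f with
    | nil =>
      cases b with
      | nil => simp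
      | cons c b =>
        have h1 : BarCochain.tail (r • x) f = r • BarCochain.tail x f :=
          BarCochain.ext fun l => hf.smul [] l r x
        have h2 := hf.smul [] b r (x * c)
        simp only [List.nil_append] at h2 ⊢
        rw [d_cons, d_cons, h1, smul_mul_assoc, h2, map_smul, smul_apply]
        ring
    | cons c a ih =>
      have h1 := ih (hf.tail c)
      cases a with
      | nil =>
        have h2 := hf.smul [] b r (c * x)
        simp only [List.nil_append, List.cons_append] at h1 h2 ⊢
        rw [d_cons, d_cons, h1, mul_smul_comm, h2]
        ring
      | cons c' a =>
        have h2 := hf.smul (c * c' :: a) b r x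
        simp only [List.cons_append] at h1 h2 ⊢
        rw [d_cons, d_cons, h1, h2]
        ring

theorem forall₂_contract {ℳ : ℕ → Submodule k M}
    (hmul : ∀ i j x y, x ∈ ℳ i → y ∈ ℳ j → x * y ∈ ℳ (i + j)) :
    ∀ (i : ℕ) (l : List M) (e : List ℕ), i + 1 < l.length →
      List.Forall₂ (fun x i => x ∈ ℳ i) l e →
      ∃ e', List.Forall₂ (fun x i => x ∈ ℳ i) (contract i l) e' ∧ e'.sum = e.sum
  | 0, [], _, h, _ => by simp at h
  | 0, [_], _, h, _ => by simp at h
  | 0, x :: y :: l, e, _, he => by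
    cases he with
    | cons h1 he =>
      cases he with
      | cons h2 he =>
        exact ⟨_, .cons (hmul _ _ _ _ h1 h2) he, by simp [add_assoc]⟩
  | i + 1, [], _, h, _ => by simp at h
  | i + 1, x :: l, e, h, he => by
    cases he with
    | cons h1 he =>
      obtain ⟨e', h2, h3⟩ := forall₂_contract hmul i l _ (by simpa using h) he
      exact ⟨_, .cons h1 h2, by simp [h3]⟩

theorem d_mem_homogeneous {ℳ : ℕ → Submodule k M}
    (hmul : ∀ i j x y, x ∈ ℳ i → y ∈ ℳ j → x * y ∈ ℳ (i + j)) {n j : ℕ} {f : BarCochain k M}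
    (hf : f ∈ homogeneous ℳ n j) : d f ∈ homogeneous ℳ (n + 1) j := by
  have hml := (isMultilinear_of_mem hf).d
  refine ⟨hml.add, hml.smul, fun l hl => ?_, fun l e he hj => ?_⟩
  · rw [d_apply]
    refine Finset.sum_eq_zero fun i hi => ?_
    rw [Finset.mem_range] at hi
    have := length_contract i l (by omega)
    rw [hf.2.2.1 _ (by omega), mul_zero]
  · rw [d_apply]
    refine Finset.sum_eq_zero fun i hi => ?_
    rw [Finset.mem_range] at hi
    obtain ⟨e', h1, h2⟩ := forall₂_contract hmul i l e (by omega) he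
    rw [hf.2.2.2 _ e' h1 (by rwa [h2]), mul_zero]

theorem d_mem_coboundaries {ℳ : ℕ → Submodule k M}
    (hmul : ∀ i j x y, x ∈ ℳ i → y ∈ ℳ j → x * y ∈ ℳ (i + j)) {n j : ℕ} {f : BarCochain k M}
    (hf : f ∈ homogeneous ℳ n j) : d f ∈ coboundaries ℳ (n + 1) j :=
  ⟨⟨d_mem_homogeneous hmul hf, d_d f⟩, f, hf, rfl⟩

/-! ### The differential on a multiplicative basis -/

variable {W : Type*} (mul : W → W → Option W)

/-- The bar differential of a function on lists of elements of a partial semigroup. -/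
def delta {R : Type*} [AddCommGroup R] : List W → (List W → R) → R
  | [], _ => 0
  | [_], _ => 0
  | w :: v :: l, φ => ((mul w v).elim 0 fun u => φ (u :: l)) - delta (v :: l) fun l' => φ (w :: l')

theorem map_delta {R S : Type*} [AddCommGroup R] [AddCommGroup S] (F : R →+ S) (l : List W) :
    ∀ φ : List W → R, F (delta mul l φ) = delta mul l fun l' => F (φ l') := by
  induction l with
  | nil => intro φ; simp [delta]
  | cons w l ih =>
    intro φ
    match l, ih with
    | [], _ => simp [delta]
    | v :: l, ih =>
      rw [delta, delta, map_sub, ih]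
      cases mul w v <;> simp

/-- Since products of basis elements are basis elements or zero, cocycle conditions become purely
combinatorial statements about lists of words. -/
theorem d_map_basis (b : Module.Basis W k M) (hmul : ∀ w v, b w * b v = (mul w v).elim 0 b)
    (l : List W) : ∀ f : BarCochain k M, IsMultilinear f →
    d f (l.map b) = delta mul l fun l' => f (l'.map b) := by
  induction l with
  | nil => intro f _; simp [delta]
  | cons w l ih =>
    intro f hf
    match l, ih with
    | [], _ => simp [delta]
    | v :: l, ih =>
      have h := ih _ (hf.tail (b w))
      rw [List.map_cons, List.map_cons, d_cons, delta, hmul]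
      rw [List.map_cons] at h
      rw [h]
      congr 1
      cases mul w v with
      | none => simp [hf.zero_cons]
      | some u => simp

theorem delta_sub (l : List W) : ∀ φ ψ : List W → k,
    delta mul l (fun l' => φ l' - ψ l') = delta mul l φ - delta mul l ψ := by
  induction l with
  | nil => intro φ ψ; simp [delta]
  | cons w l ih =>
    intro φ ψ
    match l, ih with
    | [], _ => simp [delta]
    | v :: l, ih =>
      rw [delta, delta, delta, ih]
      cases mul w v <;> simp <;> ring

theorem delta_zero (l : List W) : delta mul l (fun _ => (0 : k)) = 0 := by
  induction l with
  | nil => simp [delta]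
  | cons w l ih =>
    match l, ih with
    | [], _ => simp [delta]
    | v :: l, ih =>
      rw [delta, ih]
      cases mul w v <;> simp

theorem delta_neg (l : List W) (φ : List W → k) :
    delta mul l (fun l' => -φ l') = -delta mul l φ := by
  have := delta_sub (k := k) mul l (fun _ => 0) φ
  rw [delta_zero] at this
  simpa using this

/-- If the first entry of the product is determined up to `r` by the first factor, then the
differential at a list only depends on the values at lists with the same first entry up to `r`. -/
theorem delta_eq_zero_of_head {r : W → Prop} (hr : ∀ w v u, r w → mul w v = some u → r u)
    (w : W) (l : List W) (φ : List W → k) (hw : r w)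
    (hφ : ∀ v l', r v → φ (v :: l') = 0) : delta mul (w :: l) φ = 0 := by
  cases l with
  | nil => simp [delta]
  | cons v l =>
    rw [delta]
    have : (fun l' => φ (w :: l')) = fun _ => 0 := funext fun l' => hφ w l' hw
    rw [this, delta_zero, sub_zero]
    cases h : mul w v with
    | none => rfl
    | some u => exact hφ u l (hr w v u hw h)

theorem delta_congr_head {r : W → Prop} (hr : ∀ w v u, r w → mul w v = some u → r u)
    (w : W) (l : List W) (φ ψ : List W → k) (hw : r w)
    (hφ : ∀ v l', r v → φ (v :: l') = ψ (v :: l')) :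
    delta mul (w :: l) φ = delta mul (w :: l) ψ := by
  rw [← sub_eq_zero, ← delta_sub]
  exact delta_eq_zero_of_head mul hr w l _ hw fun v l' hv => sub_eq_zero.2 (hφ v l' hv)

end Differential

end BarCochain

/-! ### The augmentation ideal of `C` -/

section Grading

variable {k : Type u} [Field k] {X : Type} (I : TwoSidedIdeal (FreeAlgebra k X))

theorem QuotAlgebra.gen_mem_grading (x : X) : QuotAlgebra.gen I x ∈ QuotAlgebra.grading I 1 := by
  rw [QuotAlgebra.grading, pow_one]
  exact Submodule.subset_span ⟨x, rfl⟩

theorem augmentationGrading_mul {A : Type v} [Ring A] [Algebra k A] (𝒜 : ℕ → Submodule k A)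
    [SetLike.GradedMonoid 𝒜] (i j : ℕ) (x y : augmentationIdeal 𝒜)
    (hx : x ∈ augmentationGrading 𝒜 i) (hy : y ∈ augmentationGrading 𝒜 j) :
    x * y ∈ augmentationGrading 𝒜 (i + j) :=
  SetLike.GradedMul.mul_mem (A := 𝒜) (i := i) (j := j) hx hy

theorem mem_augmentationIdeal {A : Type v} [Ring A] [Algebra k A] (𝒜 : ℕ → Submodule k A)
    [SetLike.GradedMonoid 𝒜] {j : ℕ} (hj : j ≠ 0) {x : A} (hx : x ∈ 𝒜 j) :
    x ∈ augmentationIdeal 𝒜 := by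
  obtain ⟨i, rfl⟩ := Nat.exists_eq_succ_of_ne_zero hj
  exact Submodule.mem_iSup_of_mem (p := fun j => 𝒜 (j + 1)) i hx

/-- A generator as an element of the augmentation ideal. -/
def augGen (x : X) : augmentationIdeal (QuotAlgebra.grading I) :=
  ⟨QuotAlgebra.gen I x, mem_augmentationIdeal _ one_ne_zero (QuotAlgebra.gen_mem_grading I x)⟩

theorem augGen_mem (x : X) : augGen I x ∈ augmentationGrading (QuotAlgebra.grading I) 1 :=
  QuotAlgebra.gen_mem_grading I x

end Grading

/-- The type of nonempty normal words. -/
abbrev PWord : Type := {l : List Letter // IsNormalWord l ∧ l ≠ []}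

namespace PWord

/-- The degree of a word. -/
def length (w : PWord) : ℕ := w.1.length

theorem length_pos (w : PWord) : 0 < w.length := List.length_pos_iff.2 w.2.2

/-- The first letter of a word. -/
def first (w : PWord) : Letter := w.1.getLast w.2.2

/-- The last letter of a word. -/
def last (w : PWord) : Letter := w.1.head w.2.2

/-- The product of two words. -/
def mul (w v : PWord) : Option PWord :=
  (mulList w.1 v.1).pmap (fun l hl => ⟨l, hl⟩) fun l hl => by
    refine ⟨isNormalWord_mulList w.2.1 hl, ?_⟩
    obtain ⟨v', rfl, -⟩ := mulList_eq_some _ hl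
    simp [w.2.2]

theorem mul_eq_some {w v u : PWord} : mul w v = some u ↔ mulList w.1 v.1 = some u.1 := by
  rw [mul, Option.pmap_eq_some_iff]
  constructor
  · rintro ⟨l, _, h, rfl⟩; exact h
  · intro h; exact ⟨u.1, u.2, h, rfl⟩

theorem mul_eq_none {w v : PWord} : mul w v = none ↔ mulList w.1 v.1 = none := by
  rw [mul, Option.pmap_eq_none_iff]

theorem append_of_mul {w v u : PWord} (h : mul w v = some u) :
    ∃ v', u.1 = v' ++ w.1 ∧ v'.map layer = v.1.map layer :=
  mulList_eq_some _ (mul_eq_some.1 h)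

theorem map_layer_of_mul {w v u : PWord} (h : mul w v = some u) :
    u.1.map layer = v.1.map layer ++ w.1.map layer := by
  obtain ⟨v', h1, h2⟩ := append_of_mul h
  rw [h1, List.map_append, h2]

theorem length_of_mul {w v u : PWord} (h : mul w v = some u) :
    u.length = w.length + v.length := by
  have := congrArg List.length (map_layer_of_mul h)
  simp only [List.length_map, List.length_append] at this
  rw [length, this, length, length, add_comm]

theorem first_of_mul {w v u : PWord} (h : mul w v = some u) : u.first = w.first := by
  obtain ⟨u, hu⟩ := u
  obtain ⟨v', h1, -⟩ := append_of_mul h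
  dsimp only at h1
  subst h1
  exact List.getLast_append_of_ne_nil _ w.2.2

theorem layer_last_of_mul {w v u : PWord} (h : mul w v = some u) :
    layer u.last = layer v.last := by
  have h1 := congrArg List.head? (map_layer_of_mul h)
  rw [List.head?_append_of_ne_nil _ (by simpa using v.2.2), List.head?_map, List.head?_map,
    List.head?_eq_some_head u.2.2, List.head?_eq_some_head v.2.2] at h1
  simpa [last] using h1

end PWord

section AugBasis

variable (k : Type u) [Field k]

/-- The augmentation ideal of `C`. -/
abbrev AugC : Type u := augmentationIdeal (QuotAlgebra.grading (idealC k))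

/-- The grading of the augmentation ideal of `C`. -/
abbrev gradC : ℕ → Submodule k (AugC k) := augmentationGrading (QuotAlgebra.grading (idealC k))

theorem word_mem_grading (l : List Letter) : word (QuotAlgebra.gen (idealC k)) l ∈
    QuotAlgebra.grading (idealC k) l.length := by
  induction l with
  | nil => exact SetLike.GradedOne.one_mem
  | cons x l ih =>
    exact SetLike.GradedMul.mul_mem ih (QuotAlgebra.gen_mem_grading (idealC k) x)

theorem grading_le_span (j : ℕ) : QuotAlgebra.grading (idealC k) j ≤
    Submodule.span k (basisC k '' {w | w.1.length = j}) := by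
  induction j with
  | zero =>
    rw [QuotAlgebra.grading, pow_zero, Submodule.one_le]
    refine Submodule.subset_span ⟨⟨[], trivial⟩, rfl, ?_⟩
    rw [basisC_apply]; rfl
  | succ j ih =>
    rw [QuotAlgebra.grading, pow_succ]
    refine (mul_le_mul_left ih _).trans ?_
    rw [Submodule.span_mul_span, Submodule.span_le]
    rintro _ ⟨_, ⟨w, hw, rfl⟩, _, ⟨x, rfl⟩, rfl⟩
    dsimp only
    rw [basisC_apply, word_mul_letter (satisfiesRelations_genC k)]
    cases h : push w.1 x with
    | none => exact zero_mem _
    | some l =>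
      refine Submodule.subset_span ⟨⟨l, normal_of_push w.2 h⟩, ?_, basisC_apply _ _⟩
      obtain ⟨x', rfl, -⟩ := push_eq_some h
      simpa using hw

theorem length_eq_of_repr_ne_zero {j : ℕ} {c : QuotAlgebra (idealC k)}
    (hc : c ∈ QuotAlgebra.grading (idealC k) j) {w : NWord} (hw : (basisC k).repr c w ≠ 0) :
    w.1.length = j :=
  (basisC k).mem_span_image.1 (grading_le_span k j hc) (Finsupp.mem_support_iff.2 hw)

/-- A nonempty word as an element of the augmentation ideal. -/
noncomputable def augWord (l : List Letter) (hl : l ≠ []) : AugC k :=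
  ⟨word (QuotAlgebra.gen (idealC k)) l,
    mem_augmentationIdeal _ (by simpa using hl) (word_mem_grading k l)⟩

theorem augWord_mem (l : List Letter) (hl : l ≠ []) : augWord k l hl ∈ gradC k l.length :=
  word_mem_grading k l

/-- The basis of the augmentation ideal of `C` that consists of the nonempty normal words. -/
noncomputable def augBasis : Module.Basis PWord k (AugC k) :=
  Module.Basis.mk (v := fun w : PWord => augWord k w.1 w.2.2)
    (by
      apply LinearIndependent.of_comp
        (augmentationIdeal (QuotAlgebra.grading (idealC k))).toSubmodule.subtype
      exact (linearIndependent_wordC k).comp (fun w : PWord => (⟨w.1, w.2.1⟩ : NWord))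
        fun v w h => Subtype.ext (congrArg (·.1) h))
    (by
      rintro ⟨c, hc⟩ -
      have h1 : c ∈ Submodule.span k (Set.range fun w : PWord =>
          word (QuotAlgebra.gen (idealC k)) w.1) := by
        revert hc
        refine fun hc => (iSup_le fun j => ?_ :
          (⨆ j : ℕ, QuotAlgebra.grading (idealC k) (j + 1)) ≤ _) hc
        refine (grading_le_span k (j + 1)).trans (Submodule.span_mono ?_)
        rintro _ ⟨w, hw, rfl⟩
        refine ⟨⟨w.1, w.2, ?_⟩, (basisC_apply k w).symm⟩
        rintro h
        rw [Set.mem_ofPred_eq, h] at hw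
        simp at hw
      have h2 : (Set.range fun w : PWord => word (QuotAlgebra.gen (idealC k)) w.1) =
          (augmentationIdeal (QuotAlgebra.grading (idealC k))).toSubmodule.subtype ''
            (Set.range fun w : PWord => augWord k w.1 w.2.2) := by
        rw [← Set.range_comp]; rfl
      rw [h2, Submodule.span_image] at h1
      obtain ⟨c', h3, h4⟩ := h1
      have : c' = ⟨c, hc⟩ := Subtype.ext h4
      exact this ▸ h3)

theorem augBasis_apply (w : PWord) : augBasis k w = augWord k w.1 w.2.2 := by
  simp [augBasis]

theorem coe_augBasis (w : PWord) :
    (augBasis k w : QuotAlgebra (idealC k)) = word (QuotAlgebra.gen (idealC k)) w.1 := by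
  rw [augBasis_apply]; rfl

theorem augBasis_mem (w : PWord) : augBasis k w ∈ gradC k w.length := by
  rw [augBasis_apply]; exact augWord_mem k _ _

theorem augBasis_mul (w v : PWord) :
    augBasis k w * augBasis k v = (PWord.mul w v).elim 0 (augBasis k) := by
  apply Subtype.ext
  have h := word_mul_word (satisfiesRelations_genC k) w.1 v.1
  rw [← coe_augBasis, ← coe_augBasis] at h
  refine h.trans ?_
  cases h2 : PWord.mul w v with
  | none => rw [PWord.mul_eq_none.1 h2]; rfl
  | some u => rw [PWord.mul_eq_some.1 h2, owordOf_some, ← coe_augBasis]; rfl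

theorem length_eq_of_augBasis_repr_ne_zero (c : AugC k) (j : ℕ) (w : PWord) (hc : c ∈ gradC k j)
    (hw : (augBasis k).repr c w ≠ 0) : w.length = j := by
  have h1 : (c : QuotAlgebra (idealC k)) =
      Finsupp.linearCombination k (basisC k)
        (((augBasis k).repr c).mapDomain fun w : PWord => (⟨w.1, w.2.1⟩ : NWord)) := by
    conv_lhs => rw [← (augBasis k).linearCombination_repr c]
    rw [Finsupp.linearCombination_mapDomain]
    change (augmentationIdeal (QuotAlgebra.grading (idealC k))).toSubmodule.subtype _ = _
    rw [Finsupp.apply_linearCombination]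
    congr 2
    ext1 w
    exact (coe_augBasis k w).trans (basisC_apply k ⟨w.1, w.2.1⟩).symm
  refine length_eq_of_repr_ne_zero k (w := ⟨w.1, w.2.1⟩) (c := c) (j := j) hc ?_
  rw [h1, Module.Basis.repr_linearCombination]
  have h2 := Finsupp.mapDomain_apply (f := fun w : PWord => (⟨w.1, w.2.1⟩ : NWord))
    (fun v w h => Subtype.ext (congrArg (·.1) h)) ((augBasis k).repr c) w
  rw [h2]
  exact hw

end AugBasis

/-! ### The Yoneda algebra in cohomological degrees at most `2` -/

open BarCochain

section General

variable {k : Type u} {M : Type v} [Field k] [NonUnitalRing M] [Module k M]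
  {ℳ : ℕ → Submodule k M}

theorem BarCochain.eq_zero_of_mem_homogeneous_zero {j : ℕ} (hj : j ≠ 0) {f : BarCochain k M}
    (hf : f ∈ homogeneous ℳ 0 j) : f = 0 := by
  ext l
  cases l with
  | nil => exact hf.2.2.2 [] [] .nil (by simpa using hj.symm)
  | cons x l => exact hf.2.2.1 _ (by simp)

theorem BarCochain.tail_mem_homogeneous {n i j : ℕ} {x : M} (hx : x ∈ ℳ i) {f : BarCochain k M}
    (hf : f ∈ homogeneous ℳ (n + 1) (i + j)) : tail x f ∈ homogeneous ℳ n j := by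
  have h := (isMultilinear_of_mem hf).tail x
  refine ⟨h.add, h.smul, fun l hl => hf.2.2.1 _ (by simpa using hl), fun l e he hj => ?_⟩
  exact hf.2.2.2 _ (i :: e) (.cons hx he) (by simpa using hj)

variable {A : Type v} [Ring A] [Algebra k A] (𝒜 : ℕ → Submodule k A) [SetLike.GradedMonoid 𝒜]

theorem YonedaAlgebra.bigraded_eq_bot {i j : ℕ}
    (h : cocycles (augmentationGrading 𝒜) i j ≤ coboundaries (augmentationGrading 𝒜) i j) :
    YonedaAlgebra.bigraded 𝒜 i j = ⊥ := by
  rw [eq_bot_iff]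
  rintro _ ⟨x, hx, rfl⟩
  refine (Submodule.mem_bot k).2 (Ideal.Quotient.eq_zero_iff_mem.2 ?_)
  exact Submodule.mem_iSup_of_mem i (Submodule.mem_iSup_of_mem j (h hx))

variable {X : Type} (I : TwoSidedIdeal (FreeAlgebra k X))

/-- An algebra generated in degree `1` has `E^{1,j} = 0` for `j ≠ 1`. -/
theorem eq_zero_of_mem_cocycles_one {j : ℕ} (hj : j ≠ 1)
    {f : BarCochain k (augmentationIdeal (QuotAlgebra.grading I))}
    (hf : f ∈ cocycles (augmentationGrading (QuotAlgebra.grading I)) 1 j) : f = 0 := by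
  have hml := isMultilinear_of_mem hf.1
  have hd : d f = 0 := hf.2
  have hdeg : ∀ i : ℕ, ∀ c (hc : c ∈ QuotAlgebra.grading I (i + 1)),
      f [⟨c, mem_augmentationIdeal _ i.succ_ne_zero hc⟩] = 0 := by
    intro i c hc
    cases i with
    | zero => exact hf.1.2.2.2 _ [1] (.cons hc .nil) (by simpa using hj.symm)
    | succ i =>
      have hc' := hc
      rw [QuotAlgebra.grading, pow_succ] at hc'
      -- Elements of degree at least two are sums of products, on which a 1-cocycle vanishes.
      -- Membership in the augmentation ideal is carried along existentially, since the induction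
      -- runs over elements of the whole algebra.
      have key : ∃ h, hml.headMap [] ⟨c, h⟩ = 0 := by
        induction hc' using Submodule.mul_induction_on' with
        | mem_mul_mem m hm n hn =>
          have hm' : m ∈ augmentationIdeal (QuotAlgebra.grading I) :=
            mem_augmentationIdeal _ i.succ_ne_zero hm
          have hn' : n ∈ augmentationIdeal (QuotAlgebra.grading I) :=
            mem_augmentationIdeal _ one_ne_zero (by rwa [QuotAlgebra.grading, pow_one])
          refine ⟨mul_mem hm' hn', ?_⟩
          have h := congrFun hd [⟨m, hm'⟩, ⟨n, hn'⟩]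
          rw [d_cons, d_singleton, sub_zero] at h
          exact h
        | add x hx y hy h1 h2 =>
          obtain ⟨h1, h1'⟩ := h1 hx
          obtain ⟨h2, h2'⟩ := h2 hy
          refine ⟨add_mem h1 h2, ?_⟩
          have : (⟨x + y, add_mem h1 h2⟩ : augmentationIdeal (QuotAlgebra.grading I)) =
            ⟨x, h1⟩ + ⟨y, h2⟩ := rfl
          rw [this, map_add, h1', h2', add_zero]
      exact key.2
  ext l
  match l with
  | [] => exact hf.1.2.2.1 _ (by simp)
  | [⟨c, hc⟩] =>
    have hc' : c ∈ ⨆ i : ℕ, QuotAlgebra.grading I (i + 1) := hc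
    have key : ∃ h, hml.headMap [] ⟨c, h⟩ = 0 := by
      induction hc' using Submodule.iSup_induction' with
      | mem i x hx => exact ⟨_, hdeg i x hx⟩
      | zero => exact ⟨zero_mem _, map_zero (hml.headMap [])⟩
      | add x y hx hy h1 h2 =>
        obtain ⟨h1, h1'⟩ := h1 hx
        obtain ⟨h2, h2'⟩ := h2 hy
        refine ⟨add_mem h1 h2, ?_⟩
        have : (⟨x + y, add_mem h1 h2⟩ : augmentationIdeal (QuotAlgebra.grading I)) =
          ⟨x, h1⟩ + ⟨y, h2⟩ := rfl
        rw [this, map_add, h1', h2', add_zero]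
    exact key.2
  | x :: y :: l => exact hf.1.2.2.1 _ (by simp)

end General

/-! ### Algebras with the multiplicative basis of `C` -/

/-- A graded algebra without unit with a homogeneous basis that multiplies as the basis of words of
the augmentation ideal of `C`. -/
structure IsWordBasis {k : Type u} {M : Type v} [Field k] [NonUnitalRing M] [Module k M]
    (ℳ : ℕ → Submodule k M) (b : Module.Basis PWord k M) : Prop where
  mul : ∀ w v, b w * b v = (PWord.mul w v).elim 0 b
  mem : ∀ w, b w ∈ ℳ w.length
  deg : ∀ c j w, c ∈ ℳ j → b.repr c w ≠ 0 → w.length = j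
  mul_mem : ∀ i j x y, x ∈ ℳ i → y ∈ ℳ j → x * y ∈ ℳ (i + j)

theorem isWordBasis_augBasis (k : Type u) [Field k] : IsWordBasis (gradC k) (augBasis k) :=
  ⟨augBasis_mul k, augBasis_mem k, length_eq_of_augBasis_repr_ne_zero k,
    augmentationGrading_mul _⟩

/-! ### Second cohomology -/

section Second

variable {k : Type u} {M : Type v} [Field k] [NonUnitalRing M] [Module k M]
  [IsScalarTower k M M] [SMulCommClass k M M] {f : BarCochain k M} (hf : IsMultilinear f)
  (e : Letter → M)

/-- The action of a letter on `k × C₊ × k` that is attached to a `2`-cochain. -/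
noncomputable def extensionMap (x : Letter) : Module.End k (k × M × k) where
  toFun m := (0, m.1 • e x + m.2.1 * e x, f [m.2.1, e x])
  map_add' m m' := by
    refine Prod.ext (by simp) (Prod.ext ?_ ?_)
    · simp [add_smul, add_mul]; abel
    · exact hf.add [] _ _ _
  map_smul' c m := by
    refine Prod.ext (by simp) (Prod.ext ?_ ?_)
    · simp [mul_smul, smul_mul_assoc]
    · exact hf.smul [] _ _ _

theorem extensionMap_apply (x : Letter) (m : k × M × k) : extensionMap hf e x m =
    (0, m.1 • e x + m.2.1 * e x, f [m.2.1, e x]) := rfl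

theorem cochain_mul_letter (hf : IsMultilinear f) (hd : ∀ x y z, f [x * y, z] = f [x, y * z])
    (ε : k) (c x y : M) : f [ε • x + c * x, y] = ε * f [x, y] + f [c, x * y] := by
  have h1 := hf.add [] [y] (ε • x) (c * x)
  have h2 := hf.smul [] [y] ε x
  simp only [List.nil_append] at h1 h2
  rw [h1, h2, hd]

/-- The operators describe right multiplication in the singular extension given by the 2-cocycle
`f`. Lifting a quadratic relation can fail only through the values of `f` at pairs of letters, and
lifting z⁴ = 0 only through the value at (z³, z); these are assumed to vanish. -/
theorem satisfiesRelations_extensionMap (hd : ∀ x y z, f [x * y, z] = f [x, y * z])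
    (hq : ∀ c ∈ relationTriples, e (.inl c.1) * e (.inl c.2.1) = e (.inl c.1) * e (.inl c.2.2))
    (hz : e (.inr .z) * e (.inr .z) * e (.inr .z) * e (.inr .z) = 0)
    (h2 : ∀ x y, f [e x, e y] = 0)
    (h4 : f [e (.inr .z) * e (.inr .z) * e (.inr .z), e (.inr .z)] = 0) :
    SatisfiesRelations (R := (Module.End k (k × M × k))ᵐᵒᵖ)
      (fun x => MulOpposite.op (extensionMap hf e x)) := by
  constructor
  · intro c hc
    rw [← MulOpposite.op_mul, ← MulOpposite.op_mul]
    congr 1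
    refine LinearMap.ext fun m => ?_
    simp only [Module.End.mul_apply, extensionMap_apply, zero_smul, zero_add]
    rw [cochain_mul_letter hf hd, cochain_mul_letter hf hd, h2, h2, hq c hc,
      add_mul, add_mul, smul_mul_assoc, smul_mul_assoc, hq c hc, mul_assoc, mul_assoc, hq c hc]
  · rw [← MulOpposite.op_mul, ← MulOpposite.op_mul, ← MulOpposite.op_mul, ← MulOpposite.op_zero]
    congr 1
    refine LinearMap.ext fun m => ?_
    simp only [Module.End.mul_apply, extensionMap_apply, zero_smul, zero_add,
      LinearMap.zero_apply]
    have e1 : (m.1 • e (.inr .z) + m.2.1 * e (.inr .z)) * e (.inr .z) * e (.inr .z) =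
        m.1 • (e (.inr .z) * e (.inr .z) * e (.inr .z)) +
          m.2.1 * (e (.inr .z) * e (.inr .z) * e (.inr .z)) := by
      simp only [add_mul, smul_mul_assoc, mul_assoc]
    rw [e1, cochain_mul_letter hf hd, h4, add_mul, smul_mul_assoc, mul_assoc m.2.1, hz]
    have h0 : f [m.2.1, 0] = 0 := by
      have := hf.smul [m.2.1] [] 0 0
      simpa using this
    simp [h0]

/-- The product of the letters of a nonempty word in an algebra without unit. -/
def nonunitalWord : List Letter → M
  | [] => 0
  | [x] => e x
  | x :: y :: l => nonunitalWord (y :: l) * e x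

/-- The linear functional on words that bounds a `2`-cocycle. -/
def boundingFunctional (f : BarCochain k M) : List Letter → k
  | [] => 0
  | [_] => 0
  | x :: y :: l => f [nonunitalWord e (y :: l), e x]

theorem word_extensionMap (hd : ∀ x y z, f [x * y, z] = f [x, y * z]) (m : k × M × k) :
    ∀ l : List Letter, l ≠ [] →
      (word (R := (Module.End k (k × M × k))ᵐᵒᵖ)
        (fun x => MulOpposite.op (extensionMap hf e x)) l).unop m =
      (0, m.1 • nonunitalWord e l + m.2.1 * nonunitalWord e l,
        m.1 * boundingFunctional e f l + f [m.2.1, nonunitalWord e l])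
  | [], h => absurd rfl h
  | [x], _ => by simp [extensionMap_apply, nonunitalWord, boundingFunctional]
  | x :: y :: l, _ => by
    rw [word_cons, MulOpposite.unop_mul, Module.End.mul_apply,
      word_extensionMap hd m (y :: l) (by simp), MulOpposite.unop_op, extensionMap_apply]
    simp only [cochain_mul_letter hf hd, nonunitalWord, boundingFunctional, zero_smul, zero_add,
      add_mul, smul_mul_assoc, mul_assoc]

/-- The operators of w followed by v, applied to (1, 0, 0), have last coordinate `f` at (w, v); the
operator of the product word gives the bounding functional there. Equality of the operators exhibits
`f` as a coboundary. -/
theorem boundingFunctional_mulList (hf : IsMultilinear f) (hd : ∀ x y z, f [x * y, z] = f [x, y * z])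
    (hq : ∀ c ∈ relationTriples, e (.inl c.1) * e (.inl c.2.1) = e (.inl c.1) * e (.inl c.2.2))
    (hz : e (.inr .z) * e (.inr .z) * e (.inr .z) * e (.inr .z) = 0)
    (h2 : ∀ x y, f [e x, e y] = 0)
    (h4 : f [e (.inr .z) * e (.inr .z) * e (.inr .z), e (.inr .z)] = 0)
    (w v : List Letter) (hw : w ≠ []) (hv : v ≠ []) :
    (mulList w v).elim 0 (boundingFunctional e f) = f [nonunitalWord e w, nonunitalWord e v] := by
  have h0 : ∀ y, f [0, y] = 0 := fun y => hf.zero_cons [y]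
  have h1 := word_mul_word (satisfiesRelations_extensionMap hf e hd hq hz h2 h4) w v
  have h3 := congrArg (fun T => (MulOpposite.unop T (1, 0, 0)).2.2) h1
  simp only [MulOpposite.unop_mul, Module.End.mul_apply] at h3
  rw [word_extensionMap hf e hd _ w hw, word_extensionMap hf e hd _ v hv] at h3
  cases hu : mulList w v with
  | none => simpa [hu] using h3.symm
  | some u =>
    have hu' : u ≠ [] := by
      obtain ⟨v', rfl, -⟩ := mulList_eq_some _ hu
      simp [hw]
    rw [hu, owordOf_some, word_extensionMap hf e hd _ u hu'] at h3
    simpa [h0] using h3.symm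

end Second

/-! ### Vanishing of E^{2,j} for j different from 2 and 4 -/

section WordBasis

variable {k : Type u} {M : Type v} [Field k] [NonUnitalRing M] [Module k M]
  {ℳ : ℕ → Submodule k M} {b : Module.Basis PWord k M}

/-- A letter as a word. -/
def PWord.single (x : Letter) : PWord := ⟨[x], isNormalWord_singleton x, by simp⟩

theorem mulList_relation {c : GenA × GenA × GenA} (hc : c ∈ relationTriples) :
    mulList [.inl c.1] [.inl c.2.1] = mulList [.inl c.1] [.inl c.2.2] := by
  have h := canon_relation c hc none none
  rw [canon_none] at h
  simp [mulList, push_inl, h]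

theorem PWord.mul_congr {w v w' v' : PWord} (h : mulList w.1 v.1 = mulList w'.1 v'.1) :
    PWord.mul w v = PWord.mul w' v' := by
  cases h' : PWord.mul w' v' with
  | none => exact mul_eq_none.2 (h.trans (mul_eq_none.1 h'))
  | some u => exact mul_eq_some.2 (h.trans (mul_eq_some.1 h'))

theorem IsWordBasis.mul_relation (hb : IsWordBasis ℳ b) : ∀ c ∈ relationTriples,
    b (.single (.inl c.1)) * b (.single (.inl c.2.1)) =
      b (.single (.inl c.1)) * b (.single (.inl c.2.2)) := by
  intro c hc
  rw [hb.mul, hb.mul, PWord.mul_congr (w' := .single (.inl c.1)) (v' := .single (.inl c.2.2))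
    (mulList_relation hc)]

theorem IsWordBasis.nonunitalWord_eq (hb : IsWordBasis ℳ b) : ∀ (l : List Letter)
    (h : IsNormalWord l ∧ l ≠ []), nonunitalWord (fun x => b (.single x)) l = b ⟨l, h⟩
  | [], h => absurd rfl h.2
  | [x], h => rfl
  | x :: y :: l, h => by
    rw [nonunitalWord, hb.nonunitalWord_eq (y :: l) ⟨h.1.2, by simp⟩, hb.mul]
    have : PWord.mul ⟨y :: l, h.1.2, by simp⟩ (.single x) = some ⟨x :: y :: l, h⟩ :=
      PWord.mul_eq_some.2 h.1.1
    rw [this]; rfl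

theorem IsWordBasis.z_quart (hb : IsWordBasis ℳ b) :
    b (.single (.inr .z)) * b (.single (.inr .z)) * b (.single (.inr .z)) *
      b (.single (.inr .z)) = 0 := by
  have h := hb.nonunitalWord_eq [.inr .z, .inr .z, .inr .z] (by decide)
  simp only [nonunitalWord] at h
  rw [h, hb.mul]
  have : PWord.mul ⟨[.inr .z, .inr .z, .inr .z], by decide⟩ (.single (.inr .z)) = none := by
    decide
  rw [this]; rfl

variable [IsScalarTower k M M] [SMulCommClass k M M]

/-- The values of the cocycle at pairs of letters and at (z³, z) vanish for degree reasons, as these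
have internal degrees 2 and 4. So the extension splits and the bounding functional gives a
1-cochain. -/
theorem IsWordBasis.cocycles_two_le (hb : IsWordBasis ℳ b) {j : ℕ} (h2 : j ≠ 2) (h4 : j ≠ 4) :
    cocycles ℳ 2 j ≤ coboundaries ℳ 2 j := by
  intro f hfc
  have hf := isMultilinear_of_mem hfc.1
  have hd : ∀ x y z, f [x * y, z] = f [x, y * z] := by
    intro x y z
    have h : d f = 0 := hfc.2
    have h := congrFun h [x, y, z]
    rw [d_cons, d_cons] at h
    simpa [sub_eq_zero] using h
  have hl : ∀ x, b (.single x) ∈ ℳ 1 := fun x => hb.mem (.single x)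
  have hz3 := hb.mul_mem _ _ _ _ (hb.mul_mem _ _ _ _ (hl (.inr .z)) (hl (.inr .z)))
    (hl (.inr .z))
  have hη := boundingFunctional_mulList (fun x => b (.single x)) hf hd hb.mul_relation hb.z_quart
    (fun x y => hfc.1.2.2.2 _ [1, 1] (.cons (hl x) (.cons (hl y) .nil)) (by simpa using h2.symm))
    (hfc.1.2.2.2 _ [3, 1] (.cons hz3 (.cons (hl _) .nil)) (by simpa using h4.symm))
  let φ : List PWord → k := fun
    | [w] => boundingFunctional (fun x => b (.single x)) f w.1
    | _ => 0
  have hφ : extend b φ ∈ homogeneous ℳ 1 j := by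
    refine extend_mem_homogeneous _ PWord.length hb.deg fun l hl' => ?_
    match l, hl' with
    | [⟨[], hw⟩], _ => exact absurd rfl hw.2
    | [⟨[x], _⟩], hl' => exact absurd rfl hl'
    | [⟨x :: y :: l, hw⟩], hl' =>
      refine ⟨rfl, ?_⟩
      by_contra hne
      have hm : nonunitalWord (fun x => b (.single x)) (y :: l) ∈ ℳ (y :: l).length := by
        rw [hb.nonunitalWord_eq _ ⟨hw.1.2, by simp⟩]
        exact hb.mem ⟨y :: l, hw.1.2, by simp⟩
      refine hl' (hfc.1.2.2.2 _ [(y :: l).length, 1] (.cons hm (.cons (hl x) .nil)) ?_)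
      simpa [totalDegree, PWord.length] using hne
    | [], hl' => exact absurd rfl hl'
    | _ :: _ :: _, hl' => exact absurd rfl hl'
  refine ⟨hfc, extend b φ, hφ, ?_⟩
  have hml := isMultilinear_extend b φ
  refine IsMultilinear.ext_basis b hml.d hf fun l => ?_
  by_cases hl : l.length = 2
  · obtain ⟨w, v, rfl⟩ := List.length_eq_two.1 hl
    rw [d_map_basis PWord.mul b hb.mul _ _ hml]
    simp only [extend_map, delta, sub_zero]
    have h := hη w.1 v.1 w.2.2 v.2.2
    rw [hb.nonunitalWord_eq _ w.2, hb.nonunitalWord_eq _ v.2] at h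
    refine Eq.trans ?_ h
    cases hu : PWord.mul w v with
    | none => rw [PWord.mul_eq_none.1 hu]; rfl
    | some u => rw [PWord.mul_eq_some.1 hu]; rfl
  · rw [hfc.1.2.2.1 _ (by simpa using hl), (d_mem_homogeneous hb.mul_mem hφ).2.2.1 _
      (by simpa using hl)]

end WordBasis

/-! ### Breaks in lists of words -/

namespace PWord

/-- Two words are joined if there is no break between them. -/
def Joined (w v : PWord) : Prop := Linked (layer w.last) (layer v.first)

instance (w v : PWord) : Decidable (Joined w v) := inferInstanceAs (Decidable (Linked _ _))

theorem joined_congr_left {w v u : PWord} (h : mul w v = some u) (x : PWord) :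
    Joined u x ↔ Joined v x := by rw [Joined, Joined, layer_last_of_mul h]

theorem joined_congr_right {w v u : PWord} (h : mul w v = some u) (x : PWord) :
    Joined x u ↔ Joined x w := by rw [Joined, Joined, first_of_mul h]

theorem connected_of_mul {w v u : PWord} (h : mul w v = some u) (hw : Connected w.1)
    (hv : Connected v.1) (hj : Joined w v) : Connected u.1 := by
  rw [connected_iff_map] at hw hv ⊢
  rw [map_layer_of_mul h, List.isChain_append]
  refine ⟨hv, hw, fun x hx y hy => ?_⟩
  rw [List.getLast?_map, List.getLast?_eq_some_getLast v.2.2] at hx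
  rw [List.head?_map, List.head?_eq_some_head w.2.2] at hy
  cases hx; cases hy
  exact hj

theorem val_eq_append (w : PWord) : ∃ v, w.1 = v ++ [w.first] :=
  ⟨w.1.dropLast, (List.dropLast_append_getLast w.2.2).symm⟩

theorem val_eq_cons (w : PWord) : ∃ v, w.1 = w.last :: v :=
  ⟨w.1.tail, (List.cons_head_tail w.2.2).symm⟩

theorem isNormalWord_append {w v : PWord} (h : ¬ Joined w v) : IsNormalWord (v.1 ++ w.1) := by
  obtain ⟨v', hv⟩ := val_eq_append v
  obtain ⟨w', hw⟩ := val_eq_cons w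
  have := (isNormalWord_append_iff h w' v').2 ⟨hv ▸ v.2.1, hw ▸ w.2.1⟩
  rw [hv, hw]
  simpa using this

theorem exists_mul_of_not_joined {w v : PWord} (h : ¬ Joined w v) : ∃ u, mul w v = some u :=
  ⟨⟨v.1 ++ w.1, isNormalWord_append h, by simp [w.2.2]⟩,
    mul_eq_some.2 (mulList_of_isNormalWord _ (isNormalWord_append h))⟩

/-- The decomposition of a word at its first break. -/
def split (w : PWord) : Option (PWord × PWord) :=
  (splitFirst w.1).pmap (p := fun p : List Letter × List Letter =>
      (IsNormalWord p.1 ∧ p.1 ≠ []) ∧ IsNormalWord p.2 ∧ p.2 ≠ []) (fun p hp => (⟨p.1, hp.1⟩, ⟨p.2, hp.2⟩)) fun p hp => by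
    obtain ⟨a, u, b, v, h1, h2, h3, -, h5⟩ := splitFirst_eq_some (u := p.1) (v := p.2) hp
    have h := w.2.1
    rw [h5, h1, h2] at h
    rw [List.append_assoc] at h
    have h := (isNormalWord_append_iff h3 _ _).1 h
    rw [← h1, ← h2] at h
    exact ⟨⟨h.2, by simp [h1]⟩, h.1, by simp [h2]⟩

theorem split_eq_none {w : PWord} : split w = none ↔ Connected w.1 := by
  rw [split, Option.pmap_eq_none_iff, splitFirst_eq_none_iff]

theorem split_eq_some {w u v : PWord} (h : split w = some (u, v)) :
    Connected u.1 ∧ ¬ Joined u v ∧ mul u v = some w := by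
  rw [split, Option.pmap_eq_some_iff] at h
  obtain ⟨p, _, h, h'⟩ := h
  cases h'
  obtain ⟨a, u', b, v', h1, h2, h3, h4, h5⟩ := splitFirst_eq_some h
  refine ⟨h4, ?_, ?_⟩
  · simpa [Joined, first, last, h1, h2] using h3
  · rw [mul_eq_some, h5]
    exact mulList_of_isNormalWord _ (h5 ▸ w.2.1)

theorem split_eq_some_of_mul {w u v : PWord} (hu : Connected u.1) (huv : ¬ Joined u v)
    (h : mul u v = some w) : split w = some (u, v) := by
  rw [mul_eq_some, mulList_of_isNormalWord _ (isNormalWord_append huv)] at h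
  rw [split, Option.pmap_eq_some_iff]
  obtain ⟨v', hv⟩ := val_eq_append v
  obtain ⟨u', hu'⟩ := val_eq_cons u
  refine ⟨(u.1, v.1), ⟨u.2, v.2⟩, ?_, rfl⟩
  have := splitFirst_append huv (hu' ▸ hu) v'
  rw [← Option.some.inj h]
  rw [hv, hu', List.append_assoc]
  exact this

end PWord

open PWord BarCochain

/-- Lists of words whose first break lies between two words. -/
def HasOuterBreak : List PWord → Prop
  | [] => False
  | [_] => False
  | w :: v :: l => Connected w.1 ∧ (¬ Joined w v ∨ HasOuterBreak (v :: l))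

/-- Lists of words without breaks. -/
def Unbroken : List PWord → Prop
  | [] => True
  | [w] => Connected w.1
  | w :: v :: l => Connected w.1 ∧ Joined w v ∧ Unbroken (v :: l)

/-- The second list is obtained from the first one by cutting a word at the first break. -/
inductive CutsTo : List PWord → List PWord → Prop
  | here {u v w : PWord} (l : List PWord) (h : PWord.mul u v = some w) (hu : Connected u.1)
    (huv : ¬ Joined u v) : CutsTo (w :: l) (u :: v :: l)
  | there {w v v' : PWord} {l l' : List PWord} (hw : Connected w.1) (hj : Joined w v)
    (h : CutsTo (v :: l) (v' :: l')) : CutsTo (w :: v :: l) (w :: v' :: l')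

/-- The cases correspond to the position of the first break: between words, absent, or inside a
word. Cutting matches the last kind with lists of the first kind, and only unbroken lists are left
unmatched. -/
theorem hasOuterBreak_or : ∀ l : List PWord,
    HasOuterBreak l ∨ Unbroken l ∨ ∃ l', CutsTo l l'
  | [] => Or.inr (Or.inl trivial)
  | [w] => by
    cases h : split w with
    | none => exact Or.inr (Or.inl (split_eq_none.1 h))
    | some p =>
      obtain ⟨h1, h2, h3⟩ := split_eq_some h
      exact Or.inr (Or.inr ⟨_, .here [] h3 h1 h2⟩)
  | w :: v :: l => by
    cases h : split w with
    | some p =>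
      obtain ⟨h1, h2, h3⟩ := split_eq_some h
      exact Or.inr (Or.inr ⟨_, .here _ h3 h1 h2⟩)
    | none =>
      have hw := split_eq_none.1 h
      by_cases hj : Joined w v
      · rcases hasOuterBreak_or (v :: l) with h1 | h1 | ⟨l', h1⟩
        · exact Or.inl ⟨hw, Or.inr h1⟩
        · exact Or.inr (Or.inl ⟨hw, hj, h1⟩)
        · cases l' with
          | nil => cases h1
          | cons v' l' => exact Or.inr (Or.inr ⟨_, .there hw hj h1⟩)
      · exact Or.inl ⟨hw, Or.inl hj⟩

theorem CutsTo.first_eq {v v' : PWord} {l l' : List PWord} (h : CutsTo (v :: l) (v' :: l')) :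
    v'.first = v.first := by
  cases h with
  | here _ h _ _ => exact (first_of_mul h).symm
  | there _ _ _ => rfl

theorem CutsTo.hasOuterBreak {l l' : List PWord} (h : CutsTo l l') : HasOuterBreak l' := by
  induction h with
  | here _ _ hu huv => exact ⟨hu, Or.inl huv⟩
  | there hw _ _ ih => exact ⟨hw, Or.inr ih⟩

/-- Merging two words before the first break leaves that break where it was. -/
theorem HasOuterBreak.mul_cons {w v u : PWord} {l : List PWord} (h : HasOuterBreak (v :: l))
    (hw : Connected w.1) (hj : Joined w v) (hu : PWord.mul w v = some u) :
    HasOuterBreak (u :: l) := by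
  cases l with
  | nil => exact h.elim
  | cons x l =>
    refine ⟨connected_of_mul hu hw h.1 hj, ?_⟩
    rw [joined_congr_left hu]
    exact h.2

/-! ### The contracting homotopy at the first break -/

section Homotopy

variable {k : Type u} [Field k]

theorem not_joined_of_mul (w : PWord) : ∀ v v' u : PWord, ¬ Joined w v → PWord.mul v v' = some u →
    ¬ Joined w u := fun _ _ _ h hu => by rwa [joined_congr_right hu]

theorem joined_of_mul (w : PWord) : ∀ v v' u : PWord, Joined w v → PWord.mul v v' = some u →
    Joined w u := fun _ _ _ h hu => by rwa [joined_congr_right hu]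

/-- A cocycle that vanishes on lists whose first break lies between two words vanishes on lists
whose first break lies inside a word. -/
theorem CutsTo.eq_zero {l l' : List PWord} (h : CutsTo l l') : ∀ (w : PWord) (r : List PWord),
    l = w :: r → ∀ φ : List PWord → k,
    (∀ (s : PWord) (t : List PWord), HasOuterBreak (s :: t) → s.first = w.first →
      φ (s :: t) = 0) → delta PWord.mul l' φ = 0 → φ l = 0 := by
  induction h with
  | @here u v w l h hu huv =>
    intro w' r hr φ hφ hδ
    cases hr
    -- Undoing the cut is the only contraction of the cut list that does not leave its first break
    -- between two words; the other terms vanish by hypothesis.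
    rw [delta, h, delta_eq_zero_of_head PWord.mul (r := fun x => ¬ Joined u x)
      (not_joined_of_mul u) v l _ huv, sub_zero] at hδ
    · exact hδ
    · exact fun x l' hx => hφ _ _ ⟨hu, Or.inl hx⟩ (first_of_mul h).symm
  | @there w v v' l l' hw hj h ih =>
    intro w' r hr φ hφ hδ
    cases hr
    refine ih v l rfl (fun t => φ (w :: t)) (fun s t hs hsv => ?_) ?_
    · exact hφ _ _ ⟨hw, Or.inr hs⟩ rfl
    · rw [delta] at hδ
      have h0 : ((PWord.mul w v').elim 0 fun u => φ (u :: l')) = 0 := by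
        cases hu : PWord.mul w v' with
        | none => rfl
        | some u =>
          refine hφ _ _ (h.hasOuterBreak.mul_cons hw ?_ hu) (first_of_mul hu)
          rw [PWord.Joined, h.first_eq]; exact hj
      rw [h0, zero_sub, neg_eq_zero] at hδ
      exact hδ

/-- The contracting homotopy that cuts a word at the first break. -/
def breakHomotopy : List PWord → (List PWord → k) → k
  | [], _ => 0
  | [w], φ => (split w).elim 0 fun p => φ [p.1, p.2]
  | w :: v :: l, φ => (split w).elim
      (if Joined w v then -breakHomotopy (v :: l) fun l' => φ (w :: l') else 0)
      fun p => φ (p.1 :: p.2 :: v :: l)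

theorem breakHomotopy_of_split {w : PWord} {p : PWord × PWord} (h : split w = some p)
    (l : List PWord) (φ : List PWord → k) :
    breakHomotopy (w :: l) φ = φ (p.1 :: p.2 :: l) := by
  cases l <;> simp [breakHomotopy, h]

theorem breakHomotopy_of_joined {w v : PWord} (hw : Connected w.1) (h : Joined w v)
    (l : List PWord) (φ : List PWord → k) :
    breakHomotopy (w :: v :: l) φ = -breakHomotopy (v :: l) fun l' => φ (w :: l') := by
  simp [breakHomotopy, split_eq_none.2 hw, h]

theorem breakHomotopy_of_not_joined {w v : PWord} (hw : Connected w.1) (h : ¬ Joined w v)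
    (l : List PWord) (φ : List PWord → k) : breakHomotopy (w :: v :: l) φ = 0 := by
  simp [breakHomotopy, split_eq_none.2 hw, h]

theorem breakHomotopy_eq_zero : ∀ (l : List PWord), HasOuterBreak l →
    ∀ φ : List PWord → k, breakHomotopy l φ = 0
  | [], h, _ => h.elim
  | [_], h, _ => h.elim
  | w :: v :: l, h, φ => by
    by_cases hj : Joined w v
    · rw [breakHomotopy_of_joined h.1 hj,
        breakHomotopy_eq_zero (v :: l) (h.2.resolve_left (not_not.2 hj)), neg_zero]
    · exact breakHomotopy_of_not_joined h.1 hj _ _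

/-- Only the contraction that closes the first break gives a list on which the homotopy is nonzero,
and the homotopy reopens it at the same place. The sign in `breakHomotopy` cancels the sign that
`delta` collects for each word passed. -/
theorem delta_breakHomotopy : ∀ (l : List PWord), HasOuterBreak l → ∀ φ : List PWord → k,
    delta PWord.mul l (fun l' => breakHomotopy l' φ) = φ l
  | [], h, _ => h.elim
  | [_], h, _ => h.elim
  | w :: v :: l, h, φ => by
    rw [delta]
    by_cases hj : Joined w v
    · have hs := h.2.resolve_left (not_not.2 hj)
      have h0 : ((PWord.mul w v).elim 0 fun u => breakHomotopy (u :: l) φ) = 0 := by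
        cases hu : PWord.mul w v with
        | none => rfl
        | some u => exact breakHomotopy_eq_zero _ (hs.mul_cons h.1 hj hu) φ
      rw [h0, delta_congr_head PWord.mul (joined_of_mul w) v l _
        (fun l' => -breakHomotopy l' fun l' => φ (w :: l')) hj
        (fun x l' hx => breakHomotopy_of_joined h.1 hx l' φ), delta_neg,
        delta_breakHomotopy (v :: l) hs]
      ring
    · obtain ⟨u, hu⟩ := exists_mul_of_not_joined hj
      rw [hu, delta_eq_zero_of_head PWord.mul (not_joined_of_mul w) v l _ hj
        (fun x l' hx => breakHomotopy_of_not_joined h.1 hx l' φ), sub_zero]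
      exact breakHomotopy_of_split (split_eq_some_of_mul h.1 hj hu) l φ

theorem breakHomotopy_ne_zero : ∀ (l : List PWord) (φ : List PWord → k),
    breakHomotopy l φ ≠ 0 → ∃ l', φ l' ≠ 0 ∧ l'.length = l.length + 1 ∧
      totalDegree PWord.length l' = totalDegree PWord.length l
  | [], _, h => absurd rfl h
  | w :: l, φ, h => by
    cases hw : split w with
    | some p =>
      rw [breakHomotopy_of_split hw] at h
      refine ⟨_, h, rfl, ?_⟩
      have := length_of_mul (split_eq_some (u := p.1) (v := p.2) hw).2.2
      simp [totalDegree, this, add_assoc]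
    | none =>
      have hc := split_eq_none.1 hw
      cases l with
      | nil => simp [breakHomotopy, hw] at h
      | cons v l =>
        by_cases hj : Joined w v
        · rw [breakHomotopy_of_joined hc hj, neg_ne_zero] at h
          obtain ⟨l', h1, h2, h3⟩ := breakHomotopy_ne_zero (v :: l) _ h
          exact ⟨w :: l', h1, by simp [h2], by simpa [totalDegree] using h3⟩
        · exact absurd (breakHomotopy_of_not_joined hc hj l φ) h

end Homotopy

/-! ### Unbroken lists -/

/-- Words in the letter `z`. -/
def PWord.IsZ (w : PWord) : Prop := ∀ x ∈ w.1, x = .inr .z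

instance (w : PWord) : Decidable w.IsZ := inferInstanceAs (Decidable (∀ x ∈ w.1, x = .inr .z))

theorem layer_eq_seven : ∀ {x : Letter}, layer x = 7 ↔ x = .inr .z := by decide

/-- The gaps around 7 keep z from being linked to any letter of `A`. -/
theorem layer_ne_six_eight : ∀ x : Letter, layer x ≠ 6 ∧ layer x ≠ 8 := by decide

/-- Words are stored in reverse, so `getLast` is the first letter. From a letter other than z the
layer rises by one at each step and never reaches 7; from z only z can follow. -/
theorem connected_spec : ∀ (l : List Letter) (hl : l ≠ []), Connected l →
    (l.getLast hl = .inr .z → ∀ x ∈ l, x = .inr .z) ∧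
    (l.getLast hl ≠ .inr .z → l.head hl ≠ .inr .z ∧
      layer (l.head hl) + 1 = layer (l.getLast hl) + l.length)
  | [], hl, _ => absurd rfl hl
  | [x], _, _ => by simp
  | x :: y :: l, _, h => by
    unfold Connected at h
    rw [List.isChain_cons_cons] at h
    have ih := connected_spec (y :: l) (by simp) h.2
    rw [List.getLast_cons (by simp)]
    refine ⟨fun hz => ?_, fun hz => ?_⟩
    · have h1 := ih.1 hz
      have hy := h1 y (by simp)
      refine List.forall_mem_cons.2 ⟨?_, h1⟩
      subst hy
      have h2 := layer_ne_six_eight x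
      rcases h.1 with h3 | h3
      · exact absurd h3 h2.2
      · exact layer_eq_seven.1 h3.2
    · obtain ⟨h1, h2⟩ := ih.2 hz
      simp only [List.head_cons] at h1 h2 ⊢
      have h3 := layer_ne_six_eight y
      replace h1 := layer_ne_seven h1
      rcases h.1 with h4 | h4
      · refine ⟨fun hx => ?_, ?_⟩
        · have := layer_eq_seven.2 hx
          omega
        · rw [h4, h2]
          simp [add_assoc]
      · exact absurd h4.1 h1

/-- The count of `connected_spec` continues across the joints between words. Outside z the layers
end at 5, which bounds the total degree. -/
theorem Unbroken.spec : ∀ (l : List PWord) (w : PWord), Unbroken (w :: l) →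
    (w.first = .inr .z → ∀ v ∈ w :: l, v.IsZ) ∧
    (w.first ≠ .inr .z → layer w.first + totalDegree PWord.length (w :: l) ≤ 6)
  | [], w, h => by
    have hw := connected_spec w.1 w.2.2 h
    refine ⟨fun hz => ?_, fun hz => ?_⟩
    · exact List.forall_mem_singleton.2 (hw.1 hz)
    · obtain ⟨h1, h2⟩ := hw.2 hz
      have := layer_le_five h1
      have e : layer w.first = layer (w.1.getLast w.2.2) := rfl
      simp only [totalDegree, List.map_cons, List.map_nil, List.sum_cons, List.sum_nil, add_zero, e,
        PWord.length]
      omega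
  | v :: l, w, h => by
    obtain ⟨hc, hj, hl⟩ := h
    have hw := connected_spec w.1 w.2.2 hc
    have ih := Unbroken.spec l v hl
    refine ⟨fun hz => ?_, fun hz => ?_⟩
    · have h1 := hw.1 hz
      have hlast : w.last = .inr .z := h1 _ (List.head_mem w.2.2)
      refine List.forall_mem_cons.2 ⟨h1, ih.1 ?_⟩
      rw [PWord.Joined, hlast] at hj
      rcases hj with h3 | h3
      · exact absurd h3 (layer_ne_six_eight _).2
      · exact layer_eq_seven.1 h3.2
    · obtain ⟨h1, h2⟩ := hw.2 hz
      have e : layer w.first = layer (w.1.getLast w.2.2) := rfl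
      have e' : layer w.last = layer (w.1.head w.2.2) := rfl
      have h3 := layer_ne_six_eight (w.1.head w.2.2)
      have h1' := layer_ne_seven h1
      rw [PWord.Joined, e'] at hj
      rcases hj with h4 | h4
      · have hv : v.first ≠ .inr .z := fun hv => by
          have := layer_eq_seven.2 hv
          omega
        have := ih.2 hv
        have e2 : w.length = w.1.length := rfl
        simp only [totalDegree, List.map_cons, List.sum_cons, e] at this ⊢
        omega
      · exact absurd h4.1 h1'

theorem Unbroken.isZ {l : List PWord} (h : Unbroken l) (hl : 6 ≤ totalDegree PWord.length l) :
    ∀ v ∈ l, v.IsZ := by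
  cases l with
  | nil => simp
  | cons w l =>
    have h1 := Unbroken.spec l w h
    by_cases hz : w.first = .inr .z
    · exact h1.1 hz
    · have h2 := h1.2 hz
      have := one_le_layer w.first
      omega

/-! ### Words in the letter `z` -/

open PWord BarCochain

namespace PWord

/-- The word `z`. -/
def z₁ : PWord := ⟨[.inr .z], by decide⟩

/-- The word `z²`. -/
def z₂ : PWord := ⟨[.inr .z, .inr .z], by decide⟩

/-- The word `z³`. -/
def z₃ : PWord := ⟨[.inr .z, .inr .z, .inr .z], by decide⟩

theorem mul_z₁_z₁ : mul z₁ z₁ = some z₂ := by decide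
theorem mul_z₁_z₂ : mul z₁ z₂ = some z₃ := by decide
theorem mul_z₂_z₁ : mul z₂ z₁ = some z₃ := by decide
theorem mul_z₁_z₃ : mul z₁ z₃ = none := by decide
theorem mul_z₂_z₂ : mul z₂ z₂ = none := by decide
theorem mul_z₂_z₃ : mul z₂ z₃ = none := by decide

theorem isZ_z₂ : z₂.IsZ := by decide
theorem isZ_z₃ : z₃.IsZ := by decide

theorem isZ_iff (w : PWord) : w.IsZ ↔ ∀ i ∈ w.1.map layer, i = 7 := by
  rw [List.forall_mem_map]
  exact forall₂_congr fun x _ => layer_eq_seven.symm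

theorem isZ_of_mul {w v u : PWord} (h : mul w v = some u) : u.IsZ ↔ w.IsZ ∧ v.IsZ := by
  rw [isZ_iff, isZ_iff, isZ_iff, map_layer_of_mul h, List.forall_mem_append, and_comm]

theorem IsZ.eq {w : PWord} (h : w.IsZ) : w = z₁ ∨ w = z₂ ∨ w = z₃ := by
  obtain ⟨l, hl, hn⟩ := w
  simp only [IsZ] at h
  match l, hl, hn, h with
  | [], _, hn, _ => exact absurd rfl hn
  | [x], _, _, h =>
    obtain rfl := h x (by simp)
    exact Or.inl rfl
  | [x, y], _, _, h =>
    obtain rfl := h x (by simp)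
    obtain rfl := h y (by simp)
    exact Or.inr (Or.inl rfl)
  | [x, y, t], _, _, h =>
    obtain rfl := h x (by simp)
    obtain rfl := h y (by simp)
    obtain rfl := h t (by simp)
    exact Or.inr (Or.inr rfl)
  | x :: y :: t :: s :: l, hl, _, h =>
    obtain rfl := h x (by simp)
    obtain rfl := h y (by simp)
    obtain rfl := h t (by simp)
    obtain rfl := h s (by simp)
    have := hl.1
    simp [push] at this

theorem exists_mul_of_isZ {w v : PWord} (hw : w.IsZ) (hv : v.IsZ) (h : w.length + v.length ≤ 3) :
    ∃ u, mul w v = some u := by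
  rcases hw.eq with rfl | rfl | rfl <;> rcases hv.eq with rfl | rfl | rfl <;>
    first
      | exact ⟨_, mul_z₁_z₁⟩
      | exact ⟨_, mul_z₁_z₂⟩
      | exact ⟨_, mul_z₂_z₁⟩
      | exact absurd h (by decide)

/-- Two powers of `z` whose degrees add up to `4`. -/
def IsZQuart (w v : PWord) : Prop := w.IsZ ∧ v.IsZ ∧ w.length + v.length = 4

instance (w v : PWord) : Decidable (IsZQuart w v) := inferInstanceAs (Decidable (_ ∧ _ ∧ _))

end PWord

/-! ### Normalisation on lists of powers of z -/

section ZLists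

variable {k : Type u} [Field k]

/-- The contracting homotopy for lists of powers of `z`. -/
def zHomotopy (φ : List PWord → k) : List PWord → k
  | [] => 0
  | w :: l => if w = z₂ then φ (z₁ :: z₁ :: l) else if w = z₃ then φ (z₁ :: z₂ :: l) else 0

theorem zHomotopy_of_not_isZ (φ : List PWord → k) {w : PWord} (hw : ¬ w.IsZ) (l : List PWord) :
    zHomotopy φ (w :: l) = 0 := by
  rw [zHomotopy, if_neg, if_neg]
  · rintro rfl; exact hw isZ_z₃
  · rintro rfl; exact hw isZ_z₂

theorem delta_zHomotopy_of_not_isZ (φ : List PWord → k) {w : PWord} (hw : ¬ w.IsZ)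
    (l : List PWord) : delta PWord.mul (w :: l) (zHomotopy φ) = 0 :=
  delta_eq_zero_of_head PWord.mul (r := fun w => ¬ w.IsZ)
    (fun _ _ _ hw h hu => hw ((isZ_of_mul h).1 hu).1) w l _ hw
    fun _ l' hv => zHomotopy_of_not_isZ φ hv l'

theorem delta_zHomotopy_z₁ (φ : List PWord → k) (v : PWord) (l : List PWord) :
    delta PWord.mul (z₁ :: v :: l) (zHomotopy φ) =
      (PWord.mul z₁ v).elim 0 fun u => zHomotopy φ (u :: l) := by
  have h : (fun l' => zHomotopy φ (z₁ :: l')) = fun _ => (0 : k) := by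
    funext l'
    rw [zHomotopy, if_neg (by decide), if_neg (by decide)]
  rw [delta, h, delta_zero, sub_zero]

/-- On a list beginning with (z, v), the differential of the homotopy keeps only the contraction of
z with v, which the homotopy splits again into (z, v). This fails only at v = z³, because z⁴ = 0. -/
theorem sub_delta_zHomotopy_z₁ {φ : List PWord → k}
    (hφ : ∀ v l, ¬ v.IsZ → φ (z₁ :: v :: l) = 0) {v : PWord} (hv : v ≠ z₃) (l : List PWord) :
    φ (z₁ :: v :: l) - delta PWord.mul (z₁ :: v :: l) (zHomotopy φ) = 0 := by
  rw [delta_zHomotopy_z₁]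
  by_cases h : v.IsZ
  · rcases h.eq with rfl | rfl | rfl
    · rw [mul_z₁_z₁]; simp [zHomotopy]
    · rw [mul_z₁_z₂]; simp [zHomotopy, show z₃ ≠ z₂ by decide]
    · exact absurd rfl hv
  · rw [hφ v l h]
    cases hu : PWord.mul z₁ v with
    | none => simp
    | some u =>
      rw [Option.elim_some, zHomotopy_of_not_isZ φ fun hz => h ((isZ_of_mul hu).1 hz).2, sub_zero]

variable {φ : List PWord → k}

/-- The cocycle condition at (z, s, v, …) with s ≠ z³ moves the factor s to the right: the values at
(zs, v, …) and (z, sv, …) agree. Everything is thereby reduced to lists beginning with z, where only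
(z, z³, …) contributes. -/
theorem eq_mul_of_normalized (h₁ : ∀ w l, ¬ w.IsZ → φ (w :: l) = 0)
    (h₂ : ∀ v l, v ≠ z₃ → φ (z₁ :: v :: l) = 0) (h₃ : ∀ l, delta PWord.mul l φ = 0)
    (w v : PWord) (l : List PWord) :
    φ (w :: v :: l) = (if IsZQuart w v then 1 else 0) * φ (z₁ :: z₃ :: l) := by
  have step : ∀ s : PWord, s ≠ z₃ → ∀ u, PWord.mul z₁ s = some u →
      φ (u :: v :: l) = (PWord.mul s v).elim 0 fun x => φ (z₁ :: x :: l) := by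
    intro s hs u hu
    have h := h₃ (z₁ :: s :: v :: l)
    have h0 : (fun l' => φ (z₁ :: s :: l')) = fun _ => 0 := funext fun l' => h₂ s l' hs
    rw [delta, delta, hu, h0, delta_zero, sub_zero, Option.elim_some, sub_eq_zero] at h
    exact h
  by_cases hw : w.IsZ
  · by_cases hv : v.IsZ
    · have e2 := step z₁ (by decide) _ mul_z₁_z₁
      have e3 := step z₂ (by decide) _ mul_z₁_z₂
      rcases hw.eq with rfl | rfl | rfl
      · rcases hv.eq with rfl | rfl | rfl
        · rw [h₂ _ _ (by decide), if_neg (by decide), zero_mul]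
        · rw [h₂ _ _ (by decide), if_neg (by decide), zero_mul]
        · rw [if_pos (by decide), one_mul]
      · rw [e2]
        rcases hv.eq with rfl | rfl | rfl
        · rw [mul_z₁_z₁, Option.elim_some, h₂ _ _ (by decide), if_neg (by decide), zero_mul]
        · rw [mul_z₁_z₂, Option.elim_some, if_pos (by decide), one_mul]
        · rw [mul_z₁_z₃, Option.elim_none, if_neg (by decide), zero_mul]
      · rw [e3]
        rcases hv.eq with rfl | rfl | rfl
        · rw [mul_z₂_z₁, Option.elim_some, if_pos (by decide), one_mul]
        · rw [mul_z₂_z₂, Option.elim_none, if_neg (by decide), zero_mul]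
        · rw [mul_z₂_z₃, Option.elim_none, if_neg (by decide), zero_mul]
    · rw [if_neg fun h => hv h.2.1, zero_mul]
      have key : ∀ s, ((PWord.mul s v).elim 0 fun x => φ (z₁ :: x :: l)) = 0 := by
        intro s
        cases hx : PWord.mul s v with
        | none => rfl
        | some x =>
          refine h₂ _ _ ?_
          rintro rfl
          exact hv ((isZ_of_mul hx).1 isZ_z₃).2
      rcases hw.eq with rfl | rfl | rfl
      · refine h₂ _ _ ?_
        rintro rfl
        exact hv isZ_z₃
      · rw [step z₁ (by decide) _ mul_z₁_z₁, key]
      · rw [step z₂ (by decide) _ mul_z₁_z₂, key]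
  · rw [h₁ _ _ hw, if_neg fun h => hw h.1, zero_mul]

/-- In the cocycle condition at (z, z³, v, …), contracting the first pair gives z⁴ = 0, and
contracting the second cannot give z³ again. What remains is the differential of the tail. -/
theorem delta_tail_of_normalized (h₂ : ∀ v l, v ≠ z₃ → φ (z₁ :: v :: l) = 0)
    (h₃ : ∀ l, delta PWord.mul l φ = 0) (l : List PWord) :
    delta PWord.mul l (fun l' => φ (z₁ :: z₃ :: l')) = 0 := by
  cases l with
  | nil => rfl
  | cons v l =>
    have h := h₃ (z₁ :: z₃ :: v :: l)
    have h0 : ((PWord.mul z₃ v).elim 0 fun x => φ (z₁ :: x :: l)) = 0 := by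
      cases hx : PWord.mul z₃ v with
      | none => rfl
      | some x =>
        refine h₂ _ _ ?_
        rintro rfl
        have := length_of_mul hx
        have := v.length_pos
        omega
    rw [delta, delta, mul_z₁_z₃, h0] at h
    simpa using h

end ZLists

/-! ### Reduction of cohomology by the class of `z⁴` -/

section Reduction

variable {k : Type u} {M : Type v} [Field k] [NonUnitalRing M] [Module k M]
  [IsScalarTower k M M] [SMulCommClass k M M]
  {ℳ : ℕ → Submodule k M} {b : Module.Basis PWord k M}

theorem IsWordBasis.degree_eq (hb : IsWordBasis ℳ b) {n j : ℕ} {f : BarCochain k M}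
    (hf : f ∈ homogeneous ℳ n j) {l : List PWord} (hl : f (l.map b) ≠ 0) :
    l.length = n ∧ totalDegree PWord.length l = j := by
  constructor
  · by_contra h
    exact hl (hf.2.2.1 _ (by simpa using h))
  · by_contra h
    refine hl (hf.2.2.2 _ (l.map PWord.length) ?_ h)
    rw [List.forall₂_map_left_iff, List.forall₂_map_right_iff]
    exact List.forall₂_same.2 fun w _ => hb.mem w

theorem IsWordBasis.delta_eq_zero (hb : IsWordBasis ℳ b) {n j : ℕ} {f : BarCochain k M}
    (hf : f ∈ cocycles ℳ n j) (l : List PWord) :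
    delta PWord.mul l (fun l' => f (l'.map b)) = 0 := by
  have h : d f = 0 := hf.2
  rw [← d_map_basis PWord.mul b hb.mul l _ (isMultilinear_of_mem hf.1), h]
  rfl

theorem IsWordBasis.sub_d_apply (hb : IsWordBasis ℳ b) (f : BarCochain k M) (φ : List PWord → k)
    (l : List PWord) : (f - d (extend b φ)) (l.map b) = f (l.map b) - delta PWord.mul l φ := by
  rw [BarCochain.sub_apply, d_map_basis PWord.mul b hb.mul l _ (isMultilinear_extend b φ)]
  simp only [extend_map]

variable (b) in
/-- The class of the relation `z⁴`. -/
noncomputable def quartCochain : BarCochain k M :=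
  extend b fun
    | [w, v] => if IsZQuart w v then 1 else 0
    | _ => 0

theorem quartCochain_map (w v : PWord) :
    quartCochain b [b w, b v] = if IsZQuart w v then 1 else 0 :=
  extend_map b [w, v] _

theorem IsWordBasis.quartCochain_mem (hb : IsWordBasis ℳ b) :
    quartCochain b ∈ cocycles ℳ 2 4 := by
  have hh : quartCochain b ∈ homogeneous ℳ 2 4 := by
    refine extend_mem_homogeneous b PWord.length hb.deg fun l hl => ?_
    match l, hl with
    | [], hl => exact absurd rfl hl
    | [_], hl => exact absurd rfl hl
    | _ :: _ :: _ :: _, hl => exact absurd rfl hl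
    | [w, v], hl =>
      have h : IsZQuart w v := by
        by_contra h
        exact hl (if_neg h)
      exact ⟨rfl, by simpa [totalDegree] using h.2.2⟩
  refine ⟨hh, ?_⟩
  change d _ = 0
  have hml := isMultilinear_of_mem hh
  refine IsMultilinear.ext_basis b hml.d ⟨by simp, by simp⟩ fun l => ?_
  by_cases hl : l.length = 3
  · obtain ⟨w, v, u, rfl⟩ := List.length_eq_three.1 hl
    rw [d_map_basis PWord.mul b hb.mul _ _ hml]
    have e1 : ∀ w v, quartCochain b ([w, v].map b) = if IsZQuart w v then 1 else 0 :=
      quartCochain_map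
    simp only [delta, e1, sub_zero, BarCochain.zero_apply]
    rw [sub_eq_zero]
    -- Both contractions equal the indicator that all three entries are powers of z of total degree
    -- 4. The remaining entry has degree at least 1, so the contracted product is then nonzero.
    trans if w.IsZ ∧ v.IsZ ∧ u.IsZ ∧ w.length + v.length + u.length = 4 then 1 else 0
    · cases hx : PWord.mul w v with
      | none =>
        rw [if_neg, Option.elim_none]
        rintro ⟨h1, h2, h3, h4⟩
        have := u.length_pos
        obtain ⟨x, h⟩ := exists_mul_of_isZ h1 h2 (by omega)
        rw [hx] at h
        cases h
      | some x =>
        rw [Option.elim_some]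
        refine if_congr ?_ rfl rfl
        rw [IsZQuart, isZ_of_mul hx, length_of_mul hx, and_assoc]
    · cases hx : PWord.mul v u with
      | none =>
        rw [if_neg, Option.elim_none]
        rintro ⟨h1, h2, h3, h4⟩
        have := w.length_pos
        obtain ⟨x, h⟩ := exists_mul_of_isZ h2 h3 (by omega)
        rw [hx] at h
        cases h
      | some x =>
        rw [Option.elim_some]
        refine if_congr ?_ rfl rfl
        rw [IsZQuart, isZ_of_mul hx, length_of_mul hx, and_assoc, add_assoc]
  · exact (d_mem_homogeneous hb.mul_mem hh).2.2.1 _ (by simpa using hl)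

/-- In internal degrees at least `6`, a cocycle is cohomologous to a cocycle that is supported on
lists of powers of `z`. -/
theorem IsWordBasis.exists_sub_isZ (hb : IsWordBasis ℳ b) {n j : ℕ} (hj : 6 ≤ j)
    {f : BarCochain k M} (hf : f ∈ cocycles ℳ (n + 1) j) :
    ∃ g ∈ homogeneous ℳ n j, ∀ l : List PWord, (f - d g) (l.map b) ≠ 0 → ∀ v ∈ l, v.IsZ := by
  have hg : extend b (fun l => breakHomotopy l fun l' => f (l'.map b)) ∈ homogeneous ℳ n j := by
    refine extend_mem_homogeneous b PWord.length hb.deg fun l hl => ?_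
    obtain ⟨l', h1, h2, h3⟩ := breakHomotopy_ne_zero l _ hl
    obtain ⟨h4, h5⟩ := hb.degree_eq hf.1 h1
    exact ⟨by omega, by omega⟩
  refine ⟨_, hg, ?_⟩
  have hf1 := Submodule.sub_mem _ hf (coboundaries_le _ _ (d_mem_coboundaries hb.mul_mem hg))
  set f₁ := f - d (extend b (fun l => breakHomotopy l fun l' => f (l'.map b))) with hf₁
  -- The homotopy removes the values at lists whose first break is between words; by
  -- `CutsTo.eq_zero`, the cocycle condition then removes those at lists whose first break is inside
  -- a word.
  have hout : ∀ l, HasOuterBreak l → f₁ (l.map b) = 0 := by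
    intro l hl
    rw [hf₁, hb.sub_d_apply, delta_breakHomotopy l hl, sub_self]
  intro l hl
  rcases hasOuterBreak_or l with h | h | ⟨l', h⟩
  · exact absurd (hout l h) hl
  · exact h.isZ (by rw [(hb.degree_eq hf1.1 hl).2]; exact hj)
  · cases l with
    | nil => simp
    | cons w r =>
      exact absurd (h.eq_zero w r rfl (fun l => f₁ (l.map b)) (fun s t hs _ => hout _ hs)
        (hb.delta_eq_zero hf1 l')) hl

/-- In internal degrees at least `6`, multiplication by the class of `z⁴` is surjective in
cohomology. -/
theorem IsWordBasis.exists_quart_mul (hb : IsWordBasis ℳ b) {n j : ℕ} (hj : 2 ≤ j)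
    {f : BarCochain k M} (hf : f ∈ cocycles ℳ (n + 2) (j + 4)) :
    ∃ χ ∈ cocycles ℳ n j, f - quartCochain b * χ ∈ coboundaries ℳ (n + 2) (j + 4) := by
  obtain ⟨g₁, hg₁, hz⟩ := hb.exists_sub_isZ (n := n + 1) (by omega) hf
  have hB₁ := d_mem_coboundaries hb.mul_mem hg₁
  have hf₁ := Submodule.sub_mem _ hf (coboundaries_le _ _ hB₁)
  set f₁ := f - d g₁ with hf₁'
  set φ₁ : List PWord → k := fun l => f₁ (l.map b) with hφ₁
  have hg₂ : extend b (zHomotopy φ₁) ∈ homogeneous ℳ (n + 1) (j + 4) := by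
    refine extend_mem_homogeneous b PWord.length hb.deg fun l hl => ?_
    cases l with
    | nil => exact absurd rfl hl
    | cons w r =>
      rw [zHomotopy] at hl
      split_ifs at hl with h2 h3
      · obtain ⟨h4, h5⟩ := hb.degree_eq hf₁.1 hl
        subst h2
        simp only [totalDegree, List.map_cons, List.sum_cons, List.length_cons] at h4 h5 ⊢
        have e : z₁.length = 1 ∧ z₂.length = 2 := ⟨rfl, rfl⟩
        omega
      · obtain ⟨h4, h5⟩ := hb.degree_eq hf₁.1 hl
        subst h3
        simp only [totalDegree, List.map_cons, List.sum_cons, List.length_cons] at h4 h5 ⊢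
        have e : z₁.length = 1 ∧ z₂.length = 2 ∧ z₃.length = 3 := ⟨rfl, rfl, rfl⟩
        omega
      · exact absurd rfl hl
  have hB₂ := d_mem_coboundaries hb.mul_mem hg₂
  have hf₂ := Submodule.sub_mem _ hf₁ (coboundaries_le _ _ hB₂)
  set f₂ := f₁ - d (extend b (zHomotopy φ₁)) with hf₂'
  have hφ₂ : ∀ l : List PWord, f₂ (l.map b) = φ₁ l - delta PWord.mul l (zHomotopy φ₁) :=
    fun l => hb.sub_d_apply f₁ (zHomotopy φ₁) l
  have h₁ : ∀ w l, ¬ w.IsZ → f₂ ((w :: l).map b) = 0 := by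
    intro w l hw
    rw [hφ₂, delta_zHomotopy_of_not_isZ φ₁ hw, sub_zero]
    by_contra h
    exact hw (hz _ h w (by simp))
  have h₂ : ∀ v l, v ≠ z₃ → f₂ ((z₁ :: v :: l).map b) = 0 := by
    intro v l hv
    rw [hφ₂]
    refine sub_delta_zHomotopy_z₁ (fun v l hv => ?_) hv l
    by_contra h
    exact hv (hz _ h v (by simp))
  have h₃ : ∀ l, delta PWord.mul l (fun l' => f₂ (l'.map b)) = 0 := hb.delta_eq_zero hf₂
  -- The cofactor is read off behind the leading pair (z, z³), on which `quartCochain` takes the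
  -- value 1.
  have hχ : tail (b z₃) (tail (b z₁) f₂) ∈ homogeneous ℳ n j := by
    refine tail_mem_homogeneous (i := 3) (hb.mem z₃) (tail_mem_homogeneous (i := 1) (hb.mem z₁) ?_)
    rw [show 1 + (3 + j) = j + 4 by omega]
    exact hf₂.1
  refine ⟨_, ⟨hχ, ?_⟩, ?_⟩
  · have hml := isMultilinear_of_mem hχ
    refine IsMultilinear.ext_basis b hml.d ⟨by simp, by simp⟩ fun l => ?_
    rw [d_map_basis PWord.mul b hb.mul _ _ hml]
    exact delta_tail_of_normalized h₂ h₃ l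
  · have hprod := mul_mem_homogeneous hb.quartCochain_mem.1 hχ
    have e : f₂ = quartCochain b * tail (b z₃) (tail (b z₁) f₂) := by
      refine IsMultilinear.ext_basis b (isMultilinear_of_mem hf₂.1) (isMultilinear_of_mem hprod)
        fun l => ?_
      match l with
      | [] => rw [hf₂.1.2.2.1 _ (by simp), hprod.2.2.1 _ (by simp; omega)]
      | [w] => rw [hf₂.1.2.2.1 _ (by simp), hprod.2.2.1 _ (by simp; omega)]
      | w :: v :: l =>
        rw [mul_eq_of_mem hb.quartCochain_mem.1]
        refine (eq_mul_of_normalized h₁ h₂ h₃ w v l).trans ?_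
        rw [← quartCochain_map (b := b)]
        rfl
    rw [← e]
    have : f - f₂ = d g₁ + d (extend b (zHomotopy φ₁)) := by rw [hf₂', hf₁']; abel
    rw [this]
    exact Submodule.add_mem _ hB₁ hB₂

end Reduction

/-! ### Vanishing and finite generation of the cohomology of `C` -/

open PWord BarCochain

/-- Dividing by the class of bidegree (2, 4) lowers both sides of the inequality by 4, so the
vanishing follows by induction in steps of two. Division needs internal degree at least 6; below
that, the inequality leaves only bidegree (2, 5). -/
theorem cocycles_le_coboundaries_of_koszulDegree_lt (k : Type u) [Field k] : ∀ i j : ℕ,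
    koszulDegree 4 i < j → cocycles (gradC k) i j ≤ coboundaries (gradC k) i j
  | 0, j, h => fun f hf => by
    rw [eq_zero_of_mem_homogeneous_zero (by omega) hf.1]
    exact zero_mem _
  | 1, j, h => fun f hf => by
    rw [eq_zero_of_mem_cocycles_one (idealC k) (by simp [koszulDegree] at h; omega) hf]
    exact zero_mem _
  | i + 2, j, h => by
    have hb := isWordBasis_augBasis k
    have h' : koszulDegree 4 i + 4 < j := by
      unfold koszulDegree at h ⊢
      omega
    obtain ⟨j, rfl⟩ : ∃ j', j = j' + 4 := ⟨j - 4, by omega⟩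
    by_cases hj : 2 ≤ j
    · intro f hf
      obtain ⟨χ, hχ, h1⟩ := hb.exists_quart_mul hj hf
      have h2 := mul_mem_coboundaries_right hb.quartCochain_mem
        (cocycles_le_coboundaries_of_koszulDegree_lt k i j (by omega) hχ)
      rw [add_comm 2 i, add_comm 4 j] at h2
      simpa using Submodule.add_mem _ h1 h2
    · have hi : i = 0 := by
        unfold koszulDegree at h'
        omega
      subst hi
      exact hb.cocycles_two_le (by omega) (by omega)

theorem isTwoDetermined_idealC (k : Type u) [Field k] : IsTwoDetermined 4 (idealC k) :=
  ⟨by norm_num, inferInstanceAs (Finite Letter), ⟨_, relationsC_subset k, idealC_eq_span k⟩,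
    fun i j h => YonedaAlgebra.bigraded_eq_bot _
      (cocycles_le_coboundaries_of_koszulDegree_lt k i j h)⟩

/-! ### Finite-dimensionality of the cochains in each bidegree -/

section FiniteDimensional

variable {k : Type u} {M : Type v} [Field k] [NonUnitalRing M] [Module k M]
  [IsScalarTower k M M] [SMulCommClass k M M] {ℳ : ℕ → Submodule k M} {b : Module.Basis PWord k M}

theorem finite_pword_length_le (j : ℕ) : {w : PWord | w.length ≤ j}.Finite :=
  (List.finite_length_le Letter j).preimage Subtype.val_injective.injOn

theorem length_le_totalDegree (l : List PWord) : l.length ≤ totalDegree PWord.length l := by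
  induction l with
  | nil => simp [totalDegree]
  | cons w l ih =>
    have := w.length_pos
    simp only [totalDegree, List.map_cons, List.sum_cons, List.length_cons] at ih ⊢
    omega

theorem length_le_of_mem {l : List PWord} {w : PWord} (h : w ∈ l) :
    w.length ≤ totalDegree PWord.length l :=
  List.le_sum_of_mem (List.mem_map_of_mem h)

theorem finite_totalDegree_eq (j : ℕ) :
    {l : List PWord | totalDegree PWord.length l = j}.Finite := by
  have := (finite_pword_length_le j).to_subtype
  refine ((List.finite_length_le {w : PWord | w.length ≤ j} j).image
    (List.map Subtype.val)).subset fun l hl => ?_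
  have hl' : totalDegree PWord.length l = j := hl
  refine ⟨l.attach.map fun w => ⟨w.1, ?_⟩, ?_, ?_⟩
  · exact (length_le_of_mem w.2).trans hl'.le
  · change (List.map _ _).length ≤ j
    rw [List.length_map, List.length_attach, ← hl']
    exact length_le_totalDegree l
  · rw [List.map_map]
    exact List.attach_map_subtype_val l

theorem IsWordBasis.finiteDimensional_homogeneous (hb : IsWordBasis ℳ b) (n j : ℕ) :
    FiniteDimensional k (homogeneous ℳ n j) := by
  have := (finite_totalDegree_eq j).to_subtype
  let L : homogeneous ℳ n j →ₗ[k] ({l : List PWord | totalDegree PWord.length l = j} → k) :=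
    { toFun := fun f l => f.1 (l.1.map b)
      map_add' := fun _ _ => rfl
      map_smul' := fun _ _ => rfl }
  refine FiniteDimensional.of_injective L fun f g hfg => ?_
  refine Subtype.ext (IsMultilinear.ext_basis b (isMultilinear_of_mem f.2)
    (isMultilinear_of_mem g.2) fun l => ?_)
  by_cases hl : totalDegree PWord.length l = j
  · exact congrFun hfg ⟨l, hl⟩
  · by_contra h
    rcases ne_or_eq (f.1 (l.map b)) 0 with h1 | h1
    · exact hl (hb.degree_eq f.2 h1).2
    · rw [h1] at h
      exact hl (hb.degree_eq g.2 (Ne.symm h)).2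

theorem IsWordBasis.eq_zero_of_lt (hb : IsWordBasis ℳ b) {n j : ℕ} (h : j < n)
    {f : BarCochain k M} (hf : f ∈ homogeneous ℳ n j) : f = 0 := by
  refine IsMultilinear.ext_basis b (isMultilinear_of_mem hf) ⟨by simp, by simp⟩ fun l => ?_
  by_contra h0
  have h1 := hb.degree_eq hf h0
  have := length_le_totalDegree l
  omega

end FiniteDimensional

/-! ### Classes, products and finite generation in the Yoneda algebra -/

section Yoneda

variable {k : Type u} {A : Type v} [Field k] [Ring A] [Algebra k A]
  (𝒜 : ℕ → Submodule k A) [SetLike.GradedMonoid 𝒜]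

theorem mem_cocycleAlgebra {n j : ℕ} {f : BarCochain k (augmentationIdeal 𝒜)}
    (hf : f ∈ cocycles (augmentationGrading 𝒜) n j) :
    f ∈ cocycleAlgebra (augmentationGrading 𝒜) :=
  Submodule.mem_iSup_of_mem n (Submodule.mem_iSup_of_mem j hf)

/-- The class of a homogeneous cocycle. -/
def YonedaAlgebra.mk {n j : ℕ} (f : BarCochain k (augmentationIdeal 𝒜))
    (hf : f ∈ cocycles (augmentationGrading 𝒜) n j) : YonedaAlgebra 𝒜 :=
  Ideal.Quotient.mkₐ k (coboundaryIdeal (augmentationGrading 𝒜)) ⟨f, mem_cocycleAlgebra 𝒜 hf⟩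

theorem YonedaAlgebra.mem_bigraded {n j : ℕ} {y : YonedaAlgebra 𝒜} :
    y ∈ YonedaAlgebra.bigraded 𝒜 n j ↔
      ∃ f, ∃ hf : f ∈ cocycles (augmentationGrading 𝒜) n j, y = YonedaAlgebra.mk 𝒜 f hf := by
  constructor
  · rintro ⟨x, hx, rfl⟩
    exact ⟨x.1, hx, rfl⟩
  · rintro ⟨f, hf, rfl⟩
    exact ⟨_, hf, rfl⟩

theorem YonedaAlgebra.mk_eq_mul {n j n' j' n'' j'' : ℕ}
    {f g h : BarCochain k (augmentationIdeal 𝒜)}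
    (hf : f ∈ cocycles (augmentationGrading 𝒜) n j)
    (hg : g ∈ cocycles (augmentationGrading 𝒜) n' j')
    (hh : h ∈ cocycles (augmentationGrading 𝒜) n'' j'')
    (hfgh : f - g * h ∈ coboundaries (augmentationGrading 𝒜) n j) :
    YonedaAlgebra.mk 𝒜 f hf = YonedaAlgebra.mk 𝒜 g hg * YonedaAlgebra.mk 𝒜 h hh := by
  unfold YonedaAlgebra.mk
  rw [← map_mul]
  exact Ideal.Quotient.eq.2 (Submodule.mem_iSup_of_mem n (Submodule.mem_iSup_of_mem j hfgh))

theorem YonedaAlgebra.iSup_bigraded : ⨆ (n : ℕ) (j : ℕ), YonedaAlgebra.bigraded 𝒜 n j = ⊤ := by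
  set V := ⨆ (n : ℕ) (j : ℕ), YonedaAlgebra.bigraded 𝒜 n j with hV
  set π := (Ideal.Quotient.mkₐ k (coboundaryIdeal (augmentationGrading 𝒜))).toLinearMap with hπ
  set ι := (cocycleAlgebra (augmentationGrading 𝒜)).val.toLinearMap with hι
  have h : (⨆ (n : ℕ) (j : ℕ), cocycles (augmentationGrading 𝒜) n j) ≤ (V.comap π).map ι := by
    refine iSup_le fun n => iSup_le fun j => fun f hf => ?_
    refine ⟨⟨f, mem_cocycleAlgebra 𝒜 hf⟩, ?_, rfl⟩
    exact Submodule.mem_iSup_of_mem n (Submodule.mem_iSup_of_mem j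
      ((YonedaAlgebra.mem_bigraded 𝒜).2 ⟨f, hf, rfl⟩))
  rw [eq_top_iff]
  intro y _
  obtain ⟨x, rfl⟩ := Ideal.Quotient.mk_surjective y
  obtain ⟨x', hx', hxx⟩ := h x.2
  have : x' = x := Subtype.ext hxx
  subst this
  exact hx'

theorem YonedaAlgebra.fg_bigraded {n j : ℕ}
    [FiniteDimensional k (homogeneous (augmentationGrading 𝒜) n j)] :
    (YonedaAlgebra.bigraded 𝒜 n j).FG := by
  refine Submodule.FG.map _ (Submodule.fg_of_fg_map_injective
    (cocycleAlgebra (augmentationGrading 𝒜)).val.toLinearMap Subtype.val_injective ?_)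
  have h : ((cocycles (augmentationGrading 𝒜) n j).comap
      (cocycleAlgebra (augmentationGrading 𝒜)).val.toLinearMap).map
      (cocycleAlgebra (augmentationGrading 𝒜)).val.toLinearMap ≤
      homogeneous (augmentationGrading 𝒜) n j :=
    (Submodule.map_comap_le _ _).trans inf_le_left
  have := Submodule.finiteDimensional_of_le h
  exact Module.Finite.iff_fg.1 this

/-- A criterion for finite generation of the Yoneda algebra. -/
theorem YonedaAlgebra.finiteType_of_le_mul {N p q : ℕ} (hp : p < N) (hq : q < N)
    (hfg : ∀ n j, (YonedaAlgebra.bigraded 𝒜 n j).FG)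
    (h : ∀ n j, n < N ∧ j < N ∨ YonedaAlgebra.bigraded 𝒜 n j = ⊥ ∨
      ∃ n' < n, ∃ j', YonedaAlgebra.bigraded 𝒜 n j ≤
        YonedaAlgebra.bigraded 𝒜 p q * YonedaAlgebra.bigraded 𝒜 n' j') :
    Algebra.FiniteType k (YonedaAlgebra 𝒜) := by
  obtain ⟨t, ht⟩ : (⨆ (n : Fin N) (j : Fin N), YonedaAlgebra.bigraded 𝒜 n j).FG :=
    Submodule.fg_iSup _ fun n => Submodule.fg_iSup _ fun j => hfg n j
  have hsmall : ∀ n j : ℕ, n < N → j < N →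
      YonedaAlgebra.bigraded 𝒜 n j ≤ (Algebra.adjoin k (t : Set (YonedaAlgebra 𝒜))).toSubmodule := by
    intro n j hn hj
    refine le_trans ?_ (Algebra.span_le_adjoin k _)
    rw [ht]
    exact le_iSup_of_le (⟨n, hn⟩ : Fin N) (le_iSup_of_le (⟨j, hj⟩ : Fin N) le_rfl)
  refine ⟨⟨t, ?_⟩⟩
  rw [← Algebra.toSubmodule_eq_top, eq_top_iff, ← YonedaAlgebra.iSup_bigraded]
  refine iSup_le fun n => ?_
  induction n using Nat.strong_induction_on with
  | _ n ih =>
    refine iSup_le fun j => ?_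
    rcases h n j with h | h | ⟨n', hn', j', h⟩
    · exact hsmall n j h.1 h.2
    · rw [h]; exact bot_le
    · refine h.trans (Submodule.mul_le.2 fun x hx y hy => ?_)
      have h1 : x ∈ Algebra.adjoin k (t : Set (YonedaAlgebra 𝒜)) := hsmall p q hp hq hx
      have h2 : y ∈ Algebra.adjoin k (t : Set (YonedaAlgebra 𝒜)) :=
        ih n' hn' (Submodule.mem_iSup_of_mem j' hy)
      exact Subalgebra.mul_mem _ h1 h2

end Yoneda

theorem bigraded_C_le_mul (k : Type u) [Field k] (n : ℕ) {j : ℕ} (hj : 2 ≤ j) :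
    YonedaAlgebra.bigraded (QuotAlgebra.grading (idealC k)) (n + 2) (j + 4) ≤
      YonedaAlgebra.bigraded (QuotAlgebra.grading (idealC k)) 2 4 *
        YonedaAlgebra.bigraded (QuotAlgebra.grading (idealC k)) n j := by
  intro y hy
  obtain ⟨f, hf, rfl⟩ := (YonedaAlgebra.mem_bigraded (QuotAlgebra.grading (idealC k))).1 hy
  have hb := isWordBasis_augBasis k
  obtain ⟨χ, hχ, h⟩ := hb.exists_quart_mul hj hf
  rw [YonedaAlgebra.mk_eq_mul _ hf hb.quartCochain_mem hχ h]
  exact Submodule.mul_mem_mul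
    ((YonedaAlgebra.mem_bigraded _).2 ⟨_, hb.quartCochain_mem, rfl⟩)
    ((YonedaAlgebra.mem_bigraded _).2 ⟨_, hχ, rfl⟩)

/-- The bidegrees with n, j < 6 supply the generators. If j < 6 ≤ n there are no cochains, since
each entry has degree at least 1. If j ≥ 6, the class vanishes for n < 2 and is divisible by that of
z⁴ otherwise. -/
theorem finiteType_yonedaAlgebra_C (k : Type u) [Field k] :
    Algebra.FiniteType k (YonedaAlgebra (QuotAlgebra.grading (idealC k))) := by
  have hb := isWordBasis_augBasis k
  refine YonedaAlgebra.finiteType_of_le_mul (N := 6) (p := 2) (q := 4) _ (by omega) (by omega)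
    (fun n j => ?_) fun n j => ?_
  · have := hb.finiteDimensional_homogeneous n j
    exact YonedaAlgebra.fg_bigraded _
  · by_cases hj : j < 6
    · by_cases hn : n < 6
      · exact Or.inl ⟨hn, hj⟩
      · refine Or.inr (Or.inl (YonedaAlgebra.bigraded_eq_bot _ fun f hf => ?_))
        rw [hb.eq_zero_of_lt (by omega) hf.1]
        exact zero_mem _
    · refine Or.inr ?_
      match n with
      | 0 => exact Or.inl (YonedaAlgebra.bigraded_eq_bot _
          (cocycles_le_coboundaries_of_koszulDegree_lt k 0 j (by simp [koszulDegree]; omega)))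
      | 1 => exact Or.inl (YonedaAlgebra.bigraded_eq_bot _
          (cocycles_le_coboundaries_of_koszulDegree_lt k 1 j (by simp [koszulDegree]; omega)))
      | n + 2 =>
        obtain ⟨j, rfl⟩ : ∃ j', j = j' + 4 := ⟨j - 4, by omega⟩
        exact Or.inr ⟨n, by omega, j, bigraded_C_le_mul k n (by omega)⟩

/-! ### A nonzero class in `E^{4,5}` -/

open PWord BarCochain

namespace BarCochain

section Detect

variable {k : Type u} {M : Type v} [Field k] [NonUnitalRing M] [Module k M]

theorem IsMultilinear.sub_append {f : BarCochain k M} (hf : IsMultilinear f) (l r : List M)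
    (x y : M) : f (l ++ (x - y) :: r) = f (l ++ x :: r) - f (l ++ y :: r) := by
  rw [eq_sub_iff_add_eq, ← hf.add, sub_add_cancel]

theorem IsMultilinear.zero_append {f : BarCochain k M} (hf : IsMultilinear f) (l r : List M) :
    f (l ++ 0 :: r) = 0 := by
  have := hf.smul l r 0 0
  simpa using this

/-- Evaluation at a cycle of the bar construction of bidegree `(4, 5)`. -/
def detect (e : GenA → M) : BarCochain k M →ₗ[k] k where
  toFun f := f [e .n, e .p - e .r, e .s - e .t, e .y * (e .a - e .b)] +
    f [e .n, e .q - e .r, e .t - e .u, e .y * (e .a - e .b)]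
  map_add' f g := by simp only [add_apply]; ring
  map_smul' c f := by simp only [smul_apply, RingHom.id_apply, smul_eq_mul]; ring

theorem detect_apply (e : GenA → M) (f : BarCochain k M) : detect e f =
    f [e .n, e .p - e .r, e .s - e .t, e .y * (e .a - e .b)] +
      f [e .n, e .q - e .r, e .t - e .u, e .y * (e .a - e .b)] := rfl

/-- The evaluated chain is a cycle: n annihilates p − r and q − r from the left, s − t and t − u
annihilate y(a − b), and the two middle products (p − r)(s − t) and (q − r)(t − u) cancel. -/
theorem detect_d {e : GenA → M}
    (he : ∀ c ∈ relationTriples, e c.1 * e c.2.1 = e c.1 * e c.2.2)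
    {g : BarCochain k M} (hg : IsMultilinear g) : detect e (d g) = 0 := by
  simp only [relationTriples, List.forall_mem_cons, List.not_mem_nil, false_implies,
    implies_true, and_true] at he
  obtain ⟨h1, h2, h3, h4, h5, h6, h7, h8, h9, h10, h11, h12, h13, h14⟩ := he
  have e1 : e .n * (e .p - e .r) = 0 := by rw [mul_sub, h2, sub_self]
  have e2 : e .n * (e .q - e .r) = 0 := by rw [mul_sub, ← h1, h2, sub_self]
  have e3 : (e .p - e .r) * (e .s - e .t) = e .r * e .t - e .r * e .s := by
    rw [sub_mul, mul_sub, mul_sub, h3]; abel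
  have e4 : (e .q - e .r) * (e .t - e .u) = e .r * e .s - e .r * e .t := by
    rw [sub_mul, mul_sub, mul_sub, h4, h5]; abel
  have f1 : e .s * (e .y * (e .a - e .b)) = 0 := by
    rw [← mul_assoc, ← h9, mul_assoc, mul_sub, h12, sub_self, mul_zero]
  have f2 : e .t * (e .y * (e .a - e .b)) = 0 := by
    rw [← mul_assoc, ← h10, mul_assoc, mul_sub, h13, sub_self, mul_zero]
  have f3 : e .u * (e .y * (e .a - e .b)) = 0 := by
    rw [← mul_assoc, ← h11, mul_assoc, mul_sub, h14, sub_self, mul_zero]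
  have e5 : (e .s - e .t) * (e .y * (e .a - e .b)) = 0 := by rw [sub_mul, f1, f2, sub_zero]
  have e6 : (e .t - e .u) * (e .y * (e .a - e .b)) = 0 := by rw [sub_mul, f2, f3, sub_zero]
  have z1 : ∀ l, g (0 :: l) = 0 := hg.zero_cons
  have z3 : ∀ x y, g [x, y, 0] = 0 := fun x y => hg.zero_append [x, y] []
  have s2 : ∀ x y y' z, g [x, y - y', z] = g [x, y, z] - g [x, y', z] :=
    fun x y y' z => hg.sub_append [x] [z] y y'
  simp only [detect_apply, d_cons, tail_apply, d_singleton, e1, e2, e3, e4, e5, e6, z1, z3, s2]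
  ring

theorem detect_eq_zero {ℳ : ℕ → Submodule k M}
    (hmul : ∀ i j x y, x ∈ ℳ i → y ∈ ℳ j → x * y ∈ ℳ (i + j)) {e : GenA → M}
    (he : ∀ x, e x ∈ ℳ 1) {n j : ℕ} (h : ¬ (n = 4 ∧ j = 5)) {f : BarCochain k M}
    (hf : f ∈ homogeneous ℳ n j) : detect e f = 0 := by
  have key : ∀ x y z t : M, x ∈ ℳ 1 → y ∈ ℳ 1 → z ∈ ℳ 1 → t ∈ ℳ 2 → f [x, y, z, t] = 0 := by
    intro x y z t hx hy hz ht
    by_cases hn : n = 4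
    · exact hf.2.2.2 _ [1, 1, 1, 2] (.cons hx (.cons hy (.cons hz (.cons ht .nil))))
        fun h5 => h ⟨hn, h5.symm⟩
    · exact hf.2.2.1 _ fun h4 => hn h4.symm
  have hs : ∀ x y, e x - e y ∈ ℳ 1 := fun x y => sub_mem (he x) (he y)
  have ht := hmul 1 1 _ _ (he .y) (hs .a .b)
  rw [detect_apply, key _ _ _ _ (he _) (hs _ _) (hs _ _) ht,
    key _ _ _ _ (he _) (hs _ _) (hs _ _) ht, add_zero]

end Detect

/-! ### Pulling cochains back along homomorphisms -/

section Comap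

variable {k : Type u} [Field k] {M N : Type v} [NonUnitalRing M] [Module k M] [NonUnitalRing N]
  [Module k N] (F : M →ₙₐ[k] N)

/-- The pullback of cochains. -/
def comap (f : BarCochain k N) : BarCochain k M := fun l => f (l.map F)

theorem map_contract : ∀ (i : ℕ) (l : List M), (contract i l).map F = contract i (l.map F)
  | 0, [] => rfl
  | 0, [_] => rfl
  | 0, x :: y :: l => by simp [contract]
  | i + 1, [] => rfl
  | i + 1, x :: l => by simp [contract, map_contract i l]

theorem d_comap (f : BarCochain k N) : d (comap F f) = comap F (d f) := by
  ext l
  simp only [comap, d_apply, List.length_map, map_contract]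

theorem comap_mem_cocycles {ℳ : ℕ → Submodule k M} {𝒩 : ℕ → Submodule k N}
    (hF : ∀ i, ∀ x ∈ ℳ i, F x ∈ 𝒩 i) {n j : ℕ} {f : BarCochain k N} (hf : f ∈ cocycles 𝒩 n j) :
    comap F f ∈ cocycles ℳ n j := by
  refine ⟨⟨fun a b x y => ?_, fun a b c x => ?_, fun l hl => ?_, fun l e he hj => ?_⟩, ?_⟩
  · simp only [comap, List.map_append, List.map_cons, map_add, hf.1.1]
  · simp only [comap, List.map_append, List.map_cons, map_smul, hf.1.2.1]
  · exact hf.1.2.2.1 _ (by simpa using hl)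
  · refine hf.1.2.2.2 _ e ?_ hj
    rw [List.forall₂_map_left_iff]
    exact he.imp fun x i hx => hF i x hx
  · have h : d f = 0 := hf.2
    change d _ = 0
    rw [d_comap, h]
    rfl

theorem detect_comap (e : GenA → M) (f : BarCochain k N) :
    detect e (comap F f) = detect (fun x => F (e x)) f := by
  simp only [detect_apply, comap, List.map_cons, List.map_nil, map_sub, map_mul]

end Comap

end BarCochain

/-- The layers of the letters of a word, in order. -/
def PWord.layers (w : PWord) : List ℕ := (w.1.map layer).reverse

theorem PWord.layers_of_mul {w v u : PWord} (h : mul w v = some u) :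
    u.layers = w.layers ++ v.layers := by
  rw [layers, map_layer_of_mul h, List.reverse_append]; rfl

/-- Contraction preserves the sequence of layers of a list, so lists with different sequences do not
interact under the differential. -/
theorem delta_eq_zero_of_layers {R : Type*} [AddCommGroup R] (l : List PWord) :
    ∀ (P : List ℕ → Prop) (φ : List PWord → R),
      (∀ l', P (l'.flatMap PWord.layers) → φ l' = 0) → P (l.flatMap PWord.layers) →
      delta PWord.mul l φ = 0 := by
  induction l with
  | nil => intros; rfl
  | cons w l ih =>
    intro P φ hφ hl
    match l, ih with
    | [], _ => rfl
    | v :: l, ih =>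
      rw [delta, ih (fun t => P (w.layers ++ t)) _ (fun l' h => hφ (w :: l') h) hl, sub_zero]
      cases hu : PWord.mul w v with
      | none => rfl
      | some u =>
        refine hφ _ ?_
        rw [List.flatMap_cons, layers_of_mul hu]
        simpa using hl

/-- The values on lists of words of a cocycle of bidegree `(4, 5)`. -/
def listClassFun (m : List (List Letter)) : ℤ :=
  if m = [[.inl .p, .inl .n], [.inl .s], [.inl .v], [.inl .a]] ∨
    m = [[.inl .n], [.inl .s, .inl .p], [.inl .v], [.inl .a]] ∨
    m = [[.inl .n], [.inl .s, .inl .q], [.inl .v], [.inl .a]] ∨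
    m = [[.inl .n], [.inl .p], [.inl .v, .inl .t], [.inl .a]] then 1
  else if m = [[.inl .n], [.inl .s, .inl .r], [.inl .w], [.inl .a]] ∨
    m = [[.inl .n], [.inl .r], [.inl .y, .inl .s], [.inl .a]] ∨
    m = [[.inl .n], [.inl .r], [.inl .w, .inl .u], [.inl .a]] ∨
    m = [[.inl .n], [.inl .r], [.inl .s], [.inl .a, .inl .y]] then -1
  else 0

/-- The values on lists of normal words of a cocycle of bidegree `(4, 5)`. -/
def classFun (l : List PWord) : ℤ := listClassFun (l.map Subtype.val)

theorem classFun_ne_zero {l : List PWord} (h : classFun l ≠ 0) :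
    l.length = 4 ∧ totalDegree PWord.length l = 5 ∧ l.flatMap PWord.layers = [1, 2, 3, 4, 5] := by
  have e1 : l.length = (l.map Subtype.val).length := by simp
  have e2 : totalDegree PWord.length l = ((l.map Subtype.val).map List.length).sum := by
    rw [List.map_map]; rfl
  have e3 : l.flatMap PWord.layers =
      (l.map Subtype.val).flatMap fun w => (w.map layer).reverse := by
    rw [List.flatMap_map]; rfl
  rw [e1, e2, e3]
  unfold classFun at h
  generalize l.map Subtype.val = m at h ⊢
  unfold listClassFun at h
  split_ifs at h with h1 h1
  · rcases h1 with rfl | rfl | rfl | rfl <;> decide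
  · rcases h1 with rfl | rfl | rfl | rfl <;> decide
  · exact absurd rfl h

/-- The check is made over the integers and therefore serves every field. -/
theorem delta_classFun_single : ∀ x₁, layer x₁ = 1 → ∀ x₂, layer x₂ = 2 → ∀ x₃, layer x₃ = 3 →
    ∀ x₄, layer x₄ = 4 → ∀ x₅, layer x₅ = 5 →
    delta PWord.mul [.single x₁, .single x₂, .single x₃, .single x₄, .single x₅] classFun = 0 := by
  decide +kernel

theorem delta_classFun {l : List PWord} (hl : l.length = 5) : delta PWord.mul l classFun = 0 := by
  by_cases h : l.flatMap PWord.layers = [1, 2, 3, 4, 5]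
  · obtain ⟨w₁, w₂, w₃, w₄, w₅, rfl⟩ : ∃ w₁ w₂ w₃ w₄ w₅, l = [w₁, w₂, w₃, w₄, w₅] := by
      match l, hl with
      | [w₁, w₂, w₃, w₄, w₅], _ => exact ⟨w₁, w₂, w₃, w₄, w₅, rfl⟩
    -- Five nonempty words with five letters in total are single letters, which leaves a finite
    -- check.
    have hlen := congrArg List.length h
    simp only [List.flatMap_cons, List.flatMap_nil, List.length_append, layers, List.length_reverse,
      List.length_map, List.length_nil, List.length_cons] at hlen
    have single : ∀ w : PWord, w.1.length = 1 → ∃ x, w = .single x := by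
      intro w hw
      obtain ⟨x, hx⟩ := List.length_eq_one_iff.1 hw
      exact ⟨x, Subtype.ext hx⟩
    have p₁ : 0 < w₁.1.length := w₁.length_pos
    have p₂ : 0 < w₂.1.length := w₂.length_pos
    have p₃ : 0 < w₃.1.length := w₃.length_pos
    have p₄ : 0 < w₄.1.length := w₄.length_pos
    have p₅ : 0 < w₅.1.length := w₅.length_pos
    obtain ⟨x₁, rfl⟩ := single w₁ (by omega)
    obtain ⟨x₂, rfl⟩ := single w₂ (by omega)
    obtain ⟨x₃, rfl⟩ := single w₃ (by omega)
    obtain ⟨x₄, rfl⟩ := single w₄ (by omega)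
    obtain ⟨x₅, rfl⟩ := single w₅ (by omega)
    have h' : [layer x₁, layer x₂, layer x₃, layer x₄, layer x₅] = [1, 2, 3, 4, 5] := h
    simp only [List.cons.injEq, and_true] at h'
    exact delta_classFun_single x₁ h'.1 x₂ h'.2.1 x₃ h'.2.2.1 x₄ h'.2.2.2.1 x₅ h'.2.2.2.2
  · refine delta_eq_zero_of_layers l (fun t => t ≠ [1, 2, 3, 4, 5]) _ (fun l' hl' => ?_) h
    by_contra h0
    exact hl' (classFun_ne_zero h0).2.2

/-! ### The cocycle of bidegree (4, 5) -/

section ClassCochain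

variable {k : Type u} {M : Type v} [Field k] [NonUnitalRing M] [Module k M]
  [IsScalarTower k M M] [SMulCommClass k M M]
  {ℳ : ℕ → Submodule k M} {b : Module.Basis PWord k M}

variable (b) in
/-- A cocycle of bidegree `(4, 5)`. -/
noncomputable def classCochain : BarCochain k M := extend b fun l => (classFun l : k)

theorem IsWordBasis.classCochain_mem (hb : IsWordBasis ℳ b) :
    classCochain b ∈ cocycles ℳ 4 5 := by
  have hh : classCochain b ∈ homogeneous ℳ 4 5 := by
    refine extend_mem_homogeneous b PWord.length hb.deg fun l hl => ?_
    have h := classFun_ne_zero (l := l) fun h => hl (by simp [h])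
    exact ⟨h.1, h.2.1⟩
  refine ⟨hh, ?_⟩
  have hml := isMultilinear_of_mem hh
  refine IsMultilinear.ext_basis b hml.d ⟨by simp, by simp⟩ fun l => ?_
  by_cases hl : l.length = 5
  · rw [d_map_basis PWord.mul b hb.mul _ _ hml]
    simp only [classCochain, extend_map]
    have := map_delta PWord.mul (Int.castAddHom k) l classFun
    rw [delta_classFun hl, map_zero] at this
    exact this.symm
  · exact (d_mem_homogeneous hb.mul_mem hh).2.2.1 _ (by simpa using hl)

theorem classCochain_map (w₁ w₂ w₃ w₄ : PWord) :
    classCochain b [b w₁, b w₂, b w₃, b w₄] = (classFun [w₁, w₂, w₃, w₄] : k) :=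
  extend_map b [w₁, w₂, w₃, w₄] _

/-- When the cycle is expanded, only n|r|s|ya meets the support of the cocycle. Its coefficient is
−1, from p − r, and the value there is −1. -/
theorem IsWordBasis.detect_classCochain (hb : IsWordBasis ℳ b) :
    detect (fun x => b (.single (.inl x))) (classCochain b) = 1 := by
  have hml := isMultilinear_of_mem hb.classCochain_mem.1
  let ya : PWord := ⟨[.inl .a, .inl .y], by decide⟩
  let yb : PWord := ⟨[.inl .b, .inl .y], by decide⟩
  have h1 : b (.single (.inl .y)) * b (.single (.inl .a)) = b ya := by
    rw [hb.mul, show PWord.mul (.single (.inl .y)) (.single (.inl .a)) = some ya by decide]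
    rfl
  have h2 : b (.single (.inl .y)) * b (.single (.inl .b)) = b yb := by
    rw [hb.mul, show PWord.mul (.single (.inl .y)) (.single (.inl .b)) = some yb by decide]
    rfl
  have s2 : ∀ x y y' z t, classCochain b [x, y - y', z, t] =
      classCochain b [x, y, z, t] - classCochain b [x, y', z, t] :=
    fun x y y' z t => hml.sub_append [x] [z, t] y y'
  have s3 : ∀ x y z z' t, classCochain b [x, y, z - z', t] =
      classCochain b [x, y, z, t] - classCochain b [x, y, z', t] :=
    fun x y z z' t => hml.sub_append [x, y] [t] z z'
  have s4 : ∀ x y z t t', classCochain b [x, y, z, t - t'] =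
      classCochain b [x, y, z, t] - classCochain b [x, y, z, t'] :=
    fun x y z t t' => hml.sub_append [x, y, z] [] t t'
  have ha : ∀ g h : GenA, g ≠ .r ∨ h ≠ .s →
      classFun [.single (.inl .n), .single (.inl g), .single (.inl h), ya] = 0 := by decide
  have hr : classFun [.single (.inl .n), .single (.inl .r), .single (.inl .s), ya] = -1 := by decide
  have hb' : ∀ g h : GenA,
      classFun [.single (.inl .n), .single (.inl g), .single (.inl h), yb] = 0 := by decide
  rw [detect_apply]
  simp only [mul_sub, h1, h2, s2, s3, s4, classCochain_map, hr, hb']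
  simp [ha]

end ClassCochain

/-! ### Failure of generation in low degrees -/

open PWord BarCochain

section Parity

variable {k : Type u} {M : Type v} [Field k] [NonUnitalRing M] [Module k M]

/-- The algebra of cocycles whose cohomological and internal degrees have the same parity. -/
def evenCocycles (ℳ : ℕ → Submodule k M) : Subalgebra k (BarCochain k M) :=
  (⨆ p : {p : ℕ × ℕ // Even (p.1 + p.2)}, cocycles ℳ p.1.1 p.1.2).toSubalgebra
    (Submodule.mem_iSup_of_mem ⟨(0, 0), by simp⟩ one_mem_cocycles)
    (by
      intro f g hf hg
      refine (?_ : (⨆ p : {p : ℕ × ℕ // Even (p.1 + p.2)}, cocycles ℳ p.1.1 p.1.2) *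
        (⨆ p : {p : ℕ × ℕ // Even (p.1 + p.2)}, cocycles ℳ p.1.1 p.1.2) ≤ _)
        (Submodule.mul_mem_mul hf hg)
      simp only [Submodule.iSup_mul, Submodule.mul_iSup, iSup_le_iff]
      intro p q
      refine Submodule.mul_le.2 fun a ha b hb => ?_
      exact Submodule.mem_iSup_of_mem (p := fun p : {p : ℕ × ℕ // Even (p.1 + p.2)} =>
        cocycles ℳ p.1.1 p.1.2) ⟨(q.1.1 + p.1.1, q.1.2 + p.1.2), by
          have := q.2.add p.2
          rwa [add_add_add_comm] at this⟩ (mul_mem_cocycles ha hb))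

theorem mem_evenCocycles {ℳ : ℕ → Submodule k M} {n j : ℕ} (h : Even (n + j))
    {f : BarCochain k M} (hf : f ∈ cocycles ℳ n j) : f ∈ evenCocycles ℳ :=
  Submodule.mem_iSup_of_mem (p := fun p : {p : ℕ × ℕ // Even (p.1 + p.2)} =>
    cocycles ℳ p.1.1 p.1.2) ⟨(n, j), h⟩ hf

variable {A : Type v} [Ring A] [Algebra k A] (𝒜 : ℕ → Submodule k A) [SetLike.GradedMonoid 𝒜]

/-- If `E(A)` has a class of odd total degree, then it is not generated by components that are
concentrated in even total degrees. -/
theorem YonedaAlgebra.adjoin_ne_top (S : Set (YonedaAlgebra 𝒜))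
    (hS : ∀ s ∈ S, ∃ i, s ∈ YonedaAlgebra.component 𝒜 i ∧
      ∀ j, YonedaAlgebra.bigraded 𝒜 i j = ⊥ ∨ Even (i + j))
    (Φ : BarCochain k (augmentationIdeal 𝒜) →ₗ[k] k)
    (hcob : ∀ n j, ∀ f ∈ coboundaries (augmentationGrading 𝒜) n j, Φ f = 0)
    (heven : ∀ n j, Even (n + j) → ∀ f ∈ cocycles (augmentationGrading 𝒜) n j, Φ f = 0)
    {n j : ℕ} {f : BarCochain k (augmentationIdeal 𝒜)}
    (hf : f ∈ cocycles (augmentationGrading 𝒜) n j) (hΦ : Φ f ≠ 0) :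
    Algebra.adjoin k S ≠ ⊤ := by
  intro htop
  set π := Ideal.Quotient.mkₐ k (coboundaryIdeal (augmentationGrading 𝒜)) with hπ
  set ι := (cocycleAlgebra (augmentationGrading 𝒜)).val with hι
  set Q := ((evenCocycles (augmentationGrading 𝒜)).comap ι).map π with hQ
  have h1 : Algebra.adjoin k S ≤ Q := by
    refine Algebra.adjoin_le fun s hs => ?_
    obtain ⟨i, hi, hij⟩ := hS s hs
    refine (iSup_le fun j => ?_ : YonedaAlgebra.component 𝒜 i ≤ Subalgebra.toSubmodule Q) hi
    rcases hij j with h | h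
    · rw [h]; exact bot_le
    · rintro _ ⟨x, hx, rfl⟩
      exact ⟨x, mem_evenCocycles h hx, rfl⟩
  -- Generation by `S` would make the class of `f` equal to that of an even cocycle, up to
  -- coboundaries. The functional kills even cocycles and coboundaries, but not `f`.
  have h2 : YonedaAlgebra.mk 𝒜 f hf ∈ Q := h1 (htop ▸ Algebra.mem_top)
  obtain ⟨x, hx, hxf⟩ := h2
  have h3 := Ideal.Quotient.eq.1 hxf
  have h4 : Φ (x.1 - f) = 0 :=
    (iSup_le fun n => iSup_le fun j => fun g hg => hcob n j g hg :
      (⨆ (n : ℕ) (j : ℕ), coboundaries (augmentationGrading 𝒜) n j) ≤ LinearMap.ker Φ) h3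
  have h5 : Φ x.1 = 0 :=
    (iSup_le fun p => fun g hg => heven _ _ p.2 g hg :
      (⨆ p : {p : ℕ × ℕ // Even (p.1 + p.2)},
        cocycles (augmentationGrading 𝒜) p.1.1 p.1.2) ≤ LinearMap.ker Φ) hx
  rw [map_sub, h5, zero_sub, neg_eq_zero] at h4
  exact hΦ h4

variable {X : Type} (I : TwoSidedIdeal (FreeAlgebra k X))

theorem bigraded_one_eq_bot_or (j : ℕ) :
    YonedaAlgebra.bigraded (QuotAlgebra.grading I) 1 j = ⊥ ∨ Even (1 + j) := by
  by_cases hj : j = 1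
  · exact Or.inr (by subst hj; decide)
  · refine Or.inl (YonedaAlgebra.bigraded_eq_bot _ fun f hf => ?_)
    rw [eq_zero_of_mem_cocycles_one I hj hf]
    exact zero_mem _

/-- If the letters satisfy the relations of `A` and some cocycle of bidegree `(4, 5)` is detected by
`detect`, then the Yoneda algebra is not generated by components of even total degree. -/
theorem adjoin_ne_top_of_detect {e : GenA → X}
    (he : ∀ c ∈ relationTriples, augGen I (e c.1) * augGen I (e c.2.1) =
      augGen I (e c.1) * augGen I (e c.2.2))
    {n j : ℕ} {f : BarCochain k (augmentationIdeal (QuotAlgebra.grading I))}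
    (hf : f ∈ cocycles (augmentationGrading (QuotAlgebra.grading I)) n j)
    (hdet : detect (fun x => augGen I (e x)) f ≠ 0)
    (S : Set (YonedaAlgebra (QuotAlgebra.grading I)))
    (hS : ∀ s ∈ S, ∃ i, s ∈ YonedaAlgebra.component (QuotAlgebra.grading I) i ∧
      ∀ j, YonedaAlgebra.bigraded (QuotAlgebra.grading I) i j = ⊥ ∨ Even (i + j)) :
    Algebra.adjoin k S ≠ ⊤ := by
  refine YonedaAlgebra.adjoin_ne_top _ S hS (detect fun x => augGen I (e x))
    (fun n j g hg => ?_) (fun n j h g hg => ?_) hf hdet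
  · cases n with
    | zero =>
      have : g = 0 := hg
      rw [this, map_zero]
    | succ n =>
      obtain ⟨g', hg', rfl⟩ := hg.2
      exact detect_d he (isMultilinear_of_mem hg')
  · refine detect_eq_zero (augmentationGrading_mul _) (fun x => augGen_mem I _) ?_ hg.1
    rintro ⟨rfl, rfl⟩
    exact absurd h (by decide)

end Parity

/-! ### Failure of generation for `A` and `C` -/

section Main

variable (k : Type u) [Field k]

theorem augGen_idealC (x : Letter) : augGen (idealC k) x = augBasis k (.single x) := by
  apply Subtype.ext
  rw [coe_augBasis]
  exact (one_mul _).symm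

theorem detect_classCochain_C :
    detect (fun x => augGen (idealC k) (.inl x)) (classCochain (augBasis k)) = 1 := by
  simp only [augGen_idealC]
  exact (isWordBasis_augBasis k).detect_classCochain

/-- The components E¹ and E² are concentrated in even total degree, by the vanishing of E^{1,j} for
j ≠ 1 and of E^{2,j} for j ≠ 2, 4, while the detected class has bidegree (4, 5). -/
theorem not_isK2_C : ¬ IsK2 (QuotAlgebra.grading (idealC k)) := by
  refine adjoin_ne_top_of_detect (idealC k) (e := Sum.inl)
    (fun c hc => Subtype.ext ((satisfiesRelations_genC k).quad c hc))
    (isWordBasis_augBasis k).classCochain_mem (by rw [detect_classCochain_C]; exact one_ne_zero)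
    _ fun s hs => ?_
  rcases hs with hs | hs
  · exact ⟨1, hs, bigraded_one_eq_bot_or _⟩
  · refine ⟨2, hs, fun j => ?_⟩
    by_cases h2 : j = 2
    · exact Or.inr (by subst h2; decide)
    by_cases h4 : j = 4
    · exact Or.inr (by subst h4; decide)
    exact Or.inl (YonedaAlgebra.bigraded_eq_bot _
      ((isWordBasis_augBasis k).cocycles_two_le h2 h4))

theorem inclA_gen (x : GenA) :
    inclA k (QuotAlgebra.gen (idealA k) x) = QuotAlgebra.gen (idealC k) (.inl x) := by
  simp [inclA]

theorem inclA_mem_grading {j : ℕ} {c : QuotAlgebra (idealA k)}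
    (hc : c ∈ QuotAlgebra.grading (idealA k) j) :
    inclA k c ∈ QuotAlgebra.grading (idealC k) j := by
  have h : (QuotAlgebra.grading (idealA k) j).map (inclA k).toLinearMap ≤
      QuotAlgebra.grading (idealC k) j := by
    rw [QuotAlgebra.grading, QuotAlgebra.grading, Submodule.map_pow, Submodule.map_span]
    refine pow_le_pow_left' (Submodule.span_mono ?_) j
    rintro _ ⟨_, ⟨x, rfl⟩, rfl⟩
    exact ⟨.inl x, (inclA_gen k x).symm⟩
  exact h ⟨c, hc, rfl⟩

theorem inclA_mem_augmentationIdeal {c : QuotAlgebra (idealA k)}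
    (hc : c ∈ augmentationIdeal (QuotAlgebra.grading (idealA k))) :
    inclA k c ∈ augmentationIdeal (QuotAlgebra.grading (idealC k)) :=
  (iSup_le fun j => fun _ hx =>
    mem_augmentationIdeal _ j.succ_ne_zero (inclA_mem_grading k hx) :
    (⨆ j : ℕ, QuotAlgebra.grading (idealA k) (j + 1)) ≤
      (augmentationIdeal (QuotAlgebra.grading (idealC k))).toSubmodule.comap
        (inclA k).toLinearMap) hc

/-- The inclusion of the augmentation ideal of `A` in that of `C`. -/
noncomputable def augInclA : augmentationIdeal (QuotAlgebra.grading (idealA k)) →ₙₐ[k] AugC k where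
  toFun c := ⟨inclA k c, inclA_mem_augmentationIdeal k c.2⟩
  map_smul' r c := Subtype.ext (map_smul (inclA k) r c.1)
  map_zero' := Subtype.ext (map_zero (inclA k))
  map_add' c c' := Subtype.ext (map_add (inclA k) c.1 c'.1)
  map_mul' c c' := Subtype.ext (map_mul (inclA k) c.1 c'.1)

theorem augInclA_augGen (x : GenA) :
    augInclA k (augGen (idealA k) x) = augGen (idealC k) (.inl x) :=
  Subtype.ext (inclA_gen k x)

/-- The cocycle is pulled back along the inclusion of augmentation ideals. The detecting cycle
involves only letters of `A`, so the value 1 persists. -/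
theorem not_isKoszul_A : ¬ IsKoszul (QuotAlgebra.grading (idealA k)) := by
  refine adjoin_ne_top_of_detect (idealA k) (e := id)
    (fun c hc => Subtype.ext ((satisfiesRelations_genA k).quad c hc))
    (comap_mem_cocycles (augInclA k) (fun i x hx => inclA_mem_grading k hx)
      (isWordBasis_augBasis k).classCochain_mem) ?_
    _ fun s hs => ⟨1, hs, bigraded_one_eq_bot_or _⟩
  rw [detect_comap]
  simp only [id, augInclA_augGen]
  rw [detect_classCochain_C]
  exact one_ne_zero

end Main

theorem mainTheorem2 (k : Type u) [Field k] :
    -- `A` is quadratic, not Koszul, and has finite global dimension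
    IsQuadratic (idealA k) ∧
    ¬ IsKoszul (QuotAlgebra.grading (idealA k)) ∧
    leftGlobalDimension (QuotAlgebra (idealA k)) < ⊤ ∧
    -- `C` is the free product of `A` and `B`
    (∃ (iA : QuotAlgebra (idealA k) →ₐ[k] QuotAlgebra (idealC k))
      (iB : QuotAlgebra (idealB k) →ₐ[k] QuotAlgebra (idealC k)),
      (∀ g, iA (QuotAlgebra.gen (idealA k) g) = QuotAlgebra.gen (idealC k) (Sum.inl g)) ∧
      (∀ g, iB (QuotAlgebra.gen (idealB k) g) = QuotAlgebra.gen (idealC k) (Sum.inr g)) ∧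
      IsFreeProduct iA iB) ∧
    -- `C` is 2-4-determined, has infinite global dimension and a finitely generated Yoneda
    -- algebra, but is not `𝒦₂`
    IsTwoDetermined 4 (idealC k) ∧
    leftGlobalDimension (QuotAlgebra (idealC k)) = ⊤ ∧
    Algebra.FiniteType k (YonedaAlgebra (QuotAlgebra.grading (idealC k))) ∧
    ¬ IsK2 (QuotAlgebra.grading (idealC k)) := by
  exact ⟨isQuadratic_idealA k, not_isKoszul_A k, leftGlobalDimension_A_lt_top k,
    exists_isFreeProduct (idealA k) (idealB k), isTwoDetermined_idealC k,
    leftGlobalDimension_C_eq_top k, finiteType_yonedaAlgebra_C k, not_isK2_C k⟩
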